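/- Work in the upper half plane model of the hyperbolic plane $\mathbb H^2$, on which $\mathrm{PSL}(2,\mathbb R)$ acts by orientation preserving isometries. Let $\gamma=\{x+iy: 0\le x\le 2,\ 1\le y\le 2\}$ (the *core*). For $d\in\{0,1\}$ let the *prong* $P_d$ be the region $\{x+iy : d\le x\le d+1,\ y\le 1,\ |z-d|\ge 1,\ |z-d-1|\ge 1\}$; $P_0$ is one third of the "triangle" enclosed by the three pairwise tangent horoballs $\{y\ge 1\}$, and those of Euclidean diameter $1$ at $0$ and at $1$. The *modified binary tile* $\bar\tau$ is obtained from $\gamma$ by adding the left and right prongs $P_0,P_1$, removing the dent $\{|z|>2,\ |z-2|>2\}$ (into which a doubled prong $2P_0$ fits), adding on the right geodesic edge a bump $\{x\ge 2,\ |z-(2+\tfrac32 i)|\le\tfrac14\}$ and removing the matching dent $\{|z-\tfrac32 i|<\tfrac14\}$ at the left geodesic edge. A *tiling* is a collection of images of $\bar\tau$ under $\mathrm{PSL}(2,\mathbb R)$ that covers $\mathbb H^2$ and whose members have pairwise disjoint interiors; the space of tilings carries the topology of uniform convergence on compact subsets of $\mathbb H^2$, and $\mathrm{PSL}(2,\mathbb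 R)$ acts on it. A tiling is *non-degenerate* if the union of the cores of its tiles is the union of a densest horoball packing, that is, of an image under $\mathrm{PSL}(2,\mathbb R)$ of the packing $\{g\{y\ge 1\} : g\in \mathrm{PSL}(2,\mathbb Z)\}$. The complementary regions of the packing are its triangles. In a non-degenerate tiling, to each triangle and each of the three horoballs $H$ meeting at it there belongs a dyadic integer $\sum_{k\ge 0} a_k2^k\in\mathbb Z_2$, $a_k\in\{0,1\}$: $a_0$ is $0$ or $1$ according to whether the left or the right prong of a tile $t_0$ of $H$ lies in the triangle, and, for $k\ge 0$, $a_{k+1}$ is $0$ or $1$ according to whether the left or the right prong of the parent $t_{k+1}$ of $t_k$ fills the upper dent of $t_k$. For $w\in\mathbb Z_2$ let $\mathcal T_w$ be the closure, in the space of tilings, of the set of non-degenerate tilings for which the three dyadic integers at each triangle have sum $w$. It is invariant under $\mathrm{PSL}(2,\mathbb R)$. **Theorem 5.** Let $w,w'\in\mathbb Z_2$. (a) The actions of $\mathrm{PSL}(2,\mathbb R)$ on $\mathcal T_w$ and $\mathcal T_{w'}$ are topologically conjugate, i.e. there is a $\mathrm{PSL}(2,\mathbb R)$-equivariant homeomorphism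 $\mathcal T_w\to\mathcal T_{w'}$, if and only if $w-w'\in 3\mathbb Z$ (with $\mathbb Z\subset\mathbb Z_2$ the rational integers). (b) For all $w,w'$ the two actions are almost conjugate, i.e. there are invariant subsets $X_0\subset \mathcal T_w$ and $Y_0\subset\mathcal T_{w'}$, each of measure zero with respect to all $\mathrm{PSL}(2,\mathbb R)$-invariant Borel probability measures on $\mathcal T_w$, respectively $\mathcal T_{w'}$, and a $\mathrm{PSL}(2,\mathbb R)$-equivariant homeomorphism $\mathcal T_w\setminus X_0\to\mathcal T_{w'}\setminus Y_0$. -/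

import Mathlib

open scoped UpperHalfPlane MatrixGroups Pointwise Uniformity

noncomputable section

namespace ModifiedBinary

/-! ### The group of motions of the hyperbolic plane -/

/-- `PSL(2, ℝ)`, the group of orientation preserving isometries of the hyperbolic plane `ℍ`. -/
abbrev G : Type := PSL(2, ℝ)

/-- The class in `PSL(2, ℝ)` of a matrix of `SL(2, ℝ)`. -/
def toG : SL(2, ℝ) →* G := QuotientGroup.mk' _

theorem center_smul (g : SL(2, ℝ)) (hg : g ∈ Subgroup.center SL(2, ℝ)) (z : ℍ) : g • z = z := by
  obtain ⟨r, hr, h⟩ := Matrix.SpecialLinearGroup.mem_center_iff.mp hg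
  have hr0 : r ≠ 0 := by
    rintro rfl
    simp at hr
  have h00 : g 0 0 = r := by
    have := congrFun (congrFun h 0) 0
    simpa [Matrix.scalar_apply] using this.symm
  have h01 : g 0 1 = 0 := by
    have := congrFun (congrFun h 0) 1
    simpa [Matrix.scalar_apply] using this.symm
  have h10 : g 1 0 = 0 := by
    have := congrFun (congrFun h 1) 0
    simpa [Matrix.scalar_apply] using this.symm
  have h11 : g 1 1 = r := by
    have := congrFun (congrFun h 1) 1
    simpa [Matrix.scalar_apply] using this.symm
  have hrc : (r : ℂ) ≠ 0 := by exact_mod_cast hr0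
  ext
  rw [UpperHalfPlane.coe_specialLinearGroup_apply]
  simp [h00, h01, h10, h11]
  field_simp

/-- The action of `PSL(2, ℝ)` on `ℍ` by Möbius transformations. -/
instance : MulAction G ℍ :=
  MulAction.compHom ℍ (QuotientGroup.lift (Subgroup.center SL(2, ℝ))
    (MulAction.toPermHom SL(2, ℝ) ℍ) (fun g hg => Equiv.ext fun z => center_smul g hg z))

theorem toG_smul (g : SL(2, ℝ)) (z : ℍ) : toG g • z = g • z := rfl

instance : IsIsometricSMul G ℍ where
  isometry_smul g := by
    obtain ⟨g, rfl⟩ := QuotientGroup.mk_surjective g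
    exact isometry_smul ℍ g

/-- The matrix of `z ↦ s * z + x`, where `0 < s`. -/
def affineMatrix (s x : ℝ) (hs : 0 < s) : SL(2, ℝ) :=
  ⟨!![√s, x / √s; 0, 1 / √s], by
    have := (Real.sqrt_pos.mpr hs).ne'
    simp [Matrix.det_fin_two, this]⟩

/-- The motion `z ↦ s * z + x`, where `0 < s`. -/
def affineMotion (s x : ℝ) (hs : 0 < s) : G := toG (affineMatrix s x hs)

theorem coe_affineMotion_smul (s x : ℝ) (hs : 0 < s) (z : ℍ) :
    ((affineMotion s x hs • z : ℍ) : ℂ) = s * z + x := by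
  have h0 : (√s : ℂ) ≠ 0 := by exact_mod_cast (Real.sqrt_pos.mpr hs).ne'
  have h1 : (s : ℂ) = √s * √s := by exact_mod_cast (Real.mul_self_sqrt hs.le).symm
  rw [affineMotion, toG_smul, UpperHalfPlane.coe_specialLinearGroup_apply]
  rw [h1]
  simp [affineMatrix]
  field_simp

/-- The class in `PSL(2, ℝ)` of an integral matrix. The image of this map is `PSL(2, ℤ)`. -/
def modular : SL(2, ℤ) →* G :=
  toG.comp (Matrix.SpecialLinearGroup.map (Int.castRingHom ℝ))

/-- The rotation `z ↦ 1 / (1 - z)` of order three in `PSL(2, ℤ)`: it permutes the points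
`∞ ↦ 0 ↦ 1 ↦ ∞`. -/
def rotation : SL(2, ℤ) := ⟨!![0, 1; -1, 1], by simp [Matrix.det_fin_two]⟩

/-! ### The modified binary tile -/

/-- The core of the tile: two geodesic edges and two horocyclic edges, with vertices
`i`, `2 + i`, `2i`, `2 + 2i`. -/
def core : Set ℍ := {z | 0 ≤ z.re ∧ z.re ≤ 2 ∧ 1 ≤ z.im ∧ z.im ≤ 2}

/-- The horoball `{Im z ≥ 1}`. Its images under `PSL(2, ℤ)` form the densest horoball packing
(the horoballs of Ford circles). The three pairwise tangent ones at `∞`, `0`, `1` enclose the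
standard triangle. -/
def horoball : Set ℍ := {z | 1 ≤ z.im}

/-- For `d = 0`: the third of the standard triangle adjacent to `horoball`. It is cut off by the
geodesics joining the centre `(1 + i√3) / 2` of the triangle to the points `i` and `1 + i` where
`horoball` touches the horoballs at `0` and at `1`; these geodesics lie on the circles `|z| = 1`
and `|z - 1| = 1`. In general: the translate of this region by `d`. The left and the
right prong of the tile are `prong 0` and `prong 1`. -/
def prong (d : ℝ) : Set ℍ :=
  {z | d ≤ z.re ∧ z.re ≤ d + 1 ∧ z.im ≤ 1 ∧ 1 ≤ ‖(z : ℂ) - d‖ ∧ 1 ≤ ‖(z : ℂ) - (d + 1)‖}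

/-- The dent in the upper horocyclic edge of the core, into which a prong fits: within the core,
this is `z ↦ 2 * z` applied to `prong 0` (without the two geodesic sides). -/
def topDent : Set ℍ := {z | 2 < ‖(z : ℂ)‖ ∧ 2 < ‖(z : ℂ) - 2‖}

/-- The dent in the left geodesic edge of the core. -/
def sideDent : Set ℍ := {z | ‖(z : ℂ) - 3 / 2 * Complex.I‖ < 1 / 4}

/-- The bump on the right geodesic edge of the core. It fits into the side dent of the neighbouring
tile, the translate of this one by `2`. -/
def sideBump : Set ℍ := {z | 2 ≤ z.re ∧ ‖(z : ℂ) - (2 + 3 / 2 * Complex.I)‖ ≤ 1 / 4}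

/-- The modified binary tile. -/
def tile : Set ℍ := (core \ (topDent ∪ sideDent)) ∪ prong 0 ∪ prong 1 ∪ sideBump

/-! ### The space of tilings -/

/-- A tiling of the hyperbolic plane by congruent copies of the modified binary tile. -/
@[ext]
structure Tiling where
  tiles : Set (Set ℍ)
  congruent : ∀ t ∈ tiles, ∃ g : G, t = g • tile
  disjoint : ∀ t ∈ tiles, ∀ t' ∈ tiles, t ≠ t' → Disjoint (interior t) (interior t')
  cover : ⋃₀ tiles = Set.univ

namespace Tiling

/-- The action of `PSL(2, ℝ)` on tilings: each tile is moved by `g`. -/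
instance : MulAction G Tiling where
  smul g T :=
    { tiles := g • T.tiles
      congruent := by
        rintro _ ⟨t, ht, rfl⟩
        obtain ⟨h, rfl⟩ := T.congruent t ht
        exact ⟨g * h, (mul_smul g h tile).symm⟩
      disjoint := by
        rintro _ ⟨t, ht, rfl⟩ _ ⟨t', ht', rfl⟩ hne
        have h := T.disjoint t ht t' ht' (fun h => hne (by rw [h]))
        simp only [interior_smul]
        exact (Set.disjoint_image_iff (MulAction.injective g)).mpr h
      cover := by
        refine Set.eq_univ_of_forall fun z => ?_
        have hz : g⁻¹ • z ∈ ⋃₀ T.tiles := by rw [T.cover]; trivial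
        obtain ⟨t, ht, hzt⟩ := hz
        exact ⟨g • t, Set.smul_mem_smul_set ht, Set.mem_smul_set_iff_inv_smul_mem.mpr hzt⟩ }
  one_smul T := Tiling.ext (one_smul G T.tiles)
  mul_smul g h T := Tiling.ext (mul_smul g h T.tiles)

theorem tiles_smul (g : G) (T : Tiling) : (g • T).tiles = g • T.tiles := rfl

/-- Each tile of `T` that meets the ball of radius `R` about the origin `i` becomes a tile of `T'`
by a motion that moves none of its points by `ε` or more. -/
def Near (R ε : ℝ) (T T' : Tiling) : Prop :=
  ∀ t ∈ T.tiles, (t ∩ Metric.closedBall UpperHalfPlane.I R).Nonempty →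
    ∃ k : G, k • t ∈ T'.tiles ∧ ∀ p ∈ t, dist p (k • p) < ε

/-- The pairs of tilings that agree on the ball of radius `R` about the origin up to motions of
the single tiles by less than `ε`. -/
def entourage (R ε : ℝ) : Set (Tiling × Tiling) :=
  {P | Near R ε P.1 P.2 ∧ Near R ε P.2 P.1}

theorem Near.mono {R R' ε ε' : ℝ} (hR : R ≤ R') (hε : ε' ≤ ε) {T T' : Tiling}
    (h : Near R' ε' T T') : Near R ε T T' := fun t ht hm =>
  have ⟨k, hk, hd⟩ := h t ht (hm.mono (Set.inter_subset_inter_right _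
    (Metric.closedBall_subset_closedBall hR)))
  ⟨k, hk, fun p hp => (hd p hp).trans_le hε⟩

theorem Near.comp {R ε : ℝ} {T T' T'' : Tiling}
    (h : Near (R + ε / 2) (ε / 2) T T') (h' : Near (R + ε / 2) (ε / 2) T' T'') (hε : 0 < ε) :
    Near R ε T T'' := by
  intro t ht hm
  obtain ⟨k, hk, hd⟩ := h t ht (hm.mono (Set.inter_subset_inter_right _
    (Metric.closedBall_subset_closedBall (by linarith))))
  obtain ⟨p, hp, hpR⟩ := hm
  obtain ⟨k', hk', hd'⟩ := h' (k • t) hk ⟨k • p, Set.smul_mem_smul_set hp, by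
    rw [Metric.mem_closedBall] at hpR ⊢
    have h1 := dist_triangle (k • p) p UpperHalfPlane.I
    have h2 := hd p hp
    rw [dist_comm] at h2
    linarith⟩
  refine ⟨k' * k, by rwa [mul_smul], fun q hq => ?_⟩
  have h1 := dist_triangle q (k • q) ((k' * k) • q)
  have h2 := hd q hq
  have h3 := hd' (k • q) (Set.smul_mem_smul_set hq)
  rw [mul_smul] at h1 ⊢
  linarith

theorem Near.smul {R ε : ℝ} {T T' : Tiling} (g : G)
    (h : Near (R + dist (g⁻¹ • UpperHalfPlane.I) UpperHalfPlane.I) ε T T') :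
    Near R ε (g • T) (g • T') := by
  rintro _ ⟨t, ht, rfl⟩ ⟨p, ⟨q, hq, rfl⟩, hpR⟩
  obtain ⟨k, hk, hd⟩ := h t ht ⟨q, hq, by
    rw [Metric.mem_closedBall] at hpR ⊢
    have h1 := dist_triangle q (g⁻¹ • UpperHalfPlane.I) UpperHalfPlane.I
    have h2 : dist q (g⁻¹ • UpperHalfPlane.I) = dist (g • q) UpperHalfPlane.I := by
      rw [← dist_smul g q, smul_inv_smul]
    simp only at hpR
    linarith⟩
  refine ⟨g * k * g⁻¹, ?_, ?_⟩
  · refine ⟨k • t, hk, ?_⟩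
    simp only [mul_smul, inv_smul_smul]
  · rintro _ ⟨q, hq, rfl⟩
    simpa only [mul_smul, inv_smul_smul, dist_smul] using hd q hq

/-- The entourages form a basis of a filter. -/
def basis : FilterBasis (Tiling × Tiling) where
  sets := {E | ∃ R ε : ℝ, 0 < ε ∧ E = entourage R ε}
  nonempty := ⟨_, 0, 1, one_pos, rfl⟩
  inter_sets := by
    rintro _ _ ⟨R, ε, hε, rfl⟩ ⟨R', ε', hε', rfl⟩
    refine ⟨_, ⟨max R R', min ε ε', lt_min hε hε', rfl⟩, fun P hP => ⟨⟨?_, ?_⟩, ⟨?_, ?_⟩⟩⟩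
    · exact hP.1.mono (le_max_left _ _) (min_le_left _ _)
    · exact hP.2.mono (le_max_left _ _) (min_le_left _ _)
    · exact hP.1.mono (le_max_right _ _) (min_le_right _ _)
    · exact hP.2.mono (le_max_right _ _) (min_le_right _ _)

/-- The uniform structure, and with it the topology, of uniform convergence of tilings on compact
subsets of the hyperbolic plane. -/
instance : UniformSpace Tiling :=
  UniformSpace.ofCore <| UniformSpace.Core.mkOfBasis basis
    (by
      rintro _ ⟨R, ε, hε, rfl⟩ T
      have h : Near R ε T T := fun t ht _ => ⟨1, by rwa [one_smul], fun p _ => by simpa using hε⟩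
      exact ⟨h, h⟩)
    (by
      rintro _ ⟨R, ε, hε, rfl⟩
      exact ⟨_, ⟨R, ε, hε, rfl⟩, fun P hP => ⟨hP.2, hP.1⟩⟩)
    (by
      rintro _ ⟨R, ε, hε, rfl⟩
      refine ⟨_, ⟨R + ε / 2, ε / 2, half_pos hε, rfl⟩, ?_⟩
      rintro ⟨T, T''⟩ ⟨T', h, h'⟩
      exact ⟨h.1.comp h'.1 hε, h'.2.comp h.2 hε⟩)

theorem hasBasis_uniformity :
    (𝓤 Tiling).HasBasis (fun q : ℝ × ℝ => 0 < q.2) (fun q => entourage q.1 q.2) := by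
  refine ⟨fun s => ?_⟩
  refine (basis.mem_filter_iff).trans ?_
  constructor
  · rintro ⟨_, ⟨R, ε, hε, rfl⟩, hs⟩
    exact ⟨(R, ε), hε, hs⟩
  · rintro ⟨⟨R, ε⟩, hε, hs⟩
    exact ⟨_, ⟨R, ε, hε, rfl⟩, hs⟩

instance : ContinuousConstSMul G Tiling where
  continuous_const_smul g := by
    refine UniformContinuous.continuous ?_
    refine (hasBasis_uniformity.uniformContinuous_iff hasBasis_uniformity).mpr ?_
    rintro ⟨R, ε⟩ hε
    exact ⟨(R + dist (g⁻¹ • UpperHalfPlane.I) UpperHalfPlane.I, ε), hε,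
      fun T T' h => ⟨h.1.smul g, h.2.smul g⟩⟩

instance : MeasurableSpace Tiling := borel Tiling

instance : BorelSpace Tiling := ⟨rfl⟩

/-! ### Horoballs, dyadic indices and the fixed-sum tilings -/

/-- `T` is non-degenerate, and its horoball packing is the image under `g` of the packing
by the images of `horoball` under `PSL(2, ℤ)`: the union of the cores of the tiles of `T` is the
union of the horoballs. -/
def HasHoroballPacking (T : Tiling) (g : G) : Prop :=
  ⋃ h ∈ {h : G | h • tile ∈ T.tiles}, h • core = ⋃ γ : SL(2, ℤ), (g * modular γ) • horoball

/-- The dyadic index in `T` of the horoball `g • horoball`, seen from the image under `g` of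
the standard triangle, is `a = ∑ₖ dₖ 2 ^ k` with digits `dₖ ∈ {0, 1}`. The motions `p 0, p 1, …`
are the positions of tiles of `T`:
* the prong `d₀` (left for `0`, right for `1`) of the tile `p 0 • tile` is the
  third of the triangle adjacent to the horoball;
* the tile `p k • tile` emerges from the prong `dₖ₊₁` of its parent `p (k + 1) • tile`, that is, this
  prong fills its top dent, `z ↦ z / 2 + d` being the motion from `2 * prong 0` to `prong d`. -/
def HasIndex (T : Tiling) (g : G) (a : ℤ_[2]) : Prop :=
  ∃ (d : ℕ → Fin 2) (p : ℕ → G),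
    (∀ k, p k • tile ∈ T.tiles) ∧
    p 0 * affineMotion 1 ((d 0 : ℕ) : ℝ) one_pos = g ∧
    (∀ k, p k = p (k + 1) * affineMotion (1 / 2) ((d (k + 1) : ℕ) : ℝ) one_half_pos) ∧
    HasSum (fun k => ((d k : ℕ) : ℤ_[2]) * 2 ^ k) a

/-- The non-degenerate tilings for which the sum of the three dyadic indices at each triangle is
`w`. The triangles are the images under `g * modular γ` of the standard triangle; the three
horoballs meeting there are the images of `horoball` under `g * modular (γ * rotation ^ j)`,
`j = 0, 1, 2`. -/
def IsFixedSum (w : ℤ_[2]) (T : Tiling) : Prop :=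
  ∃ g : G, T.HasHoroballPacking g ∧ ∀ γ : SL(2, ℤ), ∃ a b c : ℤ_[2],
    T.HasIndex (g * modular γ) a ∧ T.HasIndex (g * modular (γ * rotation)) b ∧
    T.HasIndex (g * modular (γ * rotation ^ 2)) c ∧ a + b + c = w

theorem smul_tile_mem_smul (g h : G) (T : Tiling) :
    (g * h) • tile ∈ (g • T).tiles ↔ h • tile ∈ T.tiles := by
  rw [tiles_smul, mul_smul, Set.smul_mem_smul_set_iff]

theorem HasIndex.smul {T : Tiling} {h : G} {a : ℤ_[2]} (H : T.HasIndex h a) (g : G) :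
    (g • T).HasIndex (g * h) a := by
  obtain ⟨d, p, h1, h2, h3, h4⟩ := H
  refine ⟨d, fun k => g * p k, fun k => (smul_tile_mem_smul g _ T).mpr (h1 k), ?_, fun k => ?_, h4⟩
  · rw [mul_assoc, h2]
  · rw [mul_assoc, ← h3 k]

theorem HasHoroballPacking.smul {T : Tiling} {h : G} (H : T.HasHoroballPacking h) (g : G) :
    (g • T).HasHoroballPacking (g * h) := by
  have H' := congrArg (fun s : Set ℍ => g • s) H
  simp only [Set.smul_set_iUnion, ← mul_smul, ← mul_assoc] at H'
  rw [HasHoroballPacking, ← H']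
  ext z
  simp only [Set.mem_iUnion, Set.mem_ofPred_eq, exists_prop]
  constructor
  · rintro ⟨k, hk, hz⟩
    refine ⟨g⁻¹ * k, ?_, by rwa [mul_inv_cancel_left]⟩
    rw [← smul_tile_mem_smul g, mul_inv_cancel_left]
    exact hk
  · rintro ⟨k, hk, hz⟩
    exact ⟨g * k, (smul_tile_mem_smul g k T).mpr hk, hz⟩

theorem IsFixedSum.smul {w : ℤ_[2]} {T : Tiling} (H : IsFixedSum w T) (g : G) :
    IsFixedSum w (g • T) := by
  obtain ⟨h, h1, h2⟩ := H
  refine ⟨g * h, h1.smul g, fun γ => ?_⟩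
  obtain ⟨a, b, c, ha, hb, hc, hs⟩ := h2 γ
  refine ⟨a, b, c, ?_, ?_, ?_, hs⟩
  · simpa only [mul_assoc] using ha.smul g
  · simpa only [mul_assoc] using hb.smul g
  · simpa only [mul_assoc] using hc.smul g

end Tiling

/-- The fixed-sum space `𝒯_w`: the closure of the class of fixed-sum tilings. -/
def fixedSumSpace (w : ℤ_[2]) : Set Tiling := closure {T | T.IsFixedSum w}

theorem smul_mem_fixedSumSpace {w : ℤ_[2]} (g : G) {T : Tiling} (hT : T ∈ fixedSumSpace w) :
    g • T ∈ fixedSumSpace w :=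
  map_mem_closure (continuous_const_smul g) hT fun _ h => h.smul g

instance (w : ℤ_[2]) : MulAction G (fixedSumSpace w) where
  smul g T := ⟨g • T.1, smul_mem_fixedSumSpace g T.2⟩
  one_smul T := Subtype.ext (one_smul G T.1)
  mul_smul g h T := Subtype.ext (mul_smul g h T.1)

/-! ### Conjugacy of group actions -/

/-- The actions of `Γ` on `X` and on `Y` are topologically conjugate. -/
def TopologicallyConjugate (Γ X Y : Type*) [Group Γ] [TopologicalSpace X] [TopologicalSpace Y]
    [MulAction Γ X] [MulAction Γ Y] : Prop :=
  ∃ α : X ≃ₜ Y, ∀ (g : Γ) (x : X), α (g • x) = g • α x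

/-- `S` is an invariant set that is null for each invariant Borel probability measure. -/
def IsInvariantNull (Γ : Type*) {X : Type*} [Group Γ] [MeasurableSpace X] [MulAction Γ X]
    (S : Set X) : Prop :=
  (∀ (g : Γ), ∀ x ∈ S, g • x ∈ S) ∧
    ∀ μ : MeasureTheory.Measure X, MeasureTheory.IsProbabilityMeasure μ →
      MeasureTheory.SMulInvariantMeasure Γ X μ → μ S = 0

/-- The actions of `Γ` on `X` and on `Y` are almost conjugate: there is an equivariant
homeomorphism between the complements of invariant sets that are null for all invariant
measures. -/
def AlmostConjugate (Γ X Y : Type*) [Group Γ] [TopologicalSpace X] [TopologicalSpace Y]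
    [MeasurableSpace X] [BorelSpace X] [MeasurableSpace Y] [BorelSpace Y]
    [MulAction Γ X] [MulAction Γ Y] : Prop :=
  ∃ (X₀ : Set X) (Y₀ : Set Y), IsInvariantNull Γ X₀ ∧ IsInvariantNull Γ Y₀ ∧
    ∃ α : ↥(X₀ᶜ) ≃ₜ ↥(Y₀ᶜ), ∀ (g : Γ) (x x' : ↥(X₀ᶜ)),
      (x' : X) = g • (x : X) → (α x' : Y) = g • (α x : Y)

end ModifiedBinary

end

noncomputable section

namespace ModifiedBinary

open Filter Topology

section

/-! ### The group of motions -/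

/-! A fixed-sum tiling is encoded by its dyadic indices. Place the packing in standard position, and
attach to each pair of a triangle and an adjacent horoball, indexed by `γ` in `SL(2, ℤ)` up to sign,
its index `f γ`. Moving along the horoball to the next triangle adds `1`, and the three indices at a
triangle add up to `w`. Conversely each such labelling comes from a tiling: the level `k` tiles of a
horoball sit at the integers congruent to the label modulo `2 ^ (k + 1)` (`labelTiling`,
`isFixedSum_iff`), and the labelling is determined up to the choice of the base triangle
(`smul_labelTiling_inj`). Labellings exist because the modular group is the free product of cyclic
groups of orders two and three (`exists_modular_hom`, `exists_label`).

A limit of fixed-sum tilings is fixed-sum, the labels converging by compactness of `ℤ_[2]`, or else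
all its tiles come from deeper and deeper inside horoballs and point to one boundary point
(`label_dichotomy`, `label_limit`). The latter tilings are null for each invariant probability
measure: they have an equivariant end on the boundary circle, and no probability measure on the
circle is invariant under `PSL(2, ℝ)` (`isInvariantNull_compl`).

Adding a constant `e` to all labels changes the sum by `3 * e`, and is an equivariant homeomorphism
between the sets of fixed-sum tilings. As `3` is a unit of `ℤ_[2]`, this gives almost conjugacy for
all sums. If `e` is a rational integer, the operation extends to the closures by the identity on the
degenerate tilings: a tile at level `k` is displaced relative to its size by `e / 2 ^ k`, which
tends to `0` deep inside a horoball (`tendsto_shift_of_isFixedSum`).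

For the converse let `α` be a conjugacy. The degenerate tiling `solenoid 0` is invariant under `z ↦
2 * z` and recurrent under the translations by `2 ^ (n + 1)`. Applied to `α` and to its inverse,
these properties force `α` to fix it (`conjugacy_basePoint`), and then each `solenoid b`, a limit of
its translates (`conjugacy_solenoid`). Take the fixed-sum tiling with label `w / 3` at all three
corners of the base triangle, which is invariant under the rotation of order three. Seen from higher
and higher ancestors of a tile at `∞` it accumulates at solenoids, so its image has the same
accumulation points. As consecutive ancestors determine each other, the ancestors in the image are,
far up, those of the original moved by a single translation `u` (`exists_translation_mem_pos`). The
image is also rotation invariant, which forces its packing to be the standard one and its label at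
the base triangle to be `w' / 3` (`dyad_conj_rotation`). Hence `u` is an integer and `w / 3 - w' / 3
= u`. -/

theorem toG_surjective : Function.Surjective toG := QuotientGroup.mk_surjective

theorem det_eq (h : SL(2, ℝ)) : h 0 0 * h 1 1 - h 0 1 * h 1 0 = 1 := by
  have := h.det_coe
  rwa [Matrix.det_fin_two] at this

theorem coe_toG_smul (h : SL(2, ℝ)) (z : ℍ) :
    ((toG h • z : ℍ) : ℂ) = (h 0 0 * z + h 0 1) / (h 1 0 * z + h 1 1) := by
  rw [toG_smul, UpperHalfPlane.coe_specialLinearGroup_apply]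
  simp

theorem denom_pos (h : SL(2, ℝ)) (z : ℍ) :
    0 < (h 1 0 * z.re + h 1 1) ^ 2 + (h 1 0 * z.im) ^ 2 := by
  rcases eq_or_ne (h 1 0) 0 with h0 | h0
  · have : h 1 1 ≠ 0 := fun h1 => by simpa [h0, h1] using det_eq h
    rw [h0]; simp; positivity
  · have := z.im_pos
    positivity

theorem im_toG_smul (h : SL(2, ℝ)) (z : ℍ) :
    (toG h • z).im = z.im / ((h 1 0 * z.re + h 1 1) ^ 2 + (h 1 0 * z.im) ^ 2) := by
  rw [← UpperHalfPlane.coe_im, coe_toG_smul, Complex.div_im]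
  simp [Complex.normSq_apply]
  have h1 := denom_pos h z
  have h2 := det_eq h
  rw [← pow_two, ← pow_two, ← sub_div]
  congr 1
  linear_combination (z.im) * h2

theorem re_toG_smul (h : SL(2, ℝ)) (z : ℍ) :
    (toG h • z).re = ((h 0 0 * z.re + h 0 1) * (h 1 0 * z.re + h 1 1) + h 0 0 * h 1 0 * z.im ^ 2) /
      ((h 1 0 * z.re + h 1 1) ^ 2 + (h 1 0 * z.im) ^ 2) := by
  rw [← UpperHalfPlane.coe_re, coe_toG_smul, Complex.div_re]
  simp [Complex.normSq_apply]
  rw [← pow_two, ← pow_two, ← add_div]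
  congr 1
  ring

theorem cosh_dist_eq (z w : ℍ) : Real.cosh (dist z w) =
    1 + ((z.re - w.re) ^ 2 + (z.im - w.im) ^ 2) / (2 * z.im * w.im) := by
  rw [UpperHalfPlane.cosh_dist, Complex.dist_eq, ← Complex.normSq_eq_norm_sq, Complex.normSq_apply]
  simp [pow_two]

/-- The displacement of a point by a motion is governed by a real quadratic polynomial. -/
theorem cosh_dist_toG_smul (h : SL(2, ℝ)) (z : ℍ) : Real.cosh (dist (toG h • z) z) =
    1 + ((h 1 0 * (z.re ^ 2 - z.im ^ 2) + (h 1 1 - h 0 0) * z.re - h 0 1) ^ 2 +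
      ((2 * h 1 0 * z.re + (h 1 1 - h 0 0)) * z.im) ^ 2) / (2 * z.im ^ 2) := by
  have h1 := denom_pos h z
  have h2 := det_eq h
  have hy := z.im_pos
  rw [cosh_dist_eq, re_toG_smul, im_toG_smul]
  set a := h 0 0
  set b := h 0 1
  set c := h 1 0
  set d := h 1 1
  set x := z.re
  set y := z.im
  set N := (c * x + d) ^ 2 + (c * y) ^ 2 with hN
  -- Here `R + iJ` is `cz² + (d - a)z - b`, and the displacement is `gz - z = -(R + iJ) / (cz + d)`.
  -- The denominator `N = |cz + d|²` cancels against the one in the imaginary part of `gz`.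
  set R := c * (x ^ 2 - y ^ 2) + (d - a) * x - b with hR
  set J := (2 * c * x + (d - a)) * y with hJ
  have hD : ((a * x + b) * (c * x + d) + a * c * y ^ 2) / N - x =
      -((c * x + d) * R + c * y * J) / N := by
    rw [div_sub' h1.ne']
    congr 1
    rw [hN, hR, hJ]
    ring
  have hE : y / N - y = -((c * x + d) * J - c * y * R) / N := by
    rw [div_sub' h1.ne']
    congr 1
    rw [hN, hR, hJ]
    linear_combination (-y) * h2
  rw [hD, hE]
  have hK : ((c * x + d) * R + c * y * J) ^ 2 + ((c * x + d) * J - c * y * R) ^ 2 =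
    N * (R ^ 2 + J ^ 2) := by rw [hN]; ring
  congr 1
  rw [div_pow, div_pow, neg_sq, neg_sq, ← add_div, hK]
  field_simp

theorem dist_lt_of_cosh_lt {z w : ℍ} {ε : ℝ} (hε : 0 ≤ ε)
    (h : Real.cosh (dist z w) < Real.cosh ε) : dist z w < ε := by
  rwa [Real.cosh_lt_cosh, abs_of_nonneg dist_nonneg, abs_of_nonneg hε] at h

theorem eq_one_of_offDiag {h : SL(2, ℝ)} (hc : h 1 0 = 0) (hb : h 0 1 = 0)
    (hd : h 1 1 = h 0 0) : toG h = 1 := by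
  refine (QuotientGroup.eq_one_iff h).mpr ?_
  rw [Matrix.SpecialLinearGroup.mem_center_iff]
  have h2 := det_eq h
  refine ⟨h 0 0, ?_, ?_⟩
  · rw [hd, hb] at h2
    rw [Fintype.card_fin, pow_two]
    linarith
  · ext i j
    fin_cases i <;> fin_cases j <;> simp [hc, hb, hd]

/-- A motion that fixes two distinct points is trivial. -/
theorem eq_one_of_fix {g : G} {z w : ℍ} (hzw : z ≠ w) (hz : g • z = z) (hw : g • w = w) :
    g = 1 := by
  obtain ⟨h, rfl⟩ := toG_surjective g
  have h1 := cosh_dist_toG_smul h z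
  have h2 := cosh_dist_toG_smul h w
  rw [hz, dist_self, Real.cosh_zero] at h1
  rw [hw, dist_self, Real.cosh_zero] at h2
  have hy := z.im_pos
  have hv := w.im_pos
  have key : ∀ {p q r : ℝ}, 0 < r → (1:ℝ) = 1 + (p ^ 2 + q ^ 2) / r → p = 0 ∧ q = 0 := by
    intro p q r hr hh
    have : p ^ 2 + q ^ 2 = 0 := by
      have : (p ^ 2 + q ^ 2) / r = 0 := by linarith
      simpa [hr.ne'] using this
    constructor <;> nlinarith [sq_nonneg p, sq_nonneg q]
  obtain ⟨a1, a2⟩ := key (by positivity) h1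
  obtain ⟨b1, b2⟩ := key (by positivity) h2
  have a3 : 2 * h 1 0 * z.re + (h 1 1 - h 0 0) = 0 := by simpa [hy.ne'] using a2
  have b3 : 2 * h 1 0 * w.re + (h 1 1 - h 0 0) = 0 := by simpa [hv.ne'] using b2
  have hc : h 1 0 = 0 := by
    by_contra hc
    have hre : z.re = w.re := by
      have : h 1 0 * (z.re - w.re) = 0 := by linarith
      rcases mul_eq_zero.mp this with h | h
      · exact absurd h hc
      · linarith
    rw [hre] at a1
    have : h 1 0 * (z.im ^ 2 - w.im ^ 2) = 0 := by linarith
    rcases mul_eq_zero.mp this with h | h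
    · exact hc h
    · exact hzw (UpperHalfPlane.ext_re_im hre
        (by nlinarith : z.im = w.im))
  have hd : h 1 1 = h 0 0 := by rw [hc] at a3; linarith
  refine eq_one_of_offDiag hc ?_ hd
  rw [hc, hd] at a1
  linarith

theorem G_ext {g h : G} (H : ∀ z : ℍ, g • z = h • z) : g = h := by
  have : h⁻¹ * g = 1 := by
    have hne : (UpperHalfPlane.I : ℍ) ≠ (2 : ℝ) +ᵥ UpperHalfPlane.I := fun h => by
      have := congrArg UpperHalfPlane.re h
      simp at this
    refine eq_one_of_fix hne ?_ ?_ <;> rw [mul_smul, H, inv_smul_smul]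
  exact (inv_mul_eq_one.mp this).symm

/-! ### Affine motions -/

theorem affineMotion_re (s x : ℝ) (hs : 0 < s) (z : ℍ) :
    (affineMotion s x hs • z).re = s * z.re + x := by
  have := congrArg Complex.re (coe_affineMotion_smul s x hs z)
  simpa using this

theorem affineMotion_im (s x : ℝ) (hs : 0 < s) (z : ℍ) :
    (affineMotion s x hs • z).im = s * z.im := by
  have := congrArg Complex.im (coe_affineMotion_smul s x hs z)
  simpa using this

theorem affineMotion_mul (s x t y : ℝ) (hs : 0 < s) (ht : 0 < t) :
    affineMotion s x hs * affineMotion t y ht = affineMotion (s * t) (s * y + x) (mul_pos hs ht) := by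
  refine G_ext fun z => ?_
  refine UpperHalfPlane.ext_re_im ?_ ?_ <;>
  simp only [mul_smul, affineMotion_re, affineMotion_im] <;> ring

theorem affineMotion_congr {s x t y : ℝ} {hs : 0 < s} {ht : 0 < t} (h : s = t) (h' : x = y) :
    affineMotion s x hs = affineMotion t y ht := by
  subst h; subst h'; rfl

theorem affineMotion_inj {s x t y : ℝ} {hs : 0 < s} {ht : 0 < t}
    (h : affineMotion s x hs = affineMotion t y ht) : s = t ∧ x = y := by
  have h1 := congrArg (fun g : G => (g • UpperHalfPlane.I).re) h
  have h2 := congrArg (fun g : G => (g • UpperHalfPlane.I).im) h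
  simp only [affineMotion_re, affineMotion_im, UpperHalfPlane.I_re, UpperHalfPlane.I_im] at h1 h2
  constructor <;> linarith

theorem affineMotion_one_zero : affineMotion 1 0 one_pos = 1 :=
  G_ext fun z => UpperHalfPlane.ext_re_im (by simp [affineMotion_re]) (by simp [affineMotion_im])

theorem affineMotion_inv (s x : ℝ) (hs : 0 < s) :
    (affineMotion s x hs)⁻¹ = affineMotion (1 / s) (-x / s) (by positivity) := by
  rw [inv_eq_iff_mul_eq_one, affineMotion_mul, ← affineMotion_one_zero]
  refine affineMotion_congr (by field_simp) (by field_simp; ring)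

/-- The motion `z ↦ 2 ^ j * z + x`. -/
def dyad (j : ℤ) (x : ℝ) : G := affineMotion (2 ^ j) x (by positivity)

theorem dyad_re (j : ℤ) (x : ℝ) (z : ℍ) : (dyad j x • z).re = 2 ^ j * z.re + x :=
  affineMotion_re ..

theorem dyad_im (j : ℤ) (x : ℝ) (z : ℍ) : (dyad j x • z).im = 2 ^ j * z.im :=
  affineMotion_im ..

theorem dyad_mul (j k : ℤ) (x y : ℝ) : dyad j x * dyad k y = dyad (j + k) (2 ^ j * y + x) := by
  rw [dyad, dyad, affineMotion_mul]
  exact affineMotion_congr (zpow_add₀ two_ne_zero j k).symm rfl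

theorem dyad_zero_zero : dyad 0 0 = 1 := by
  rw [← affineMotion_one_zero]
  exact affineMotion_congr (zpow_zero _) rfl

theorem dyad_inv (j : ℤ) (x : ℝ) : (dyad j x)⁻¹ = dyad (-j) (-x / 2 ^ j) := by
  rw [inv_eq_iff_mul_eq_one, dyad_mul, ← dyad_zero_zero]
  congr 1
  · simp
  · field_simp; ring

theorem dyad_inj {j k : ℤ} {x y : ℝ} (h : dyad j x = dyad k y) : j = k ∧ x = y := by
  obtain ⟨h1, h2⟩ := affineMotion_inj h
  exact ⟨zpow_right_injective₀ (by norm_num) (by norm_num) h1, h2⟩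

theorem dyad_congr {j k : ℤ} {x y : ℝ} (h : j = k) (h' : x = y) : dyad j x = dyad k y := by
  rw [h, h']

theorem affineMotion_one_eq (x : ℝ) : affineMotion 1 x one_pos = dyad 0 x :=
  affineMotion_congr (by simp) rfl

theorem affineMotion_half_eq (x : ℝ) : affineMotion (1 / 2) x one_half_pos = dyad (-1) x :=
  affineMotion_congr (by norm_num) rfl

/-! ### The stabilizer of the point at infinity -/

/-- `g` fixes the boundary point `∞`. -/
def FixesInfty (g : G) : Prop :=
  ∃ (s x : ℝ) (hs : 0 < s), g = affineMotion s x hs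

theorem fixesInfty_of_entry {h : SL(2, ℝ)} (hc : h 1 0 = 0) : FixesInfty (toG h) := by
  have h2 := det_eq h
  rw [hc] at h2
  have ha : h 0 0 ≠ 0 := fun h0 => by simp [h0] at h2
  refine ⟨h 0 0 ^ 2, h 0 0 * h 0 1, by positivity, G_ext fun z => ?_⟩
  have hd : h 1 1 = (h 0 0)⁻¹ := by field_simp; linarith
  refine UpperHalfPlane.ext_re_im ?_ ?_
  · rw [re_toG_smul, affineMotion_re, hc, hd]
    field_simp; ring
  · rw [im_toG_smul, affineMotion_im, hc, hd]
    field_simp; ring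

/-- The images of `i` and `2i` have heights `1 / (c² + d²)` and `2 / (4c² + d²)`. Fixing `∞` thus
becomes an equation between heights of images of two points, which survives pointwise limits. -/
theorem entry_eq_zero_of_im {h : SL(2, ℝ)}
    (H : (toG h • (UpperHalfPlane.mk ⟨0, 2⟩ two_pos : ℍ)).im = 2 * (toG h • UpperHalfPlane.I).im) :
    h 1 0 = 0 := by
  have h1 := denom_pos h UpperHalfPlane.I
  have h3 := denom_pos h (UpperHalfPlane.mk ⟨0, 2⟩ two_pos : ℍ)
  rw [im_toG_smul, im_toG_smul] at H
  simp only [UpperHalfPlane.mk_re, UpperHalfPlane.mk_im, UpperHalfPlane.I_re,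
    UpperHalfPlane.I_im, mul_zero, zero_add, mul_one] at H h1 h3
  rw [mul_one_div, div_eq_div_iff h3.ne' h1.ne'] at H
  nlinarith

theorem fixesInfty_iff (g : G) : FixesInfty g ↔
    (g • (UpperHalfPlane.mk ⟨0, 2⟩ two_pos : ℍ)).im = 2 * (g • UpperHalfPlane.I).im := by
  constructor
  · rintro ⟨s, x, hs, rfl⟩
    simp [affineMotion_im, mul_comm]
  · intro H
    obtain ⟨h, rfl⟩ := toG_surjective g
    exact fixesInfty_of_entry (entry_eq_zero_of_im H)

theorem fixesInfty_toG_iff (h : SL(2, ℝ)) : FixesInfty (toG h) ↔ h 1 0 = 0 :=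
  ⟨fun H => entry_eq_zero_of_im ((fixesInfty_iff _).mp H), fixesInfty_of_entry⟩

theorem FixesInfty.mul {g h : G} (hg : FixesInfty g) (hh : FixesInfty h) : FixesInfty (g * h) := by
  obtain ⟨s, x, hs, rfl⟩ := hg
  obtain ⟨t, y, ht, rfl⟩ := hh
  exact ⟨_, _, _, affineMotion_mul ..⟩

theorem FixesInfty.inv {g : G} (hg : FixesInfty g) : FixesInfty g⁻¹ := by
  obtain ⟨s, x, hs, rfl⟩ := hg
  exact ⟨_, _, _, affineMotion_inv ..⟩

theorem fixesInfty_dyad (j : ℤ) (x : ℝ) : FixesInfty (dyad j x) := ⟨_, _, _, rfl⟩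

/-! ### Pointwise convergence of motions -/

variable {ι : Type*}

/-- Pointwise convergence of motions on the hyperbolic plane. -/
def Conv (l : Filter ι) (q : ι → G) (p : G) : Prop :=
  ∀ z : ℍ, Tendsto (fun n => q n • z) l (𝓝 (p • z))

theorem Conv.const (l : Filter ι) (p : G) : Conv l (fun _ => p) p := fun _ => tendsto_const_nhds

theorem Conv.mul {l : Filter ι} {q q' : ι → G} {p p' : G} (h : Conv l q p) (h' : Conv l q' p') :
    Conv l (fun n => q n * q' n) (p * p') := by
  intro z
  rw [tendsto_iff_dist_tendsto_zero]
  have h1 := tendsto_iff_dist_tendsto_zero.mp (h' z)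
  have h2 := tendsto_iff_dist_tendsto_zero.mp (h (p' • z))
  have h3 := h1.add h2
  rw [add_zero] at h3
  refine squeeze_zero (fun _ => dist_nonneg) (fun n => ?_) h3
  rw [mul_smul, mul_smul]
  calc _ ≤ dist (q n • q' n • z) (q n • p' • z) + dist (q n • p' • z) (p • p' • z) :=
        dist_triangle _ _ _
    _ = _ := by rw [dist_smul]

theorem Conv.inv {l : Filter ι} {q : ι → G} {p : G} (h : Conv l q p) :
    Conv l (fun n => (q n)⁻¹) p⁻¹ := by
  intro z
  rw [tendsto_iff_dist_tendsto_zero]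
  have h2 := tendsto_iff_dist_tendsto_zero.mp (h (p⁻¹ • z))
  refine h2.congr fun n => ?_
  rw [smul_inv_smul, dist_comm, ← dist_smul (q n)⁻¹, inv_smul_smul]

theorem Conv.congr' {l : Filter ι} {q q' : ι → G} {p : G} (h : Conv l q p)
    (he : ∀ᶠ n in l, q n = q' n) : Conv l q' p := fun z =>
  (h z).congr' (he.mono fun n hn => by rw [hn])

theorem Conv.mono {l l' : Filter ι} {q : ι → G} {p : G} (h : Conv l q p) (hl : l' ≤ l) :
    Conv l' q p := fun z => (h z).mono_left hl

theorem Conv.fixesInfty {l : Filter ι} [l.NeBot] {q : ι → G} {p : G} (h : Conv l q p)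
    (hq : ∀ᶠ n in l, FixesInfty (q n)) : FixesInfty p := by
  rw [fixesInfty_iff]
  have h1 := UpperHalfPlane.continuous_im.continuousAt.tendsto.comp (h (UpperHalfPlane.mk ⟨0, 2⟩ two_pos))
  have h2 := UpperHalfPlane.continuous_im.continuousAt.tendsto.comp (h UpperHalfPlane.I)
  refine tendsto_nhds_unique h1 ((h2.const_mul 2).congr' ?_)
  filter_upwards [hq] with n hn
  exact ((fixesInfty_iff _).mp hn).symm

theorem tendsto_coe_iff {l : Filter ι} {z : ι → ℍ} {w : ℍ} : Tendsto z l (𝓝 w) ↔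
    Tendsto (fun n => (z n).re) l (𝓝 w.re) ∧ Tendsto (fun n => (z n).im) l (𝓝 w.im) := by
  constructor
  · intro h
    exact ⟨(UpperHalfPlane.continuous_re.tendsto w).comp h,
      (UpperHalfPlane.continuous_im.tendsto w).comp h⟩
  · rintro ⟨h1, h2⟩
    rw [UpperHalfPlane.isEmbedding_coe.tendsto_nhds_iff]
    have h3 : Tendsto (fun n => ((z n).re : ℂ) + (z n).im * Complex.I) l
        (𝓝 ((w.re : ℂ) + w.im * Complex.I)) :=
      ((Complex.continuous_ofReal.tendsto _).comp h1).add
        (((Complex.continuous_ofReal.tendsto _).comp h2).mul_const _)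
    simp only [UpperHalfPlane.re_add_im] at h3
    exact h3

theorem conv_affineMotion {l : Filter ι} {s x : ι → ℝ} {t y : ℝ} {hs : ∀ n, 0 < s n} {ht : 0 < t}
    (h1 : Tendsto s l (𝓝 t)) (h2 : Tendsto x l (𝓝 y)) :
    Conv l (fun n => affineMotion (s n) (x n) (hs n)) (affineMotion t y ht) := by
  intro z
  rw [tendsto_coe_iff]
  simp only [affineMotion_re, affineMotion_im]
  exact ⟨(h1.mul_const _).add h2, h1.mul_const _⟩

theorem conv_dyad {l : Filter ι} {x : ι → ℝ} {y : ℝ} (j : ℤ) (h : Tendsto x l (𝓝 y)) :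
    Conv l (fun n => dyad j (x n)) (dyad j y) :=
  conv_affineMotion tendsto_const_nhds h

/-- The displacement at a point controls two linear forms in `c`, `d - a` and `b`. Two points on one
vertical line suffice to solve for all three. The tendency of these to `0` does not depend on the
choice of sign of the matrices, so no normalization of the lifts is needed. -/
theorem entries_tendsto_zero {l : Filter ι} {h : ι → SL(2, ℝ)} {z w : ℍ} (hre : z.re = w.re)
    (him : z.im ≠ w.im) (hz : Tendsto (fun n => dist (toG (h n) • z) z) l (𝓝 0))
    (hw : Tendsto (fun n => dist (toG (h n) • w) w) l (𝓝 0)) :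
    Tendsto (fun n => h n 1 0) l (𝓝 0) ∧ Tendsto (fun n => h n 1 1 - h n 0 0) l (𝓝 0) ∧
      Tendsto (fun n => h n 0 1) l (𝓝 0) := by
  have key : ∀ u : ℍ, Tendsto (fun n => dist (toG (h n) • u) u) l (𝓝 0) →
      Tendsto (fun n => h n 1 0 * (u.re ^ 2 - u.im ^ 2) + (h n 1 1 - h n 0 0) * u.re - h n 0 1)
        l (𝓝 0) ∧
      Tendsto (fun n => 2 * h n 1 0 * u.re + (h n 1 1 - h n 0 0)) l (𝓝 0) := by
    intro u hu
    have hy := u.im_pos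
    have h1 : Tendsto (fun n => (Real.cosh (dist (toG (h n) • u) u) - 1) * (2 * u.im ^ 2))
        l (𝓝 0) := by
      have := ((Real.continuous_cosh.tendsto 0).comp hu).sub_const 1
      rw [Real.cosh_zero, sub_self] at this
      simpa using this.mul_const (2 * u.im ^ 2)
    have h2 : ∀ n, (Real.cosh (dist (toG (h n) • u) u) - 1) * (2 * u.im ^ 2) =
        (h n 1 0 * (u.re ^ 2 - u.im ^ 2) + (h n 1 1 - h n 0 0) * u.re - h n 0 1) ^ 2 +
        ((2 * h n 1 0 * u.re + (h n 1 1 - h n 0 0)) * u.im) ^ 2 := by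
      intro n
      rw [cosh_dist_toG_smul]
      field_simp
      ring
    have sq0 : ∀ f : ι → ℝ, Tendsto (fun n => f n ^ 2) l (𝓝 0) → Tendsto f l (𝓝 0) := by
      intro f hf
      have := (Real.continuous_sqrt.tendsto 0).comp hf
      rw [Real.sqrt_zero] at this
      refine (tendsto_zero_iff_abs_tendsto_zero f).mpr (this.congr fun n => ?_)
      simp [Real.sqrt_sq_eq_abs]
    constructor
    · refine sq0 _ (squeeze_zero (fun n => sq_nonneg _) (fun n => ?_) h1)
      rw [h2]
      exact le_add_of_nonneg_right (sq_nonneg _)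
    · have h3 : Tendsto (fun n => (2 * h n 1 0 * u.re + (h n 1 1 - h n 0 0)) * u.im) l (𝓝 0) := by
        refine sq0 _ (squeeze_zero (fun n => sq_nonneg _) (fun n => ?_) h1)
        rw [h2]
        exact le_add_of_nonneg_left (sq_nonneg _)
      have h4 := h3.mul_const (u.im)⁻¹
      rw [zero_mul] at h4
      refine h4.congr fun n => ?_
      field_simp
  obtain ⟨a1, a2⟩ := key z hz
  obtain ⟨b1, b2⟩ := key w hw
  have hne : w.im ^ 2 - z.im ^ 2 ≠ 0 := by
    have := z.im_pos
    have := w.im_pos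
    intro h0
    have : (w.im - z.im) * (w.im + z.im) = 0 := by linarith
    rcases mul_eq_zero.mp this with h | h
    · exact him (by linarith)
    · linarith
  have hc : Tendsto (fun n => h n 1 0) l (𝓝 0) := by
    have := (a1.sub b1).mul_const (w.im ^ 2 - z.im ^ 2)⁻¹
    rw [sub_zero, zero_mul] at this
    refine this.congr fun n => ?_
    rw [hre]
    field_simp
    ring
  have hd : Tendsto (fun n => h n 1 1 - h n 0 0) l (𝓝 0) := by
    have := a2.sub (hc.const_mul (2 * z.re))
    rw [mul_zero, sub_zero] at this
    refine this.congr fun n => ?_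
    ring
  refine ⟨hc, hd, ?_⟩
  have := ((hc.mul_const (z.re ^ 2 - z.im ^ 2)).add (hd.mul_const z.re)).sub a1
  simp only [zero_mul, add_zero, sub_zero] at this
  refine this.congr fun n => ?_
  ring

theorem dist_smul_lt_of_entries {l : Filter ι} {h : ι → SL(2, ℝ)}
    (hc : Tendsto (fun n => h n 1 0) l (𝓝 0)) (hd : Tendsto (fun n => h n 1 1 - h n 0 0) l (𝓝 0))
    (hb : Tendsto (fun n => h n 0 1) l (𝓝 0)) (M : ℝ) {ε : ℝ} (hε : 0 < ε) :
    ∀ᶠ n in l, ∀ z : ℍ, |z.re| ≤ M → z.im ≤ M → 1 / M ≤ z.im → dist (toG (h n) • z) z < ε := by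
  have hF : Tendsto (fun n => 1 + ((|h n 1 0| * (M ^ 2 + M ^ 2) + |h n 1 1 - h n 0 0| * M +
      |h n 0 1|) ^ 2 + ((2 * |h n 1 0| * M + |h n 1 1 - h n 0 0|) * M) ^ 2) * M ^ 2) l (𝓝 1) := by
    have hc' := (tendsto_zero_iff_abs_tendsto_zero _).mp hc
    have hd' := (tendsto_zero_iff_abs_tendsto_zero _).mp hd
    have hb' := (tendsto_zero_iff_abs_tendsto_zero _).mp hb
    have := (((((hc'.mul_const (M ^ 2 + M ^ 2)).add (hd'.mul_const M)).add hb').pow 2).add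
      ((((hc'.const_mul 2).mul_const M).add hd').mul_const M |>.pow 2)).mul_const (M ^ 2)
      |>.const_add 1
    simpa using this
  have h1 : (1 : ℝ) < Real.cosh ε := by
    rw [← Real.cosh_zero, Real.cosh_lt_cosh]
    simpa [abs_of_pos hε] using hε
  filter_upwards [hF.eventually_lt_const h1] with n hn z hx hy1 hy2
  refine dist_lt_of_cosh_lt hε.le (lt_of_le_of_lt ?_ hn)
  rw [cosh_dist_toG_smul]
  have hy := z.im_pos
  have hM : 0 < M := hy.trans_le hy1
  have hyy : 1 / (2 * z.im ^ 2) ≤ M ^ 2 := by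
    rw [div_le_iff₀ (by positivity)]
    rw [div_le_iff₀ hM] at hy2
    nlinarith
  rw [div_eq_mul_one_div]
  have hzz : |z.re ^ 2 - z.im ^ 2| ≤ M ^ 2 + M ^ 2 := by
    have : z.re ^ 2 ≤ M ^ 2 := sq_le_sq' (by linarith [neg_abs_le z.re]) (by linarith [le_abs_self z.re])
    have : z.im ^ 2 ≤ M ^ 2 := pow_le_pow_left₀ hy.le hy1 2
    rw [abs_le]
    constructor <;> nlinarith [sq_nonneg z.re, sq_nonneg z.im]
  have e1 : |h n 1 0 * (z.re ^ 2 - z.im ^ 2) + (h n 1 1 - h n 0 0) * z.re - h n 0 1| ≤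
      |h n 1 0| * (M ^ 2 + M ^ 2) + |h n 1 1 - h n 0 0| * M + |h n 0 1| := by
    refine (abs_sub _ _).trans (add_le_add ((abs_add_le _ _).trans ?_) le_rfl)
    rw [abs_mul, abs_mul]
    gcongr
  have e2 : |(2 * h n 1 0 * z.re + (h n 1 1 - h n 0 0)) * z.im| ≤
      (2 * |h n 1 0| * M + |h n 1 1 - h n 0 0|) * M := by
    rw [abs_mul, abs_of_pos hy]
    refine mul_le_mul ((abs_add_le _ _).trans ?_) hy1 hy.le (by positivity)
    rw [abs_mul, abs_mul, abs_two]
    gcongr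
  gcongr ?_ + (?_ + ?_) * ?_
  · exact le_rfl
  · rw [← sq_abs]; gcongr
  · rw [← sq_abs]; gcongr

/-- Convergence at two points of a vertical line implies pointwise convergence. -/
theorem conv_of_two {l : Filter ι} {q : ι → G} {p : G} {z w : ℍ} (hre : z.re = w.re)
    (him : z.im ≠ w.im) (hz : Tendsto (fun n => q n • z) l (𝓝 (p • z)))
    (hw : Tendsto (fun n => q n • w) l (𝓝 (p • w))) : Conv l q p := by
  choose h hh using fun n => toG_surjective (p⁻¹ * q n)
  have key : ∀ u : ℍ, Tendsto (fun n => q n • u) l (𝓝 (p • u)) ↔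
      Tendsto (fun n => dist (toG (h n) • u) u) l (𝓝 0) := by
    intro u
    rw [tendsto_iff_dist_tendsto_zero]
    refine tendsto_congr fun n => ?_
    rw [hh, mul_smul, ← dist_smul p (p⁻¹ • q n • u), smul_inv_smul]
  obtain ⟨h1, h2, h3⟩ := entries_tendsto_zero hre him ((key z).mp hz) ((key w).mp hw)
  intro u
  rw [key]
  rw [Metric.tendsto_nhds]
  intro ε hε
  filter_upwards [dist_smul_lt_of_entries h1 h2 h3 (max |u.re| (max u.im (1 / u.im))) hε] with n hn
  rw [Real.dist_0_eq_abs, abs_of_nonneg dist_nonneg]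
  refine hn u (le_max_left _ _) ((le_max_left _ _).trans (le_max_right _ _)) ?_
  rw [one_div_le (lt_max_of_lt_right (lt_max_of_lt_left u.im_pos)) u.im_pos]
  exact (le_max_right _ _).trans (le_max_right _ _)

/-- Pointwise convergence of motions is uniform on bounded sets. -/
theorem Conv.uniform {l : Filter ι} {q : ι → G} {p : G} (hq : Conv l q p) (M : ℝ) {ε : ℝ}
    (hε : 0 < ε) :
    ∀ᶠ n in l, ∀ z : ℍ, |z.re| ≤ M → z.im ≤ M → 1 / M ≤ z.im → dist (q n • z) (p • z) < ε := by
  choose h hh using fun n => toG_surjective (p⁻¹ * q n)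
  have key : ∀ u : ℍ, Tendsto (fun n => dist (toG (h n) • u) u) l (𝓝 0) := by
    intro u
    refine (tendsto_iff_dist_tendsto_zero.mp (hq u)).congr fun n => ?_
    rw [hh, mul_smul, ← dist_smul p (p⁻¹ • q n • u), smul_inv_smul]
  obtain ⟨h1, h2, h3⟩ := entries_tendsto_zero (z := UpperHalfPlane.I)
    (w := UpperHalfPlane.mk ⟨0, 2⟩ two_pos) rfl (by simp) (key _) (key _)
  filter_upwards [dist_smul_lt_of_entries h1 h2 h3 M hε] with n hn z hz1 hz2 hz3
  have := hn z hz1 hz2 hz3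
  rwa [hh, mul_smul, ← dist_smul p (p⁻¹ • q n • z), smul_inv_smul] at this

end

/-! ### The pieces of the tile in coordinates -/

theorem norm_lt_iff_sq {w : ℂ} {r : ℝ} (hr : 0 ≤ r) : ‖w‖ < r ↔ w.re ^ 2 + w.im ^ 2 < r ^ 2 := by
  rw [← sq_lt_sq₀ (norm_nonneg w) hr, Complex.sq_norm, Complex.normSq_apply, pow_two w.re,
    pow_two w.im]

theorem norm_le_iff_sq {w : ℂ} {r : ℝ} (hr : 0 ≤ r) : ‖w‖ ≤ r ↔ w.re ^ 2 + w.im ^ 2 ≤ r ^ 2 := by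
  rw [← sq_le_sq₀ (norm_nonneg w) hr, Complex.sq_norm, Complex.normSq_apply, pow_two w.re,
    pow_two w.im]

theorem mem_core {z : ℍ} : z ∈ core ↔ 0 ≤ z.re ∧ z.re ≤ 2 ∧ 1 ≤ z.im ∧ z.im ≤ 2 := Iff.rfl

theorem mem_prong {d : ℝ} {z : ℍ} : z ∈ prong d ↔ d ≤ z.re ∧ z.re ≤ d + 1 ∧ z.im ≤ 1 ∧
    1 ≤ (z.re - d) ^ 2 + z.im ^ 2 ∧ 1 ≤ (z.re - (d + 1)) ^ 2 + z.im ^ 2 := by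
  simp only [prong, Set.mem_ofPred_eq, ← not_lt, norm_lt_iff_sq zero_le_one]
  simp

theorem mem_topDent {z : ℍ} : z ∈ topDent ↔ 4 < z.re ^ 2 + z.im ^ 2 ∧
    4 < (z.re - 2) ^ 2 + z.im ^ 2 := by
  simp only [topDent, Set.mem_ofPred_eq, ← not_le, norm_le_iff_sq zero_le_two]
  norm_num

theorem mem_sideDent {z : ℍ} : z ∈ sideDent ↔ z.re ^ 2 + (z.im - 3 / 2) ^ 2 < 1 / 16 := by
  simp only [sideDent, Set.mem_ofPred_eq, norm_lt_iff_sq (show (0:ℝ) ≤ 1 / 4 by norm_num)]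
  norm_num

theorem mem_sideBump {z : ℍ} : z ∈ sideBump ↔ 2 ≤ z.re ∧
    (z.re - 2) ^ 2 + (z.im - 3 / 2) ^ 2 ≤ 1 / 16 := by
  simp only [sideBump, Set.mem_ofPred_eq, norm_le_iff_sq (show (0:ℝ) ≤ 1 / 4 by norm_num)]
  norm_num

/-- The point of the hyperbolic plane with given coordinates. -/
def pt (x y : ℝ) (hy : 0 < y) : ℍ := UpperHalfPlane.mk ⟨x, y⟩ hy

@[simp] theorem pt_re (x y : ℝ) (hy : 0 < y) : (pt x y hy).re = x := rfl
@[simp] theorem pt_im (x y : ℝ) (hy : 0 < y) : (pt x y hy).im = y := rfl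

/-- The open part of the core of the tile. -/
def coreO : Set ℍ := {z | 0 < z.re ∧ z.re < 2 ∧ 1 < z.im ∧ z.im < 2 ∧
  (z.re ^ 2 + z.im ^ 2 < 4 ∨ (z.re - 2) ^ 2 + z.im ^ 2 < 4) ∧
  1 / 16 < z.re ^ 2 + (z.im - 3 / 2) ^ 2}

/-- The open part of a prong. -/
def prongO (d : ℝ) : Set ℍ := {z | d < z.re ∧ z.re < d + 1 ∧ z.im < 1 ∧
  1 < (z.re - d) ^ 2 + z.im ^ 2 ∧ 1 < (z.re - (d + 1)) ^ 2 + z.im ^ 2}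

/-- The open part of the bump. -/
def bumpO : Set ℍ := {z | 2 < z.re ∧ (z.re - 2) ^ 2 + (z.im - 3 / 2) ^ 2 < 1 / 16}

/-- The union of the open pieces of the tile: a dense open subset. -/
def tileO : Set ℍ := coreO ∪ prongO 0 ∪ prongO 1 ∪ bumpO

theorem isOpen_tileO : IsOpen tileO := by
  have hr := UpperHalfPlane.continuous_re
  have hi := UpperHalfPlane.continuous_im
  have h : ∀ d, IsOpen (prongO d) := by
    intro d
    unfold prongO
    simp only [Set.ofPred_and]
    repeat' refine IsOpen.inter ?_ ?_
    all_goals refine isOpen_lt ?_ ?_ <;> fun_prop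
  refine ((IsOpen.union ?_ (h 0)).union (h 1)).union ?_
  · unfold coreO
    simp only [Set.ofPred_and, Set.ofPred_or]
    repeat' first | refine IsOpen.inter ?_ ?_ | refine IsOpen.union ?_ ?_
    all_goals refine isOpen_lt ?_ ?_ <;> fun_prop
  · unfold bumpO
    simp only [Set.ofPred_and]
    refine IsOpen.inter (isOpen_lt ?_ ?_) (isOpen_lt ?_ ?_) <;> fun_prop

theorem mem_tile_of_core {z : ℍ} (h : z ∈ core) (h1 : z ∉ topDent) (h2 : z ∉ sideDent) :
    z ∈ tile := Or.inl (Or.inl (Or.inl ⟨h, fun h' => h'.elim h1 h2⟩))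

theorem prong_zero_subset : prong 0 ⊆ tile := fun _ h => Or.inl (Or.inl (Or.inr h))
theorem prong_one_subset : prong 1 ⊆ tile := fun _ h => Or.inl (Or.inr h)
theorem sideBump_subset : sideBump ⊆ tile := fun _ h => Or.inr h

theorem tileO_subset : tileO ⊆ tile := by
  rintro z (((h | h) | h) | h)
  · obtain ⟨h1, h2, h3, h4, h5, h6⟩ := h
    refine mem_tile_of_core ⟨h1.le, h2.le, h3.le, h4.le⟩ ?_ ?_
    · rw [mem_topDent, not_and_or, not_lt, not_lt]
      exact h5.imp le_of_lt le_of_lt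
    · rw [mem_sideDent, not_lt]
      exact h6.le
  · exact prong_zero_subset (mem_prong.mpr ⟨h.1.le, h.2.1.le, h.2.2.1.le, h.2.2.2.1.le, h.2.2.2.2.le⟩)
  · exact prong_one_subset (mem_prong.mpr ⟨h.1.le, h.2.1.le, h.2.2.1.le, h.2.2.2.1.le, h.2.2.2.2.le⟩)
  · exact sideBump_subset (mem_sideBump.mpr ⟨h.1.le, h.2.le⟩)

theorem tileO_subset_interior : tileO ⊆ interior tile :=
  interior_maximal tileO_subset isOpen_tileO

/-- The pieces of the tile, in coordinates. -/
theorem tile_cases {z : ℍ} (h : z ∈ tile) :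
    (0 ≤ z.re ∧ z.re ≤ 2 ∧ 1 ≤ z.im ∧ z.im ≤ 2 ∧
      (z.re ^ 2 + z.im ^ 2 ≤ 4 ∨ (z.re - 2) ^ 2 + z.im ^ 2 ≤ 4) ∧
      1 / 16 ≤ z.re ^ 2 + (z.im - 3 / 2) ^ 2) ∨
    (∃ d : ℝ, (d = 0 ∨ d = 1) ∧ d ≤ z.re ∧ z.re ≤ d + 1 ∧ z.im ≤ 1 ∧
      1 ≤ (z.re - d) ^ 2 + z.im ^ 2 ∧ 1 ≤ (z.re - (d + 1)) ^ 2 + z.im ^ 2) ∨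
    (2 ≤ z.re ∧ (z.re - 2) ^ 2 + (z.im - 3 / 2) ^ 2 ≤ 1 / 16) := by
  rcases h with ((⟨h, h'⟩ | h) | h) | h
  · obtain ⟨h1, h2, h3, h4⟩ := h
    rw [Set.mem_union, not_or, mem_topDent, mem_sideDent, not_and_or] at h'
    simp only [not_lt] at h'
    exact Or.inl ⟨h1, h2, h3, h4, h'.1, h'.2⟩
  · exact Or.inr (Or.inl ⟨0, Or.inl rfl, mem_prong.mp h⟩)
  · exact Or.inr (Or.inl ⟨1, Or.inr rfl, mem_prong.mp h⟩)
  · exact Or.inr (Or.inr (mem_sideBump.mp h))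

theorem tileO_cases {z : ℍ} (h : z ∈ tileO) :
    z ∈ coreO ∨ (∃ d : ℝ, (d = 0 ∨ d = 1) ∧ z ∈ prongO d) ∨ z ∈ bumpO := by
  rcases h with ((h | h) | h) | h
  · exact Or.inl h
  · exact Or.inr (Or.inl ⟨0, Or.inl rfl, h⟩)
  · exact Or.inr (Or.inl ⟨1, Or.inr rfl, h⟩)
  · exact Or.inr (Or.inr h)

/-- A bounding region for the tile. -/
theorem tile_bounds {z : ℍ} (h : z ∈ tile) : 43 / 50 ≤ z.im ∧ z.im ≤ 2 ∧ 0 ≤ z.re ∧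
    3 * (1 - z.im) ≤ z.re ∧ (1 ≤ z.im → z.re ≤ 2 + 3 / 5 * (z.im - 1)) ∧
    (z.im ≤ 1 → z.re ≤ 2 - 3 * (1 - z.im)) := by
  have hy := z.im_pos
  rcases tile_cases h with ⟨h1, h2, h3, h4, h5, h6⟩ | ⟨d, hd, h1, h2, h3, h4, h5⟩ | ⟨h1, h2⟩
  · refine ⟨by linarith, h4, h1, by linarith, fun _ => by linarith, fun _ => by linarith⟩
  · have hx0 : 0 ≤ (z.re - d) := by linarith
    have hx1 : 0 ≤ (d + 1 - z.re) := by linarith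
    -- The lowest point of a prong has height `√3 / 2`, slightly above `43 / 50`.
    have hy1 : 43 / 50 ≤ z.im := by
      by_contra hlt
      push Not at hlt
      rcases le_total (z.re - d) (1 / 2) with h | h <;> nlinarith
    have ha : 3 * (1 - z.im) ≤ z.re - d := by
      by_contra hlt
      push Not at hlt
      nlinarith
    have hb : 3 * (1 - z.im) ≤ d + 1 - z.re := by
      by_contra hlt
      push Not at hlt
      nlinarith
    rcases hd with rfl | rfl
    · exact ⟨hy1, by linarith, by linarith, by linarith, fun _ => by linarith, fun _ => by linarith⟩
    · exact ⟨hy1, by linarith, by linarith, by linarith, fun _ => by linarith, fun _ => by linarith⟩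
  · have h3 : 5 / 4 ≤ z.im := by nlinarith [sq_nonneg (z.re - 2)]
    have h4 : z.im ≤ 7 / 4 := by nlinarith [sq_nonneg (z.re - 2)]
    refine ⟨by linarith, by linarith, by linarith, by linarith, fun _ => ?_, fun h => by linarith⟩
    by_contra hlt
    push Not at hlt
    -- The line of slope `3 / 5` narrowly misses the bump; `47 / 34` is close to the foot of the
    -- perpendicular from the centre of the bump.
    have : (z.im - 3 / 2) ^ 2 + (3 / 5 * (z.im - 1)) ^ 2 < 1 / 16 := by nlinarith
    nlinarith [sq_nonneg (z.im - 47 / 34)]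

theorem I_mem_tile : pt 0 1 one_pos ∈ tile := by
  refine mem_tile_of_core ⟨?_, ?_, ?_, ?_⟩ ?_ ?_
  any_goals norm_num
  · rw [mem_topDent]; norm_num
  · rw [mem_sideDent]; norm_num

theorem corner_mem_tile : pt 2 1 one_pos ∈ tile := by
  refine mem_tile_of_core ⟨?_, ?_, ?_, ?_⟩ ?_ ?_
  any_goals norm_num
  · rw [mem_topDent]; norm_num
  · rw [mem_sideDent]; norm_num

theorem top_corner_mem_tile : pt 2 2 two_pos ∈ tile := by
  refine mem_tile_of_core ⟨?_, ?_, ?_, ?_⟩ ?_ ?_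
  any_goals norm_num
  · rw [mem_topDent]; norm_num
  · rw [mem_sideDent]; norm_num

/-! ### The tile has no symmetries -/

/-- The lower corners of the core form the only pair of points of the tile at maximal distance
(with the point of smaller real part first). -/
theorem tile_diam_aux {z w : ℍ} (hz : z ∈ tile) (hw : w ∈ tile) (hzw : z.re ≤ w.re)
    (h : 4 * z.im * w.im ≤ (z.re - w.re) ^ 2 + (z.im - w.im) ^ 2) :
    z = pt 0 1 one_pos ∧ w = pt 2 1 one_pos := by
  obtain ⟨a1, a2, a3, a4, a5, a6⟩ := tile_bounds hz
  obtain ⟨b1, b2, b3, b4, b5, b6⟩ := tile_bounds hw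
  obtain ⟨x, hx⟩ : ∃ x, z.re = x := ⟨_, rfl⟩
  obtain ⟨u, hu⟩ : ∃ u, w.re = u := ⟨_, rfl⟩
  obtain ⟨s, hs⟩ : ∃ s, z.im = 1 + s := ⟨z.im - 1, by ring⟩
  obtain ⟨t, ht⟩ : ∃ t, w.im = 1 + t := ⟨w.im - 1, by ring⟩
  suffices H : s = 0 ∧ t = 0 ∧ x = 0 ∧ u = 2 by
    obtain ⟨rfl, rfl, rfl, rfl⟩ := H
    exact ⟨UpperHalfPlane.ext_re_im hx (by simp [hs]), UpperHalfPlane.ext_re_im hu (by simp [ht])⟩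
  rw [hx, hu] at hzw
  simp only [hx, hs] at a1 a2 a3 a4 a5 a6
  simp only [hu, ht] at b1 b2 b3 b4 b5 b6
  rw [hx, hu, hs, ht] at h
  -- The linear bounds for the width of the tile at given heights reduce the quadratic inequality to
  -- a linear one with positive coefficients in `|s|` and `|t|`.
  have hst : s = 0 ∧ t = 0 := by
    rcases le_total 0 s with h0 | h0 <;> rcases le_total 0 t with h1 | h1
    · have hW : (u - x) ^ 2 ≤ (2 + 3 / 5 * t) ^ 2 :=
        pow_le_pow_left₀ (by linarith) (by linarith [b5 (by linarith)]) 2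
      have p1 := mul_nonneg (by linarith : (0:ℝ) ≤ s) (by linarith : (0:ℝ) ≤ 1 - s)
      have p2 := mul_nonneg (by linarith : (0:ℝ) ≤ t) (by linarith : (0:ℝ) ≤ 1 - t)
      have p3 := mul_nonneg h0 h1
      have key : 3 * s + 6 / 25 * t ≤ 0 := by linarith
      constructor <;> linarith
    · have hW : (u - x) ^ 2 ≤ (2 + 3 * t) ^ 2 :=
        pow_le_pow_left₀ (by linarith) (by linarith [b6 (by linarith)]) 2
      have p1 := mul_nonneg (by linarith : (0:ℝ) ≤ s) (by linarith : (0:ℝ) ≤ 1 - s)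
      have p2 := mul_nonneg (by linarith : (0:ℝ) ≤ -t) (by linarith : (0:ℝ) ≤ 7 / 50 + t)
      have p3 := mul_nonneg (by linarith : (0:ℝ) ≤ s) (by linarith : (0:ℝ) ≤ 7 / 50 + t)
      have key : 2 * s + 6 * -t ≤ 0 := by linarith
      constructor <;> linarith
    · have hW : (u - x) ^ 2 ≤ (2 + 3 / 5 * t + 3 * s) ^ 2 :=
        pow_le_pow_left₀ (by linarith) (by linarith [b5 (by linarith)]) 2
      have p1 := mul_nonneg (by linarith : (0:ℝ) ≤ t) (by linarith : (0:ℝ) ≤ 1 - t)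
      have p2 := mul_nonneg (by linarith : (0:ℝ) ≤ -s) (by linarith : (0:ℝ) ≤ 7 / 50 + s)
      have p3 := mul_nonneg (by linarith : (0:ℝ) ≤ -s) (by linarith : (0:ℝ) ≤ 1 - t)
      have key : 6 / 25 * t + 4 * -s ≤ 0 := by linarith
      constructor <;> linarith
    · have hW : (u - x) ^ 2 ≤ (2 + 3 * t + 3 * s) ^ 2 :=
        pow_le_pow_left₀ (by linarith) (by linarith [b6 (by linarith)]) 2
      have p1 := mul_nonneg (by linarith : (0:ℝ) ≤ -t) (by linarith : (0:ℝ) ≤ 7 / 50 + t)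
      have p2 := mul_nonneg (by linarith : (0:ℝ) ≤ -s) (by linarith : (0:ℝ) ≤ 7 / 50 + s)
      have p3 := mul_nonneg (by linarith : (0:ℝ) ≤ -s) (by linarith : (0:ℝ) ≤ 7 / 50 + t)
      have key : -s + -t ≤ 0 := by linarith
      constructor <;> linarith
  obtain ⟨rfl, rfl⟩ := hst
  have b5' := b5 (by norm_num)
  have hux : 2 ≤ u - x := by
    refine (sq_le_sq₀ zero_le_two (by linarith)).mp ?_
    linarith
  exact ⟨rfl, rfl, by linarith, by linarith⟩

theorem tile_diam {z w : ℍ} (hz : z ∈ tile) (hw : w ∈ tile)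
    (h : dist z w = dist (pt 0 1 one_pos) (pt 2 1 one_pos)) :
    (z = pt 0 1 one_pos ∧ w = pt 2 1 one_pos) ∨ (w = pt 0 1 one_pos ∧ z = pt 2 1 one_pos) := by
  have h1 := congrArg Real.cosh h
  rw [cosh_dist_eq, cosh_dist_eq] at h1
  simp only [pt_re, pt_im] at h1
  have hy := z.im_pos
  have hv := w.im_pos
  have h2 : (z.re - w.re) ^ 2 + (z.im - w.im) ^ 2 = 4 * z.im * w.im := by
    have : ((z.re - w.re) ^ 2 + (z.im - w.im) ^ 2) / (2 * z.im * w.im) = 2 := by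
      norm_num at h1; linarith
    rw [div_eq_iff (by positivity)] at this
    linarith
  rcases le_total z.re w.re with hle | hle
  · exact Or.inl (tile_diam_aux hz hw hle h2.ge)
  · exact Or.inr (tile_diam_aux hw hz hle (by nlinarith))

/-- The half turn exchanging the two lower corners of the core. -/
def halfTurn : SL(2, ℝ) :=
  ⟨!![1 / √2, -3 / √2; 1 / √2, -1 / √2], by
    have : √2 * √2 = 2 := Real.mul_self_sqrt zero_le_two
    have h0 : √2 ≠ 0 := by positivity
    rw [Matrix.det_fin_two]
    simp
    field_simp
    nlinarith⟩

theorem coe_halfTurn_smul (z : ℍ) : ((toG halfTurn • z : ℍ) : ℂ) = (z - 3) / (z - 1) := by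
  have h0 : (√2 : ℂ) ≠ 0 := by exact_mod_cast (by positivity : √2 ≠ 0)
  have h1 : (z : ℂ) - 1 ≠ 0 := sub_ne_zero.mpr (by exact_mod_cast z.ne_intCast 1)
  rw [coe_toG_smul]
  simp [halfTurn]
  rw [div_eq_div_iff _ h1]
  · field_simp
    ring
  · have : (√2 : ℂ)⁻¹ * z + -1 / √2 = (z - 1) / √2 := by field_simp; ring
    rw [this]
    exact div_ne_zero h1 h0

/-- A symmetry preserves the unique pair of points of the tile at maximal distance. If it exchanges
them, it is the half turn, which takes the corner `2 + 2i` to `(3 + 4i) / 5`, a point too low to lie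
in the tile. Hence a tile determines its position `g`. -/
theorem smul_tile_eq_iff {g : G} : g • tile = tile ↔ g = 1 := by
  refine ⟨fun hg => ?_, fun hg => by rw [hg, one_smul]⟩
  have hmem : ∀ z ∈ tile, g • z ∈ tile := fun z hz => hg ▸ Set.smul_mem_smul_set hz
  have hne : pt 0 1 one_pos ≠ pt 2 1 one_pos := fun h => by
    have := congrArg UpperHalfPlane.re h; simp at this
  rcases tile_diam (hmem _ I_mem_tile) (hmem _ corner_mem_tile) (dist_smul g _ _) with h | h
  · exact eq_one_of_fix hne h.1 h.2
  · exfalso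
    have e1 : toG halfTurn • pt 0 1 one_pos = pt 2 1 one_pos := by
      ext
      rw [coe_halfTurn_smul]
      have : ((pt 0 1 one_pos : ℍ) : ℂ) = Complex.I := by apply Complex.ext <;> simp
      have h2 : ((pt 2 1 one_pos : ℍ) : ℂ) = 2 + Complex.I := by apply Complex.ext <;> simp
      rw [this, h2, div_eq_iff]
      · linear_combination (-1 : ℂ) * Complex.I_sq
      · intro h; have := congrArg Complex.im h; simp at this
    have e2 : toG halfTurn • pt 2 1 one_pos = pt 0 1 one_pos := by
      ext
      rw [coe_halfTurn_smul]
      have : ((pt 0 1 one_pos : ℍ) : ℂ) = Complex.I := by apply Complex.ext <;> simp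
      have h2 : ((pt 2 1 one_pos : ℍ) : ℂ) = 2 + Complex.I := by apply Complex.ext <;> simp
      rw [this, h2, div_eq_iff]
      · linear_combination (-1 : ℂ) * Complex.I_sq
      · intro h; have := congrArg Complex.im h; simp at this
    have e3 : g = toG halfTurn := by
      have : (toG halfTurn)⁻¹ * g = 1 := by
        refine eq_one_of_fix hne ?_ ?_
        · rw [mul_smul, h.2, inv_smul_eq_iff, e1]
        · rw [mul_smul, h.1, inv_smul_eq_iff, e2]
      exact (inv_mul_eq_one.mp this).symm
    have h4 := hmem _ top_corner_mem_tile
    have e4 : g • pt 2 2 two_pos = pt (3 / 5) (4 / 5) (by norm_num) := by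
      rw [e3]
      ext
      rw [coe_halfTurn_smul]
      have : ((pt 2 2 two_pos : ℍ) : ℂ) = 2 + 2 * Complex.I := by apply Complex.ext <;> simp
      have h2 : ((pt (3 / 5) (4 / 5) (by norm_num) : ℍ) : ℂ) = 3 / 5 + 4 / 5 * Complex.I := by
        apply Complex.ext <;> simp
      rw [this, h2, div_eq_iff]
      · linear_combination (-8 / 5 : ℂ) * Complex.I_sq
      · intro h; have := congrArg Complex.im h; simp at this
    rw [e4] at h4
    have := (tile_bounds h4).1
    norm_num at this

theorem smul_tile_inj {g h : G} (H : g • tile = h • tile) : g = h := by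
  have : h⁻¹ * g = 1 := by
    rw [← smul_tile_eq_iff, mul_smul, H, inv_smul_smul]
  exact (inv_mul_eq_one.mp this).symm

/-! ### The tile is the closure of its open part -/

theorem mem_closure_of_path {S : Set ℍ} {z : ℍ} (x y : ℝ → ℝ) (hy : ∀ t, 0 < y t)
    (hx0 : x 0 = z.re) (hy0 : y 0 = z.im) (hcx : Continuous x) (hcy : Continuous y)
    (h : ∀ᶠ t in 𝓝[>] (0 : ℝ), pt (x t) (y t) (hy t) ∈ S) : z ∈ closure S := by
  refine mem_closure_of_tendsto (f := fun t => pt (x t) (y t) (hy t)) (b := 𝓝[>] (0 : ℝ)) ?_ h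
  rw [tendsto_coe_iff]
  simp only [pt_re, pt_im, ← hx0, ← hy0]
  exact ⟨(hcx.tendsto 0).mono_left nhdsWithin_le_nhds, (hcy.tendsto 0).mono_left nhdsWithin_le_nhds⟩

theorem eventually_pos_of_continuous {f : ℝ → ℝ} (hf : Continuous f) (h : 0 < f 0) :
    ∀ᶠ t in 𝓝[>] (0 : ℝ), 0 < f t :=
  ((hf.tendsto 0).eventually_const_lt h).filter_mono nhdsWithin_le_nhds

/-- Each boundary point is approached along a path into the open part: near the side dent by moving
to the right, elsewhere by contracting towards the point `1 + 6i/5`. -/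
theorem mem_closure_of_core_piece {z : ℍ} (h1 : 0 ≤ z.re) (h2 : z.re ≤ 2) (h3 : 1 ≤ z.im)
    (h4 : z.im ≤ 2) (h5 : z.re ^ 2 + z.im ^ 2 ≤ 4 ∨ (z.re - 2) ^ 2 + z.im ^ 2 ≤ 4)
    (h6 : 1 / 16 ≤ z.re ^ 2 + (z.im - 3 / 2) ^ 2) : z ∈ closure tileO := by
  have hy0 := z.im_pos
  have hIoo : ∀ᶠ t in 𝓝[>] (0 : ℝ), t ∈ Set.Ioo (0 : ℝ) (1 / 20) :=
    Ioo_mem_nhdsGT (by norm_num)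
  by_cases hnear : z.re ^ 2 + (z.im - 3 / 2) ^ 2 < 1 / 9
  · have hx : z.re < 1 / 3 := by nlinarith [sq_nonneg (z.im - 3 / 2)]
    have hya : 7 / 6 < z.im := by nlinarith [sq_nonneg z.re]
    have hyb : z.im < 11 / 6 := by nlinarith [sq_nonneg z.re]
    refine mem_closure_of_path (fun t => z.re + t) (fun _ => z.im) (fun _ => hy0)
      (by simp) rfl (by fun_prop) (by fun_prop) ?_
    filter_upwards [hIoo] with t ht
    refine Or.inl (Or.inl (Or.inl ⟨?_, ?_, ?_, ?_, Or.inl ?_, ?_⟩)) <;>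
      simp only [pt_re, pt_im] <;> nlinarith [ht.1, ht.2, mul_nonneg h1 ht.1.le]
  · push Not at hnear
    -- The maximum only serves to keep the path in the half plane for all `t`; for small `t` it is
    -- the affine path.
    have hyt : ∀ t : ℝ, 0 < max (1 / 2) ((1 - t) * z.im + t * (6 / 5)) :=
      fun t => lt_max_of_lt_left (by norm_num)
    have hyy : ∀ t ∈ Set.Ioo (0 : ℝ) (1 / 20),
        max (1 / 2) ((1 - t) * z.im + t * (6 / 5)) = (1 - t) * z.im + t * (6 / 5) := by
      intro t ht
      refine max_eq_right ?_
      nlinarith [ht.1, ht.2]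
    have hd : ∀ᶠ t in 𝓝[>] (0 : ℝ), 0 < ((1 - t) * z.re + t) ^ 2 +
        ((1 - t) * z.im + t * (6 / 5) - 3 / 2) ^ 2 - 1 / 16 :=
      eventually_pos_of_continuous (by fun_prop) (by norm_num; linarith)
    refine mem_closure_of_path (fun t => (1 - t) * z.re + t)
      (fun t => max (1 / 2) ((1 - t) * z.im + t * (6 / 5))) hyt
      (by simp) (by simp; linarith) (by fun_prop) (by fun_prop) ?_
    filter_upwards [hIoo, hd] with t ht hdt
    obtain ⟨t0, t1⟩ := ht
    have ht' : 0 < t * (1 - t) := by nlinarith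
    have hmid : ∀ a b : ℝ, ((1 - t) * a + t * b) ^ 2 =
        (1 - t) * a ^ 2 + t * b ^ 2 - t * (1 - t) * (a - b) ^ 2 := by intros; ring
    refine Or.inl (Or.inl (Or.inl ⟨?_, ?_, ?_, ?_, ?_, ?_⟩)) <;>
      simp only [pt_re, pt_im, hyy t ⟨t0, t1⟩]
    · nlinarith
    · nlinarith
    · nlinarith
    · nlinarith
    · refine h5.imp (fun h5 => ?_) (fun h5 => ?_)
      · have e1 := hmid z.re 1
        rw [mul_one] at e1
        rw [e1, hmid]
        have q1 := mul_nonneg ht'.le (sq_nonneg (z.re - 1))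
        have q2 := mul_nonneg ht'.le (sq_nonneg (z.im - 6 / 5))
        nlinarith [mul_le_mul_of_nonneg_left h5 (by linarith : 0 ≤ 1 - t)]
      · have e1 := hmid (z.re - 2) (-1)
        have e2 : (1 - t) * z.re + t - 2 = (1 - t) * (z.re - 2) + t * (-1) := by ring
        rw [e2, e1, hmid]
        have q1 := mul_nonneg ht'.le (sq_nonneg (z.re - 2 - (-1)))
        have q2 := mul_nonneg ht'.le (sq_nonneg (z.im - 6 / 5))
        nlinarith [mul_le_mul_of_nonneg_left h5 (by linarith : 0 ≤ 1 - t)]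
    · linarith

theorem mem_closure_of_prong_piece {z : ℍ} {d : ℝ} (hd : d = 0 ∨ d = 1) (h1 : d ≤ z.re)
    (h2 : z.re ≤ d + 1) (h3 : z.im ≤ 1) (h4 : 1 ≤ (z.re - d) ^ 2 + z.im ^ 2)
    (h5 : 1 ≤ (z.re - (d + 1)) ^ 2 + z.im ^ 2) : z ∈ closure tileO := by
  have hy0 := z.im_pos
  have hIoo : ∀ᶠ t in 𝓝[>] (0 : ℝ), t ∈ Set.Ioo (0 : ℝ) (1 / 20) :=
    Ioo_mem_nhdsGT (by norm_num)
  have hx02 : 0 ≤ z.re ∧ z.re ≤ 2 := by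
    rcases hd with rfl | rfl <;> constructor <;> linarith
  rcases eq_or_lt_of_le h3 with hy1 | hy1
  -- A point at height `1` lies on the common edge of prong and core and is approached from inside
  -- the core. The lower points of the prong are approached from above, inside the prong.
  · refine mem_closure_of_path (fun t => (1 - t) * z.re + t)
      (fun t => 1 + |t|) (fun t => by positivity)
      (by simp) (by simp [hy1]) (by fun_prop) (by fun_prop) ?_
    filter_upwards [hIoo] with t ht
    obtain ⟨t0, t1⟩ := ht
    have e1 : |t| = t := abs_of_pos t0
    have q1 : 0 ≤ t * z.re := mul_nonneg t0.le hx02.1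
    have q2 : 0 ≤ (2 - z.re) * (1 - t) := mul_nonneg (by linarith) (by linarith)
    refine Or.inl (Or.inl (Or.inl ⟨?_, ?_, ?_, ?_, ?_, ?_⟩)) <;> simp only [pt_re, pt_im, e1]
    · nlinarith
    · nlinarith
    · linarith
    · linarith
    · rcases le_total z.re 1 with hz1 | hz1
      · left
        have : (1 - t) * z.re + t ≤ 1 := by nlinarith
        have : 0 ≤ (1 - t) * z.re + t := by nlinarith
        nlinarith
      · right
        have : (1 - t) * z.re + t - 2 ≤ 0 := by nlinarith
        have : -1 ≤ (1 - t) * z.re + t - 2 := by nlinarith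
        nlinarith
    · nlinarith [sq_nonneg ((1 - t) * z.re + t)]
  · have hxd : d < z.re := by
      refine lt_of_le_of_ne h1 fun h => ?_
      rw [← h] at h4; nlinarith
    have hxd' : z.re < d + 1 := by
      refine lt_of_le_of_ne h2 fun h => ?_
      rw [h] at h5; nlinarith
    have hd1 : ∀ᶠ t in 𝓝[>] (0 : ℝ), 0 < 1 - (z.im + |t|) :=
      eventually_pos_of_continuous (by fun_prop) (by simpa using hy1)
    refine mem_closure_of_path (fun _ => z.re) (fun t => z.im + |t|) (fun t => by positivity)
      rfl (by simp) (by fun_prop) (by fun_prop) ?_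
    filter_upwards [hIoo, hd1] with t ht hd1
    obtain ⟨t0, t1⟩ := ht
    rw [abs_of_pos t0] at hd1
    have : pt z.re (z.im + |t|) (by positivity) ∈ prongO d := by
      refine ⟨?_, ?_, ?_, ?_, ?_⟩ <;> simp only [pt_re, pt_im, abs_of_pos t0] <;> nlinarith
    rcases hd with rfl | rfl
    · exact Or.inl (Or.inl (Or.inr this))
    · exact Or.inl (Or.inr this)

theorem mem_closure_of_bump_piece {z : ℍ} (h1 : 2 ≤ z.re)
    (h2 : (z.re - 2) ^ 2 + (z.im - 3 / 2) ^ 2 ≤ 1 / 16) : z ∈ closure tileO := by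
  have hy0 := z.im_pos
  have hIoo : ∀ᶠ t in 𝓝[>] (0 : ℝ), t ∈ Set.Ioo (0 : ℝ) (1 / 20) :=
    Ioo_mem_nhdsGT (by norm_num)
  have hya : 5 / 4 ≤ z.im := by nlinarith [sq_nonneg (z.re - 2)]
  have hyb : z.im ≤ 7 / 4 := by nlinarith [sq_nonneg (z.re - 2)]
  have hxb : z.re ≤ 9 / 4 := by nlinarith [sq_nonneg (z.im - 3 / 2)]
  have hyt : ∀ t : ℝ, 0 < max (1 / 2) ((1 - t) * z.im + t * (3 / 2)) :=
    fun t => lt_max_of_lt_left (by norm_num)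
  have hyy : ∀ t ∈ Set.Ioo (0 : ℝ) (1 / 20),
      max (1 / 2) ((1 - t) * z.im + t * (3 / 2)) = (1 - t) * z.im + t * (3 / 2) := by
    intro t ht
    refine max_eq_right ?_
    nlinarith [ht.1, ht.2]
  refine mem_closure_of_path (fun t => (1 - t) * z.re + t * (21 / 10))
    (fun t => max (1 / 2) ((1 - t) * z.im + t * (3 / 2))) hyt
    (by simp) (by simp; linarith) (by fun_prop) (by fun_prop) ?_
  filter_upwards [hIoo] with t ht
  obtain ⟨t0, t1⟩ := ht
  have ht' : 0 < t * (1 - t) := by nlinarith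
  refine Or.inr ⟨?_, ?_⟩ <;> simp only [pt_re, pt_im, hyy t ⟨t0, t1⟩]
  · nlinarith
  · have e1 : ((1 - t) * z.re + t * (21 / 10) - 2) ^ 2 +
        ((1 - t) * z.im + t * (3 / 2) - 3 / 2) ^ 2 =
        (1 - t) * ((z.re - 2) ^ 2 + (z.im - 3 / 2) ^ 2) + t * (1 / 100) -
        t * (1 - t) * ((z.re - 2 - 1 / 10) ^ 2 + (z.im - 3 / 2) ^ 2) := by ring
    rw [e1]
    have q1 := mul_nonneg ht'.le
      (add_nonneg (sq_nonneg (z.re - 2 - 1 / 10)) (sq_nonneg (z.im - 3 / 2)))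
    nlinarith [mul_le_mul_of_nonneg_left h2 (by linarith : 0 ≤ 1 - t)]


theorem tile_subset_closure : tile ⊆ closure tileO := by
  intro z hz
  rcases tile_cases hz with ⟨h1, h2, h3, h4, h5, h6⟩ | ⟨d, hd, h1, h2, h3, h4, h5⟩ | ⟨h1, h2⟩
  · exact mem_closure_of_core_piece h1 h2 h3 h4 h5 h6
  · exact mem_closure_of_prong_piece hd h1 h2 h3 h4 h5
  · exact mem_closure_of_bump_piece h1 h2

/-! ### Matching of neighbouring tiles -/

/-- An interior point of the tile. -/
def ctr : ℍ := pt 1 (3 / 2) (by norm_num)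

theorem ctr_mem : ctr ∈ tileO := by
  refine Or.inl (Or.inl (Or.inl ⟨?_, ?_, ?_, ?_, Or.inl ?_, ?_⟩)) <;> norm_num [ctr]

theorem low_mem : pt 1 (5 / 4) (by norm_num) ∈ tileO := by
  refine Or.inl (Or.inl (Or.inl ⟨?_, ?_, ?_, ?_, Or.inl ?_, ?_⟩)) <;> norm_num

theorem dist_ctr_le {z : ℍ} (hz : z ∈ tile) : dist z ctr ≤ 20 := by
  obtain ⟨a1, a2, a3, a4, a5, a6⟩ := tile_bounds hz
  have h1 : dist z ctr ≤ Real.cosh (dist z ctr) :=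
    (Real.self_le_sinh_iff.mpr dist_nonneg).trans (Real.sinh_lt_cosh _).le
  refine h1.trans ?_
  have hx : z.re ≤ 4 := by
    rcases le_total 1 z.im with h | h
    · linarith [a5 h]
    · linarith [a6 h]
  rw [cosh_dist_eq]
  have : ((z.re - ctr.re) ^ 2 + (z.im - ctr.im) ^ 2) / (2 * z.im * ctr.im) ≤ 19 := by
    simp only [ctr, pt_re, pt_im]
    have := z.im_pos
    rw [div_le_iff₀ (by positivity)]
    have : (z.re - 1) ^ 2 ≤ 9 := by nlinarith
    have : (z.im - 3 / 2) ^ 2 ≤ 1 := by nlinarith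
    linarith
  linarith

theorem tile_bounded {z : ℍ} (hz : z ∈ tile) : |z.re| ≤ 4 ∧ z.im ≤ 4 ∧ 1 / 4 ≤ z.im := by
  obtain ⟨a1, a2, a3, a4, a5, a6⟩ := tile_bounds hz
  refine ⟨?_, by linarith, by linarith⟩
  rw [abs_of_nonneg a3]
  rcases le_total 1 z.im with h | h
  · linarith [a5 h]
  · linarith [a6 h]

/-- Each point of the core lies in the tile, or in the left neighbour's bump, or in a prong of the
parent, whichever of the two it is. -/
theorem core_cover {v : ℍ} (hv : v ∈ core) : v ∈ tile ∨ dyad 0 2 • v ∈ tile ∨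
    (dyad (-1) 0 • v ∈ tile ∧ dyad (-1) 1 • v ∈ tile) := by
  by_cases h1 : v ∈ sideDent
  · refine Or.inr (Or.inl (sideBump_subset (mem_sideBump.mpr ?_)))
    rw [mem_sideDent] at h1
    simp only [dyad_re, dyad_im, zpow_zero, one_mul]
    refine ⟨by linarith [hv.1], ?_⟩
    rw [add_sub_cancel_right]
    exact h1.le
  by_cases h2 : v ∈ topDent
  · rw [mem_topDent] at h2
    obtain ⟨c1, c2, c3, c4⟩ := hv
    refine Or.inr (Or.inr ⟨prong_zero_subset (mem_prong.mpr ?_),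
      prong_one_subset (mem_prong.mpr ?_)⟩) <;>
    simp only [dyad_re, dyad_im, zpow_neg, zpow_one] <;>
    refine ⟨by linarith, by linarith, by linarith, by linarith [h2.1], by linarith [h2.2]⟩
  · exact Or.inl (mem_tile_of_core hv h2 h1)

theorem prongO_im {d : ℝ} {v : ℍ} (h : v ∈ prongO d) : 43 / 50 < v.im := by
  obtain ⟨h1, h2, h3, h4, h5⟩ := h
  have := v.im_pos
  by_contra hlt
  push Not at hlt
  rcases le_total (v.re - d) (1 / 2) with h | h <;> nlinarith

theorem bumpO_bounds {v : ℍ} (h : v ∈ bumpO) :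
    2 < v.re ∧ v.re < 9 / 4 ∧ 5 / 4 < v.im ∧ v.im < 7 / 4 := by
  obtain ⟨h1, h2⟩ := h
  refine ⟨h1, ?_, ?_, ?_⟩
  · nlinarith [sq_nonneg (v.im - 3 / 2)]
  · nlinarith [sq_nonneg (v.re - 2)]
  · nlinarith [sq_nonneg (v.re - 2)]

theorem tileO_im {v : ℍ} (h : v ∈ tileO) : 43 / 50 < v.im ∧ v.im < 2 := by
  rcases tileO_cases h with h | ⟨d, _, h⟩ | h
  · exact ⟨by linarith [h.2.2.1], h.2.2.2.1⟩
  · exact ⟨prongO_im h, by linarith [h.2.2.1]⟩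
  · have := bumpO_bounds h
    exact ⟨by linarith, by linarith⟩

/-- Within a horoball, the open parts of different tiles are disjoint. -/
theorem tileO_disjoint_aux {v v' : ℍ} (hv : v ∈ tileO) (hv' : v' ∈ tileO) {D : ℕ} {r : ℤ}
    (hre : v.re = 2 ^ D * v'.re - 2 * r) (him : v.im = 2 ^ D * v'.im) : D = 0 ∧ r = 0 := by
  have b1 := tileO_im hv
  have b2 := tileO_im hv'
  have hbound : ∀ {n : ℤ} {a b : ℝ}, (a : ℝ) < n → (n : ℝ) < b → ∀ m : ℤ, (m : ℝ) - 1 ≤ a →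
      b ≤ m + 1 → n = m := by
    intro n a b h1 h2 m h3 h4
    have h5 : ((m - 1 : ℤ) : ℝ) < n := by push_cast; linarith
    have h6 : (n : ℝ) < ((m + 1 : ℤ) : ℝ) := by push_cast; linarith
    have := Int.cast_lt.mp h5
    have := Int.cast_lt.mp h6
    omega
  -- Tiles of equal level are separated by their geodesic edges, with bump against dent; a parent
  -- meets a child only where a prong faces the upper dent. If the levels differ by two or more, the
  -- heights are disjoint, since `4 * (43 / 50) > 2`.
  rcases D with _ | _ | D
  · refine ⟨rfl, ?_⟩
    simp only [pow_zero, one_mul] at hre him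
    rcases tileO_cases hv with h | ⟨d, hd, h⟩ | h <;>
      rcases tileO_cases hv' with h' | ⟨d', hd', h'⟩ | h'
    · exact hbound (a := -1) (b := 1) (by linarith [h.2.1, h'.1]) (by linarith [h.1, h'.2.1]) 0
        (by norm_num) (by norm_num)
    · linarith [h.2.2.1, h'.2.2.1]
    · have hb := bumpO_bounds h'
      have hr : r = 1 := hbound (a := 0) (b := 9 / 8) (by linarith [h.2.1])
        (by linarith [h.1]) 1 (by norm_num) (by norm_num)
      have h6 := h.2.2.2.2.2
      have h2 := h'.2
      rw [hre, him, hr] at h6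
      norm_num at h6
      linarith
    · linarith [h.2.2.1, h'.2.2.1]
    · have h1 : 0 < v.re ∧ v.re < 2 := by
        rcases hd with rfl | rfl <;> constructor <;> linarith [h.1, h.2.1]
      have h2 : 0 < v'.re ∧ v'.re < 2 := by
        rcases hd' with rfl | rfl <;> constructor <;> linarith [h'.1, h'.2.1]
      exact hbound (a := -1) (b := 1) (by linarith) (by linarith) 0 (by norm_num) (by norm_num)
    · linarith [h.2.2.1, (bumpO_bounds h').2.2.1]
    · have hb := bumpO_bounds h
      have hr : r = -1 := hbound (a := -9 / 8) (b := 0) (by linarith [h'.1])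
        (by linarith [h'.2.1]) (-1) (by norm_num) (by norm_num)
      have h6 := h'.2.2.2.2.2
      have h2 := h.2
      rw [hre, him, hr] at h2
      norm_num at h2
      linarith
    · linarith [h'.2.2.1, (bumpO_bounds h).2.2.1]
    · have hb := bumpO_bounds h
      have hb' := bumpO_bounds h'
      exact hbound (a := -1) (b := 1) (by linarith) (by linarith) 0 (by norm_num) (by norm_num)
  · exfalso
    simp only [zero_add, pow_one] at hre him
    rcases tileO_cases hv' with h' | ⟨d', hd', h'⟩ | h'
    · linarith [h'.2.2.1]
    · obtain ⟨e, rfl⟩ : ∃ e : ℤ, d' = e := by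
        rcases hd' with rfl | rfl
        · exact ⟨0, by simp⟩
        · exact ⟨1, by simp⟩
      obtain ⟨q1, q2, q3, q4, q5⟩ := h'
      have hx : v'.re = v.re / 2 + r := by linarith
      have hy : v'.im = v.im / 2 := by linarith
      rw [hx] at q1 q2 q4 q5
      rw [hy] at q4 q5
      rcases tileO_cases hv with h | ⟨d, hd, h⟩ | h
      · have hr : e - r = 0 := hbound (n := e - r) (a := -1) (b := 1)
          (by push_cast; linarith [h.1]) (by push_cast; linarith [h.2.1]) 0
          (by norm_num) (by norm_num)
        have hr' : (e : ℝ) = r := by exact_mod_cast sub_eq_zero.mp hr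
        rw [hr'] at q4 q5
        rcases h.2.2.2.2.1 with h5 | h5 <;> linarith
      · linarith [h.2.2.1]
      · have hb := bumpO_bounds h
        have hr : e - r = 1 := hbound (n := e - r) (a := 0) (b := 9 / 8)
          (by push_cast; linarith) (by push_cast; linarith) 1
          (by norm_num) (by norm_num)
        have hr' : (e : ℝ) = r + 1 := by
          have : e = r + 1 := by omega
          rw [this]; push_cast; ring
        rw [hr'] at q4
        have h2 := h.2
        linarith
    · linarith [(bumpO_bounds h').2.2.1]
  · exfalso
    have : (4 : ℝ) ≤ 2 ^ (D + 1 + 1) := by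
      have : (1 : ℝ) ≤ 2 ^ D := one_le_pow₀ (by norm_num)
      rw [pow_succ, pow_succ]; linarith
    nlinarith

/-! ### Images under the modular group -/

/-- The part of the plane above all unit circles centred at integers: the horoball at `∞` together
with the adjacent thirds of triangles. -/
def upperRegion : Set ℍ := {z | ∀ n : ℤ, 1 < (z.re - n) ^ 2 + z.im ^ 2}

theorem modular_apply (γ : SL(2, ℤ)) :
    modular γ = toG (Matrix.SpecialLinearGroup.map (Int.castRingHom ℝ) γ) := rfl

theorem im_modular_smul (γ : SL(2, ℤ)) (z : ℍ) : (modular γ • z).im =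
    z.im / (((γ 1 0 : ℝ) * z.re + γ 1 1) ^ 2 + ((γ 1 0 : ℝ) * z.im) ^ 2) := by
  rw [modular_apply, im_toG_smul]
  simp

/-- The height is divided by `|cz + d|²`. For `c = ±1` this exceeds `1` by the definition of the
region, and for `|c| ≥ 2` because the region lies above the height `√3 / 2`. -/
theorem im_modular_smul_lt {γ : SL(2, ℤ)} {z : ℍ} (hz : z ∈ upperRegion) (hc : γ 1 0 ≠ 0) :
    (modular γ • z).im < z.im := by
  rw [im_modular_smul]
  refine div_lt_self z.im_pos ?_
  have h34 : 3 / 4 < z.im ^ 2 := by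
    have h1 := hz (round z.re)
    have h2 := abs_sub_round z.re
    have h3 : (z.re - round z.re) ^ 2 ≤ (1 / 2) ^ 2 := by
      rw [← sq_abs]; exact pow_le_pow_left₀ (abs_nonneg _) h2 2
    linarith
  have hcase : γ 1 0 = 1 ∨ γ 1 0 = -1 ∨ 4 ≤ (γ 1 0) ^ 2 := by
    rcases lt_trichotomy (γ 1 0) 0 with h | h | h
    · rcases eq_or_lt_of_le (show γ 1 0 ≤ -1 by omega) with h' | h'
      · exact Or.inr (Or.inl h')
      · exact Or.inr (Or.inr (by nlinarith))
    · exact absurd h hc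
    · rcases eq_or_lt_of_le (show 1 ≤ γ 1 0 by omega) with h' | h'
      · exact Or.inl h'.symm
      · exact Or.inr (Or.inr (by nlinarith))
  rcases hcase with h | h | h
  · have h1 := hz (-γ 1 1)
    rw [h]
    push_cast at h1 ⊢
    linarith
  · have h1 := hz (γ 1 1)
    rw [h]
    push_cast
    linarith
  · have h' : (4 : ℝ) ≤ (γ 1 0 : ℝ) ^ 2 := by exact_mod_cast h
    nlinarith [sq_nonneg ((γ 1 0 : ℝ) * z.re + γ 1 1)]

theorem lower_left_inv (γ : SL(2, ℤ)) : γ⁻¹ 1 0 = -γ 1 0 := by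
  rw [Matrix.SpecialLinearGroup.SL2_inv_expl]
  simp

/-- Otherwise both `γ` and its inverse would lower a point. The consequence is that the regions
belonging to different horoballs are disjoint. -/
theorem lower_left_eq_zero {γ : SL(2, ℤ)} {z : ℍ} (hz : z ∈ upperRegion)
    (hz' : modular γ • z ∈ upperRegion) : γ 1 0 = 0 := by
  by_contra hc
  have h1 := im_modular_smul_lt hz hc
  have h2 := im_modular_smul_lt hz' (γ := γ⁻¹) (by rw [lower_left_inv]; simpa using hc)
  rw [map_inv, inv_smul_smul] at h2
  linarith

theorem mem_upperRegion_of_im {z : ℍ} (hz : 1 < z.im) : z ∈ upperRegion := fun n => by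
  nlinarith [sq_nonneg (z.re - n)]

theorem dyad_smul_mem_upperRegion (k : ℕ) (m : ℤ) {v : ℍ} (hv : v ∈ tileO) :
    dyad k (-m) • v ∈ upperRegion := by
  by_cases hy : 1 < v.im
  · refine mem_upperRegion_of_im ?_
    rw [dyad_im, zpow_natCast]
    have : (1 : ℝ) ≤ 2 ^ k := one_le_pow₀ (by norm_num)
    nlinarith
  rcases k with _ | k
  · rcases tileO_cases hv with h | ⟨d, hd, h⟩ | h
    · exact absurd h.2.2.1 hy
    · obtain ⟨e, rfl⟩ : ∃ e : ℤ, d = e := by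
        rcases hd with rfl | rfl
        · exact ⟨0, by simp⟩
        · exact ⟨1, by simp⟩
      intro n
      simp only [dyad_re, dyad_im, CharP.cast_eq_zero, zpow_zero, one_mul]
      obtain ⟨h1, h2, h3, h4, h5⟩ := h
      rcases le_or_gt (m + n) e with hle | hle
      · have : ((m + n : ℤ) : ℝ) ≤ e := Int.cast_le.mpr hle
        push_cast at this
        nlinarith
      · have : ((e + 1 : ℤ) : ℝ) ≤ (m + n : ℤ) := Int.cast_le.mpr hle
        push_cast at this
        nlinarith
    · exact absurd (by linarith [(bumpO_bounds h).2.2.1]) hy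
  · refine mem_upperRegion_of_im ?_
    rw [dyad_im, zpow_natCast]
    have : (1 : ℝ) ≤ 2 ^ k := one_le_pow₀ (by norm_num)
    have := (tileO_im hv).1
    rw [pow_succ]
    nlinarith

theorem modular_T_zpow (j : ℤ) : modular (ModularGroup.T ^ j) = dyad 0 j := by
  refine G_ext fun z => ?_
  have : modular (ModularGroup.T ^ j) • z = ModularGroup.T ^ j • z := rfl
  rw [this]
  refine UpperHalfPlane.ext_re_im ?_ ?_
  · rw [ModularGroup.re_T_zpow_smul, dyad_re]; simp
  · rw [ModularGroup.im_T_zpow_smul, dyad_im]; simp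

theorem modular_eq_dyad {γ : SL(2, ℤ)} (hc : γ 1 0 = 0) : ∃ j : ℤ, modular γ = dyad 0 j ∧
    (γ = ModularGroup.T ^ j ∨ γ = -ModularGroup.T ^ j) := by
  have hdet := γ.det_coe
  rw [Matrix.det_fin_two, hc, mul_zero, sub_zero] at hdet
  rcases Int.mul_eq_one_iff_eq_one_or_neg_one.mp hdet with ⟨h1, h2⟩ | ⟨h1, h2⟩
  · have e : γ = ModularGroup.T ^ (γ 0 1) := by
      ext i j
      rw [ModularGroup.coe_T_zpow]
      fin_cases i <;> fin_cases j <;> simp [h1, h2, hc]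
    exact ⟨γ 0 1, by rw [← modular_T_zpow, ← e], Or.inl e⟩
  · have e : γ = -ModularGroup.T ^ (-γ 0 1) := by
      ext i j
      rw [Matrix.SpecialLinearGroup.coe_neg, ModularGroup.coe_T_zpow]
      fin_cases i <;> fin_cases j <;> simp [h1, h2, hc]
    refine ⟨-γ 0 1, ?_, Or.inr e⟩
    rw [← modular_T_zpow]
    refine G_ext fun z => ?_
    conv_lhs => rw [e]
    exact ModularGroup.SL_neg_smul _ z

theorem modular_neg (γ : SL(2, ℤ)) : modular (-γ) = modular γ :=
  G_ext fun z => ModularGroup.SL_neg_smul γ z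

theorem fixesInfty_modular_iff (γ : SL(2, ℤ)) : FixesInfty (modular γ) ↔ γ 1 0 = 0 := by
  rw [modular_apply, fixesInfty_toG_iff]
  simp

/-! ### Positions of the tiles of a tiling -/

/-- The positions of the tiles of a tiling. -/
def pos (T : Tiling) : Set G := {h | h • tile ∈ T.tiles}

theorem mul_mem_pos_smul {g h : G} {T : Tiling} : g * h ∈ pos (g • T) ↔ h ∈ pos T :=
  Tiling.smul_tile_mem_smul g h T

theorem mem_pos_smul {g h : G} {T : Tiling} : h ∈ pos (g • T) ↔ g⁻¹ * h ∈ pos T := by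
  rw [← mul_mem_pos_smul (g := g) (h := g⁻¹ * h), mul_inv_cancel_left]

theorem exists_pos_of_mem {T : Tiling} {t : Set ℍ} (ht : t ∈ T.tiles) : ∃ p ∈ pos T, t = p • tile := by
  obtain ⟨g, rfl⟩ := T.congruent t ht
  exact ⟨g, ht, rfl⟩

theorem exists_pos_cover (T : Tiling) (z : ℍ) : ∃ p ∈ pos T, z ∈ p • tile := by
  obtain ⟨t, ht, hz⟩ : z ∈ ⋃₀ T.tiles := by rw [T.cover]; trivial
  obtain ⟨p, hp, rfl⟩ := exists_pos_of_mem ht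
  exact ⟨p, hp, hz⟩

theorem pos_nonempty (T : Tiling) : (pos T).Nonempty := by
  obtain ⟨p, hp, _⟩ := exists_pos_cover T UpperHalfPlane.I
  exact ⟨p, hp⟩

theorem pos_eq_of_overlap {T : Tiling} {p q : G} (hp : p ∈ pos T) (hq : q ∈ pos T) {z : ℍ}
    (h1 : z ∈ p • tileO) (h2 : z ∈ q • tileO) : p = q := by
  refine smul_tile_inj (by_contra fun hne => ?_)
  have := T.disjoint _ hp _ hq hne
  rw [interior_smul, interior_smul] at this
  exact Set.disjoint_left.mp this (Set.smul_set_mono tileO_subset_interior h1)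
    (Set.smul_set_mono tileO_subset_interior h2)

theorem exists_ball_subset : ∃ ε : ℝ, 0 < ε ∧ Metric.ball ctr ε ⊆ tileO :=
  Metric.isOpen_iff.mp isOpen_tileO ctr ctr_mem

/-- The radius of a ball inside the tile. -/
def inrad : ℝ := exists_ball_subset.choose

theorem inrad_pos : 0 < inrad := exists_ball_subset.choose_spec.1

theorem mem_tileO_of_dist {z : ℍ} (h : dist z ctr < inrad) : z ∈ tileO :=
  exists_ball_subset.choose_spec.2 h

theorem mem_smul_tileO_of_dist {p : G} {z : ℍ} (h : dist z (p • ctr) < inrad) : z ∈ p • tileO := by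
  rw [Set.mem_smul_set_iff_inv_smul_mem]
  refine mem_tileO_of_dist ?_
  rwa [← dist_smul p, smul_inv_smul]

theorem pos_eq_of_dist {T : Tiling} {p q : G} (hp : p ∈ pos T) (hq : q ∈ pos T)
    (h : dist (p • ctr) (q • ctr) < inrad) : p = q :=
  pos_eq_of_overlap hp hq (Set.smul_mem_smul_set ctr_mem) (mem_smul_tileO_of_dist h)

/-- The tiles of `T` already cover the plane: the centre of any tile of `T'` lies in a tile of `T`,
whose open part then overlaps the given tile. This reduces equalities of tilings to one inclusion
throughout. -/
theorem pos_eq_of_subset {T T' : Tiling} (h : pos T ⊆ pos T') : pos T = pos T' := by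
  refine h.antisymm fun p hp => ?_
  obtain ⟨q, hq, hz⟩ := exists_pos_cover T (p • ctr)
  rw [Set.mem_smul_set_iff_inv_smul_mem] at hz
  have h1 := Metric.mem_closure_iff.mp (tile_subset_closure hz) inrad inrad_pos
  obtain ⟨w, hw, hd⟩ := h1
  have h2 : q • w ∈ p • tileO := mem_smul_tileO_of_dist (by
    rwa [dist_comm, ← dist_smul q⁻¹, inv_smul_smul])
  rwa [pos_eq_of_overlap hp (h hq) h2 (Set.smul_mem_smul_set hw)]

theorem tiling_ext {T T' : Tiling} (h : pos T = pos T') : T = T' := by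
  ext t
  constructor <;> intro ht
  · obtain ⟨p, hp, rfl⟩ := exists_pos_of_mem ht
    rw [h] at hp; exact hp
  · obtain ⟨p, hp, rfl⟩ := exists_pos_of_mem ht
    rw [← h] at hp; exact hp

theorem tiling_eq_of_subset {T T' : Tiling} (h : pos T ⊆ pos T') : T = T' :=
  tiling_ext (pos_eq_of_subset h)

/-- A tiling given by the positions of its tiles. -/
def ofPos (P : Set G) (hc : ∀ z : ℍ, ∃ p ∈ P, z ∈ p • tile)
    (hd : ∀ p ∈ P, ∀ q ∈ P, ∀ z : ℍ, z ∈ p • tileO → z ∈ q • tileO → p = q) : Tiling where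
  tiles := Set.image (fun p : G => p • tile) P
  congruent := by rintro _ ⟨p, _, rfl⟩; exact ⟨p, rfl⟩
  disjoint := by
    rintro _ ⟨p, hp, rfl⟩ _ ⟨q, hq, rfl⟩ hne
    have hcl : ∀ (g : G), g • tile ⊆ closure (g • tileO) := fun g => by
      rw [closure_smul]
      exact Set.smul_set_mono tile_subset_closure
    rw [Set.disjoint_iff_inter_eq_empty, ← Set.not_nonempty_iff_eq_empty]
    rintro ⟨z, hz1, hz2⟩
    have h1 := mem_closure_iff.mp (hcl p (interior_subset hz1)) _
      (isOpen_interior.inter isOpen_interior) ⟨hz1, hz2⟩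
    obtain ⟨w, ⟨hw1, hw2⟩, hwp⟩ := h1
    have h2 := mem_closure_iff.mp (hcl q (interior_subset hw2)) _ (isOpen_tileO.smul p) hwp
    obtain ⟨u, hu1, hu2⟩ := h2
    exact hne (congrArg (fun p : G => p • tile) (hd p hp q hq u hu1 hu2))
  cover := by
    refine Set.eq_univ_of_forall fun z => ?_
    obtain ⟨p, hp, hz⟩ := hc z
    exact ⟨_, ⟨p, hp, rfl⟩, hz⟩

theorem pos_ofPos {P : Set G} {hc} {hd} : pos (ofPos P hc hd) = P := by
  ext p
  constructor
  · rintro ⟨q, hq, h⟩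
    rwa [← smul_tile_inj h]
  · exact fun hp => ⟨p, hp, rfl⟩

/-- A ball of radius `R` is covered by finitely many balls too small to contain the centres of two
different tiles. -/
theorem finite_pos_near (T : Tiling) (R : ℝ) :
    {p ∈ pos T | dist (p • ctr) UpperHalfPlane.I ≤ R}.Finite := by
  have hcpt : TotallyBounded (Metric.closedBall (UpperHalfPlane.I : ℍ) R) :=
    (isCompact_closedBall _ _).totallyBounded
  obtain ⟨t, ht, hsub⟩ := Metric.totallyBounded_iff.mp hcpt (inrad / 2) (half_pos inrad_pos)
  refine Set.Finite.subset (ht.biUnion (t := fun y => {p ∈ pos T | dist (p • ctr) y < inrad / 2})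
    fun y _ => Set.Subsingleton.finite ?_) ?_
  · rintro p ⟨hp, hpy⟩ q ⟨hq, hqy⟩
    refine pos_eq_of_dist hp hq ?_
    have := dist_triangle_right (p • ctr) (q • ctr) y
    linarith
  · rintro p ⟨hp, hpR⟩
    obtain ⟨y, hy, hpy⟩ := Set.mem_iUnion₂.mp (hsub hpR)
    exact Set.mem_iUnion₂.mpr ⟨y, hy, hp, hpy⟩

/-! ### Convergence of tilings -/

theorem tendsto_tiling_iff {ι : Type*} {l : Filter ι} {S : ι → Tiling} {T : Tiling} :
    Tendsto S l (𝓝 T) ↔ ∀ R ε : ℝ, 0 < ε → ∀ᶠ n in l, (T, S n) ∈ Tiling.entourage R ε := by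
  rw [(nhds_basis_uniformity' Tiling.hasBasis_uniformity).tendsto_right_iff]
  exact ⟨fun h R ε hε => h (R, ε) hε, fun h i hi => h i.1 i.2 hi⟩

/-- This allows closures and continuity to be tested with sequences. -/
instance : (𝓤 Tiling).IsCountablyGenerated := by
  have : (𝓤 Tiling).HasBasis (fun _ : ℕ => True)
      (fun n => Tiling.entourage n (1 / ((n : ℝ) + 1))) := by
    refine Tiling.hasBasis_uniformity.to_hasBasis ?_ ?_
    · rintro ⟨R, ε⟩ hε
      obtain ⟨n, hn⟩ := exists_nat_gt (max R (1 / ε))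
      refine ⟨n, trivial, fun P hP => ⟨hP.1.mono ?_ ?_, hP.2.mono ?_ ?_⟩⟩
      all_goals first
        | exact ((le_max_left _ _).trans hn.le)
        | (have h1 : 1 / ε < n := (le_max_right _ _).trans_lt hn
           have hε' : 0 < ε := hε
           rw [div_lt_iff₀ hε'] at h1
           simp only
           rw [div_le_iff₀ (by positivity)]
           nlinarith)
    · intro n _
      exact ⟨(n, 1 / ((n : ℝ) + 1)), by positivity, subset_rfl⟩
  exact this.isCountablyGenerated

/-- Choose for each `n` an element that minimizes `d n` up to `1 / (n + 1)`. This turns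
approximations for each `ε` into a single sequence. -/
theorem exists_tendsto_zero_of_eventually {β : Type*} [Nonempty β] {l : Filter ℕ} (hl : l ≤ atTop)
    (P : ℕ → β → Prop) (d : ℕ → β → ℝ) (hd : ∀ n x, 0 ≤ d n x)
    (h : ∀ ε > 0, ∀ᶠ n in l, ∃ x, P n x ∧ d n x < ε) :
    ∃ x : ℕ → β, (∀ᶠ n in l, P n (x n)) ∧ Tendsto (fun n => d n (x n)) l (𝓝 0) := by
  have key : ∀ n, ∃ x, (∃ y, P n y) → P n x ∧ ∀ y, P n y → d n x < d n y + 1 / ((n : ℝ) + 1) := by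
    intro n
    by_cases hn : ∃ y, P n y
    · have hbdd : BddBelow (Set.image (d n) {y | P n y}) := ⟨0, by rintro _ ⟨y, _, rfl⟩; exact hd n y⟩
      have hne : (Set.image (d n) {y | P n y}).Nonempty := hn.elim fun y hy => ⟨_, y, hy, rfl⟩
      obtain ⟨_, ⟨x, hx, rfl⟩, hlt⟩ := exists_lt_of_csInf_lt hne
        (show sInf (Set.image (d n) {y | P n y}) < sInf (Set.image (d n) {y | P n y}) + 1 / ((n : ℝ) + 1) by
          have : 0 < 1 / ((n : ℝ) + 1) := by positivity
          linarith)
      refine ⟨x, fun _ => ⟨hx, fun y hy => hlt.trans_le ?_⟩⟩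
      have := csInf_le hbdd ⟨y, hy, rfl⟩
      linarith
    · exact ⟨Classical.arbitrary β, fun h => absurd h hn⟩
  choose x hx using key
  refine ⟨x, ?_, ?_⟩
  · filter_upwards [h 1 one_pos] with n ⟨y, hy, _⟩
    exact (hx n ⟨y, hy⟩).1
  · rw [Metric.tendsto_nhds]
    intro ε hε
    have h1 : ∀ᶠ n : ℕ in l, 1 / ((n : ℝ) + 1) < ε / 2 :=
      hl (tendsto_one_div_add_atTop_nhds_zero_nat.eventually_lt_const (half_pos hε))
    filter_upwards [h (ε / 2) (half_pos hε), h1] with n ⟨y, hy, hlt⟩ hn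
    have := (hx n ⟨y, hy⟩).2 y hy
    rw [Real.dist_0_eq_abs, abs_of_nonneg (hd _ _)]
    linarith

theorem ctr_low : ctr.re = (pt 1 (5 / 4) (by norm_num)).re ∧
    ctr.im ≠ (pt 1 (5 / 4) (by norm_num)).im := by
  constructor
  · rfl
  · simp only [ctr, pt_im]; norm_num

/-- Each tile of the limit is a limit of tiles. -/
theorem exists_conv_of_tendsto {l : Filter ℕ} (hl : l ≤ atTop) {S : ℕ → Tiling} {T : Tiling}
    (h : Tendsto S l (𝓝 T)) {p : G} (hp : p ∈ pos T) :
    ∃ q : ℕ → G, (∀ᶠ n in l, q n ∈ pos (S n)) ∧ Conv l q p := by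
  set low := pt 1 (5 / 4) (by norm_num) with hlow
  obtain ⟨q, h1, h2⟩ := exists_tendsto_zero_of_eventually hl (fun n q => q ∈ pos (S n))
    (fun n q => dist (q • ctr) (p • ctr) + dist (q • low) (p • low))
    (fun _ _ => by positivity) (by
      intro ε hε
      filter_upwards [tendsto_tiling_iff.mp h (dist (p • ctr) UpperHalfPlane.I) (ε / 2)
        (half_pos hε)] with n hn
      obtain ⟨k, hk, hd⟩ := hn.1 (p • tile) hp
        ⟨p • ctr, Set.smul_mem_smul_set (tileO_subset ctr_mem), Metric.mem_closedBall.mpr le_rfl⟩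
      refine ⟨k * p, ?_, ?_⟩
      · rw [← mul_smul] at hk
        exact hk
      · have h1 := hd (p • ctr) (Set.smul_mem_smul_set (tileO_subset ctr_mem))
        have h2 := hd (p • low) (Set.smul_mem_smul_set (tileO_subset low_mem))
        rw [dist_comm] at h1 h2
        rw [mul_smul, mul_smul]
        linarith)
  refine ⟨q, h1, conv_of_two ctr_low.1 ctr_low.2 ?_ ?_⟩
  · rw [tendsto_iff_dist_tendsto_zero]
    exact squeeze_zero (fun _ => dist_nonneg) (fun n => le_add_of_nonneg_right dist_nonneg) h2
  · rw [tendsto_iff_dist_tendsto_zero]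
    exact squeeze_zero (fun _ => dist_nonneg) (fun n => le_add_of_nonneg_left dist_nonneg) h2

/-- Limits of tiles are tiles of the limit. -/
theorem mem_pos_of_tendsto {ι : Type*} {l : Filter ι} [l.NeBot] {S : ι → Tiling} {T : Tiling}
    (h : Tendsto S l (𝓝 T)) {q : ι → G} {p : G} (hq : ∀ᶠ n in l, q n ∈ pos (S n))
    (hc : Conv l q p) : p ∈ pos T := by
  set low := pt 1 (5 / 4) (by norm_num) with hlow
  have key : ∀ ε > 0, ∃ r ∈ pos T, dist (r • ctr) (p • ctr) < ε ∧ dist (r • low) (p • low) < ε := by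
    intro ε hε
    have h1 := tendsto_tiling_iff.mp h (dist (p • ctr) UpperHalfPlane.I + 1) (ε / 2) (half_pos hε)
    have h2 := Metric.tendsto_nhds.mp (hc ctr) (min 1 (ε / 2)) (lt_min one_pos (half_pos hε))
    have h3 := Metric.tendsto_nhds.mp (hc low) (ε / 2) (half_pos hε)
    obtain ⟨n, hn1, hn2, hn3, hn4⟩ := (h1.and (h2.and (h3.and hq))).exists
    obtain ⟨k, hk, hd⟩ := hn1.2 (q n • tile) hn4
      ⟨q n • ctr, Set.smul_mem_smul_set (tileO_subset ctr_mem), Metric.mem_closedBall.mpr (by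
        have := dist_triangle (q n • ctr) (p • ctr) UpperHalfPlane.I
        have := hn2.trans_le (min_le_left _ _)
        linarith)⟩
    refine ⟨k * q n, ?_, ?_, ?_⟩
    · rw [← mul_smul] at hk
      exact hk
    · have e1 := hd (q n • ctr) (Set.smul_mem_smul_set (tileO_subset ctr_mem))
      have e2 := hn2.trans_le (min_le_right _ _)
      have e3 := dist_triangle_left (k • q n • ctr) (p • ctr) (q n • ctr)
      rw [mul_smul]
      linarith
    · have e1 := hd (q n • low) (Set.smul_mem_smul_set (tileO_subset low_mem))
      have e3 := dist_triangle_left (k • q n • low) (p • low) (q n • low)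
      rw [mul_smul]
      linarith
  obtain ⟨r, hr, hr1, -⟩ := key (inrad / 2) (half_pos inrad_pos)
  -- By discreteness of the tiles, the tile found for one small `ε` serves for all of them.
  have hall : ∀ ε > 0, dist (r • ctr) (p • ctr) < ε ∧ dist (r • low) (p • low) < ε := by
    intro ε hε
    obtain ⟨r', hr', h1, h2⟩ := key (min ε (inrad / 2)) (lt_min hε (half_pos inrad_pos))
    have : r = r' := pos_eq_of_dist hr hr' (by
      have := dist_triangle_right (r • ctr) (r' • ctr) (p • ctr)
      have := h1.trans_le (min_le_right _ _)
      linarith)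
    subst this
    exact ⟨h1.trans_le (min_le_left _ _), h2.trans_le (min_le_left _ _)⟩
  have e1 : r • ctr = p • ctr := by
    by_contra hne
    exact lt_irrefl _ (hall _ (dist_pos.mpr hne)).1
  have e2 : r • low = p • low := by
    by_contra hne
    exact lt_irrefl _ (hall _ (dist_pos.mpr hne)).2
  have : p⁻¹ * r = 1 := by
    refine eq_one_of_fix (z := ctr) (w := low) (fun h => ctr_low.2 (congrArg UpperHalfPlane.im h))
      ?_ ?_
    · rw [mul_smul, e1, inv_smul_smul]
    · rw [mul_smul, e2, inv_smul_smul]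
  rw [inv_mul_eq_one.mp this]
  exact hr

/-- Tilings converge if each tile of the limit is a limit of tiles. -/
theorem tendsto_of_conv {ι : Type*} {l : Filter ι} {S : ι → Tiling} {T : Tiling}
    (H : ∀ p ∈ pos T, ∃ q : ι → G, (∀ᶠ n in l, q n ∈ pos (S n)) ∧ Conv l q p) :
    Tendsto S l (𝓝 T) := by
  rw [tendsto_tiling_iff]
  intro R ε hε
  -- A tile has radius at most `20` about its centre. Tiles meeting the ball have their centres
  -- within `R + 20`, and the tiles of `T` covering such centres have theirs within `R + 40`.
  set F := {p ∈ pos T | dist (p • ctr) UpperHalfPlane.I ≤ R + 40} with hF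
  have hFf : F.Finite := finite_pos_near T (R + 40)
  choose! q hq1 hq2 using H
  have h1 : ∀ᶠ n in l, ∀ p ∈ F, q p n ∈ pos (S n) ∧
      ∀ z ∈ tile, dist (q p n • z) (p • z) < min ε (inrad / 2) := by
    rw [hFf.eventually_all]
    intro p hp
    filter_upwards [hq1 p hp.1, (hq2 p hp.1).uniform 4 (lt_min hε (half_pos inrad_pos))]
      with n hn1 hn2
    exact ⟨hn1, fun z hz => hn2 z (tile_bounded hz).1 (tile_bounded hz).2.1 (tile_bounded hz).2.2⟩
  have hmeet : ∀ (p : G), ((p • tile) ∩ Metric.closedBall UpperHalfPlane.I R).Nonempty →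
      dist (p • ctr) UpperHalfPlane.I ≤ R + 20 := by
    rintro p ⟨_, ⟨z, hz, rfl⟩, hR⟩
    have h1 := dist_triangle_left (p • ctr) UpperHalfPlane.I (p • z)
    have h2 := dist_ctr_le hz
    rw [← dist_smul p] at h2
    rw [Metric.mem_closedBall] at hR
    simp only at hR
    linarith
  filter_upwards [h1] with n hn
  constructor
  · intro t ht hm
    obtain ⟨p, hp, rfl⟩ := exists_pos_of_mem ht
    obtain ⟨hn1, hn2⟩ := hn p ⟨hp, by linarith [hmeet p hm]⟩
    refine ⟨q p n * p⁻¹, ?_, ?_⟩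
    · rw [mul_smul, inv_smul_smul]
      exact hn1
    · rintro _ ⟨z, hz, rfl⟩
      simp only
      rw [mul_smul, inv_smul_smul, dist_comm]
      exact (hn2 z hz).trans_le (min_le_left _ _)
  · intro t ht hm
    obtain ⟨h, hh, rfl⟩ := exists_pos_of_mem ht
    have hR := hmeet h hm
    obtain ⟨p, hp, hz⟩ := exists_pos_cover T (h • ctr)
    rw [Set.mem_smul_set_iff_inv_smul_mem] at hz
    have hpF : p ∈ F := by
      refine ⟨hp, ?_⟩
      have h2 := dist_ctr_le hz
      rw [← dist_smul p, smul_inv_smul] at h2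
      have h3 := dist_triangle_left (p • ctr) UpperHalfPlane.I (h • ctr)
      linarith
    obtain ⟨hn1, hn2⟩ := hn p hpF
    obtain ⟨w, hw, hd⟩ := Metric.mem_closure_iff.mp (tile_subset_closure hz) (inrad / 2)
      (half_pos inrad_pos)
    -- The tile `h` of `S n` has its centre in the tile `p` of `T`, so it overlaps the tile of `S n`
    -- close to `p` and coincides with it.
    have heq : h = q p n := by
      refine pos_eq_of_overlap hh hn1 (mem_smul_tileO_of_dist (z := q p n • w) ?_)
        (Set.smul_mem_smul_set hw)
      have e1 := (hn2 w (tileO_subset hw)).trans_le (min_le_right _ _)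
      rw [← dist_smul p, smul_inv_smul, dist_comm] at hd
      have e2 := dist_triangle (q p n • w) (p • w) (h • ctr)
      linarith
    refine ⟨p * (q p n)⁻¹, ?_, ?_⟩
    · rw [heq, mul_smul, inv_smul_smul]
      exact hp
    · rintro _ ⟨z, hz, rfl⟩
      simp only
      rw [heq, mul_smul, inv_smul_smul]
      exact (hn2 z hz).trans_le (min_le_left _ _)

theorem tiling_tendsto_unique {l : Filter ℕ} [l.NeBot] (hl : l ≤ atTop) {S : ℕ → Tiling}
    {T T' : Tiling} (h : Tendsto S l (𝓝 T)) (h' : Tendsto S l (𝓝 T')) : T = T' := by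
  refine tiling_eq_of_subset fun p hp => ?_
  obtain ⟨q, h1, h2⟩ := exists_conv_of_tendsto hl h hp
  exact mem_pos_of_tendsto h' h1 h2

/-! ### Divisibility by powers of two among the dyadic integers -/

theorem two_pow_dvd_int_iff (n : ℕ) (a : ℤ) : (2 : ℤ_[2]) ^ n ∣ (a : ℤ_[2]) ↔ (2 : ℤ) ^ n ∣ a := by
  have := PadicInt.pow_p_dvd_int_iff (p := 2) n a
  exact_mod_cast this

theorem two_dvd_or (b : ℤ_[2]) : 2 ∣ b ∨ 2 ∣ b - 1 := by
  obtain ⟨n, hn, h⟩ := PadicInt.exists_mem_range b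
  rw [PadicInt.maximalIdeal_eq_span_p, Ideal.mem_span_singleton] at h
  have h' : (2 : ℤ_[2]) ∣ b - n := by exact_mod_cast h
  interval_cases n
  · left; simpa using h'
  · right; simpa using h'

/-- The two alternatives correspond to the two prongs of the parent that may fill the upper dent of
a tile. -/
theorem two_pow_succ_dvd_or {n : ℕ} {a : ℤ_[2]} (h : 2 ^ n ∣ a) :
    2 ^ (n + 1) ∣ a ∨ 2 ^ (n + 1) ∣ a - 2 ^ n := by
  obtain ⟨b, rfl⟩ := h
  rcases two_dvd_or b with ⟨c, hc⟩ | ⟨c, hc⟩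
  · exact Or.inl ⟨c, by rw [hc]; ring⟩
  · exact Or.inr ⟨c, by rw [eq_add_of_sub_eq hc]; ring⟩

theorem appr_dvd (a : ℤ_[2]) (n : ℕ) : (2 : ℤ_[2]) ^ n ∣ a - (a.appr n : ℤ) := by
  have := PadicInt.appr_spec n a
  rw [Ideal.mem_span_singleton] at this
  exact_mod_cast this

theorem two_pow_dvd_iff_norm (n : ℕ) (a : ℤ_[2]) : (2 : ℤ_[2]) ^ n ∣ a ↔ ‖a‖ ≤ 2 ^ (-n : ℤ) := by
  have := PadicInt.norm_le_pow_iff_mem_span_pow a n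
  rw [Ideal.mem_span_singleton] at this
  exact_mod_cast this.symm

theorem eq_zero_of_forall_dvd {a : ℤ_[2]} (h : ∀ n : ℕ, (2 : ℤ_[2]) ^ (n + 1) ∣ a) : a = 0 := by
  rw [← norm_eq_zero]
  refine le_antisymm ?_ (norm_nonneg a)
  have h1 : Tendsto (fun n : ℕ => ((1 : ℝ) / 2) ^ (n + 1)) atTop (𝓝 0) :=
    (tendsto_add_atTop_iff_nat 1).mpr (tendsto_pow_atTop_nhds_zero_of_lt_one (by norm_num) (by norm_num))
  refine ge_of_tendsto' h1 fun n => ?_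
  have := (two_pow_dvd_iff_norm _ _).mp (h n)
  rwa [zpow_neg, zpow_natCast, ← inv_pow, ← one_div] at this

/-! ### The tiling given by dyadic labels -/

/-- `f` assigns dyadic integers to the pairs of a triangle and an adjacent horoball of the standard
packing, increasing by `1` along each horoball. -/
structure IsLabel (f : SL(2, ℤ) → ℤ_[2]) : Prop where
  neg : ∀ γ, f (-γ) = f γ
  mul_T : ∀ γ, f (γ * ModularGroup.T) = f γ + 1

theorem IsLabel.mul_T_zpow {f : SL(2, ℤ) → ℤ_[2]} (hf : IsLabel f) (γ : SL(2, ℤ)) (j : ℤ) :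
    f (γ * ModularGroup.T ^ j) = f γ + j := by
  induction j using Int.induction_on with
  | zero => simp
  | succ i ih =>
    rw [zpow_add_one, ← mul_assoc, hf.mul_T, ih]
    push_cast; ring
  | pred i ih =>
    have := hf.mul_T (γ * ModularGroup.T ^ (-(i : ℤ) - 1))
    rw [mul_assoc, ← zpow_add_one, sub_add_cancel, ih] at this
    rw [eq_sub_of_add_eq this.symm]
    push_cast; ring

theorem IsLabel.comp_mul {f : SL(2, ℤ) → ℤ_[2]} (hf : IsLabel f) (γ : SL(2, ℤ)) :
    IsLabel (fun δ => f (γ * δ)) where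
  neg δ := by rw [mul_neg, hf.neg]
  mul_T δ := by rw [← mul_assoc, hf.mul_T]

theorem IsLabel.add_const {f : SL(2, ℤ) → ℤ_[2]} (hf : IsLabel f) (e : ℤ_[2]) :
    IsLabel (fun δ => f δ + e) where
  neg δ := by rw [hf.neg]
  mul_T δ := by rw [hf.mul_T]; ring

/-- The positions of the tiles determined by labels. -/
def labelPos (f : SL(2, ℤ) → ℤ_[2]) : Set G :=
  {p | ∃ (γ : SL(2, ℤ)) (k : ℕ) (m : ℤ), 2 ^ (k + 1) ∣ f γ - m ∧ p = modular γ * dyad k (-m)}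

theorem eq_of_inv_mul_lower_left {γ γ' : SL(2, ℤ)} (h : (γ'⁻¹ * γ) 1 0 = 0) : ∃ j : ℤ,
    modular γ = modular γ' * dyad 0 j ∧
      (γ = γ' * ModularGroup.T ^ j ∨ γ = -(γ' * ModularGroup.T ^ j)) := by
  obtain ⟨j, h1, h2⟩ := modular_eq_dyad h
  refine ⟨j, ?_, ?_⟩
  · rw [← h1, map_mul, map_inv, mul_inv_cancel_left]
  · refine h2.imp (fun h => ?_) (fun h => ?_)
    · rw [← h, mul_inv_cancel_left]
    · rw [← mul_neg, ← h, mul_inv_cancel_left]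

theorem IsLabel.eq_add {f : SL(2, ℤ) → ℤ_[2]} (hf : IsLabel f) {γ γ' : SL(2, ℤ)} {j : ℤ}
    (h : γ = γ' * ModularGroup.T ^ j ∨ γ = -(γ' * ModularGroup.T ^ j)) : f γ = f γ' + j := by
  rcases h with rfl | rfl
  · rw [hf.mul_T_zpow]
  · rw [hf.neg, hf.mul_T_zpow]

/-- The level of a position and the horoball it belongs to are unique. -/
theorem modular_mul_dyad_inj {γ γ' : SL(2, ℤ)} {k k' : ℤ} {x x' : ℝ}
    (h : modular γ * dyad k x = modular γ' * dyad k' x') : k = k' ∧ ∃ j : ℤ,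
      modular γ = modular γ' * dyad 0 j ∧
      (γ = γ' * ModularGroup.T ^ j ∨ γ = -(γ' * ModularGroup.T ^ j)) ∧ x + j = x' := by
  have h1 : modular (γ'⁻¹ * γ) = dyad k' x' * (dyad k x)⁻¹ := by
    rw [map_mul, map_inv, eq_mul_inv_iff_mul_eq, mul_assoc, h, inv_mul_cancel_left]
  have h2 : (γ'⁻¹ * γ) 1 0 = 0 := by
    rw [← fixesInfty_modular_iff, h1]
    exact (fixesInfty_dyad _ _).mul (fixesInfty_dyad _ _).inv
  obtain ⟨j, h3, h4⟩ := eq_of_inv_mul_lower_left h2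
  rw [h3, mul_assoc, mul_right_inj, dyad_mul] at h
  obtain ⟨h5, h6⟩ := dyad_inj h
  exact ⟨by omega, j, h3, h4, by simpa using h6⟩

theorem mem_labelPos_iff {f : SL(2, ℤ) → ℤ_[2]} (hf : IsLabel f) {γ : SL(2, ℤ)} {k : ℕ} {m : ℤ} :
    modular γ * dyad k (-m) ∈ labelPos f ↔ 2 ^ (k + 1) ∣ f γ - m := by
  constructor
  · rintro ⟨γ', k', m', h, he⟩
    obtain ⟨hk, j, -, h2, h3⟩ := modular_mul_dyad_inj he
    have hk' : k = k' := by exact_mod_cast hk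
    have hm : m = m' + j := by
      have : (m : ℝ) = m' + j := by linarith
      exact_mod_cast this
    rw [hf.eq_add h2, hm, hk']
    push_cast
    rwa [add_sub_add_right_eq_sub]
  · exact fun h => ⟨γ, k, m, h, rfl⟩

/-- Rescaling by the lower of the two levels turns the congruence into the integral offset of
`tileO_disjoint_aux`. -/
theorem dyad_tileO_disjoint {k k' : ℕ} {m m' : ℤ} (hdvd : (2 : ℤ) ^ (min k k' + 1) ∣ m - m')
    {v v' : ℍ} (hv : v ∈ tileO) (hv' : v' ∈ tileO)
    (h : dyad k (-m) • v = dyad k' (-m') • v') : k = k' ∧ m = m' := by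
  wlog hle : k ≤ k' generalizing k k' m m' v v'
  · have := this (k := k') (k' := k) (m := m') (m' := m)
      (by rw [min_comm]; rw [← neg_sub, dvd_neg] at hdvd; exact hdvd) hv' hv h.symm
      (le_of_not_ge hle)
    exact ⟨this.1.symm, this.2.symm⟩
  obtain ⟨D, rfl⟩ := Nat.exists_eq_add_of_le hle
  rw [min_eq_left hle] at hdvd
  obtain ⟨r, hr⟩ := hdvd
  have h1 := congrArg UpperHalfPlane.re h
  have h2 := congrArg UpperHalfPlane.im h
  simp only [dyad_re, dyad_im, zpow_natCast, pow_add] at h1 h2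
  have h0 : (2 : ℝ) ^ k ≠ 0 := by positivity
  have hr' : (m : ℝ) - m' = 2 ^ k * 2 * r := by
    have := congrArg (Int.cast : ℤ → ℝ) hr
    push_cast at this
    rw [pow_succ] at this
    exact this
  have := tileO_disjoint_aux hv hv' (D := D) (r := -r) (by
    refine mul_left_cancel₀ h0 ?_
    push_cast
    linear_combination h1 + hr') (by
    refine mul_left_cancel₀ h0 ?_
    linear_combination h2)
  obtain ⟨rfl, hr0⟩ := this
  refine ⟨by simp, ?_⟩
  have : r = 0 := by omega
  rw [this, mul_zero] at hr
  omega

/-- Overlapping tiles belong to the same horoball by `lower_left_eq_zero`. There, both offsets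
approximate the same label, so they are congruent modulo the smaller of the two powers of two. -/
theorem labelPos_disjoint {f : SL(2, ℤ) → ℤ_[2]} (hf : IsLabel f) {p q : G} (hp : p ∈ labelPos f)
    (hq : q ∈ labelPos f) {z : ℍ} (h1 : z ∈ p • tileO) (h2 : z ∈ q • tileO) : p = q := by
  obtain ⟨γ, k, m, h, rfl⟩ := hp
  obtain ⟨γ', k', m', h', rfl⟩ := hq
  obtain ⟨v, hv, hz⟩ := h1
  obtain ⟨v', hv', hz'⟩ := h2
  simp only [mul_smul] at hz hz'
  have hu := dyad_smul_mem_upperRegion k m hv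
  have hu' := dyad_smul_mem_upperRegion k' m' hv'
  have he : modular (γ'⁻¹ * γ) • dyad k (-m) • v = dyad k' (-m') • v' := by
    rw [map_mul, map_inv, mul_smul, hz, inv_smul_eq_iff, hz']
  obtain ⟨j, h3, h4⟩ := eq_of_inv_mul_lower_left (lower_left_eq_zero hu (by rw [he]; exact hu'))
  have he' : dyad k (-(m - j : ℤ)) • v = dyad k' (-m') • v' := by
    rw [map_mul, map_inv, h3, inv_mul_cancel_left, ← mul_smul, dyad_mul] at he
    rw [← he, zero_add]
    congr 2
    push_cast
    simp
    ring
  rw [hf.eq_add h4] at h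
  have hd : (2 : ℤ) ^ (min k k' + 1) ∣ (m - j) - m' := by
    rw [← two_pow_dvd_int_iff]
    have a1 : (2 : ℤ_[2]) ^ (min k k' + 1) ∣ f γ' + j - m :=
      (pow_dvd_pow _ (by omega)).trans h
    have a2 : (2 : ℤ_[2]) ^ (min k k' + 1) ∣ f γ' - m' :=
      (pow_dvd_pow _ (by omega)).trans h'
    have := dvd_sub a2 a1
    convert this using 1
    push_cast; ring
  obtain ⟨rfl, hm⟩ := dyad_tileO_disjoint hd hv hv' he'
  rw [h3, mul_assoc, dyad_mul, zero_add, ← hm]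
  congr 2
  push_cast
  simp
  ring

/-- Covering a point of the horoball at `∞` at a given level. -/
theorem exists_dyad_core (k : ℤ) (c : ℝ) {z : ℍ} (h1 : 2 ^ k ≤ z.im) (h2 : z.im ≤ 2 ^ (k + 1)) :
    ∃ l : ℤ, ∃ v ∈ core, z = dyad k (-c + 2 ^ (k + 1) * l) • v := by
  have h0 : (0 : ℝ) < 2 ^ k := by positivity
  have h3 : (2 : ℝ) ^ (k + 1) = 2 ^ k * 2 := zpow_add_one₀ two_ne_zero k
  refine ⟨⌊(z.re + c) / 2 ^ (k + 1)⌋, (dyad k _)⁻¹ • z, ?_, (smul_inv_smul _ _).symm⟩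
  have hf1 := Int.floor_le ((z.re + c) / 2 ^ (k + 1))
  have hf2 := Int.lt_floor_add_one ((z.re + c) / 2 ^ (k + 1))
  set l := ⌊(z.re + c) / 2 ^ (k + 1)⌋
  rw [h3, le_div_iff₀ (by positivity)] at hf1
  rw [h3, div_lt_iff₀ (by positivity)] at hf2
  rw [dyad_inv]
  have hre : (dyad (-k) (-(-c + 2 ^ (k + 1) * l) / 2 ^ k) • z).re =
      (z.re + c - 2 ^ k * 2 * l) / 2 ^ k := by
    rw [dyad_re, h3, zpow_neg]
    field_simp
    ring
  have him : (dyad (-k) (-(-c + 2 ^ (k + 1) * l) / 2 ^ k) • z).im = z.im / 2 ^ k := by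
    rw [dyad_im, zpow_neg]
    field_simp
  rw [mem_core, hre, him]
  refine ⟨div_nonneg (by linarith) h0.le, ?_, ?_, ?_⟩
  · rw [div_le_iff₀ h0]; linarith
  · rw [le_div_iff₀ h0]; linarith
  · rw [div_le_iff₀ h0]; linarith

/-- The tile, its left neighbour, or its parent, covers a point of the core. -/
theorem core_cover_smul (k : ℤ) (x : ℝ) {v : ℍ} (hv : v ∈ core) :
    dyad k x • v ∈ dyad k x • tile ∨ dyad k x • v ∈ dyad k (x - 2 ^ (k + 1)) • tile ∨
    (dyad k x • v ∈ dyad (k + 1) x • tile ∧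
      dyad k x • v ∈ dyad (k + 1) (x - 2 ^ (k + 1)) • tile) := by
  have h3 : (2 : ℝ) ^ (k + 1) = 2 ^ k * 2 := zpow_add_one₀ two_ne_zero k
  refine (core_cover hv).imp (fun h => Set.smul_mem_smul_set h) (Or.imp (fun h => ?_) ?_)
  · refine ⟨_, h, ?_⟩
    simp only [← mul_smul, dyad_mul]
    congr 2
    · simp
    · rw [h3]; ring
  · rintro ⟨h, h'⟩
    refine ⟨⟨_, h, ?_⟩, ⟨_, h', ?_⟩⟩
    · simp only [← mul_smul, dyad_mul]
      congr 2
      · simp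
      · simp
    · simp only [← mul_smul, dyad_mul]
      congr 2
      · simp
      · rw [h3]; ring

/-- Move the point into the fundamental domain of the modular group, where it lies in the horoball
at `∞` or in the adjacent third of a triangle. -/
theorem labelPos_cover {f : SL(2, ℤ) → ℤ_[2]} (z : ℍ) :
    ∃ p ∈ labelPos f, z ∈ p • tile := by
  obtain ⟨γ, hγ⟩ := ModularGroup.exists_smul_mem_fd z
  set z' : ℍ := modular γ • z with hz'
  have hfd : 1 ≤ z'.re ^ 2 + z'.im ^ 2 ∧ |z'.re| ≤ 1 / 2 := by
    have h1 := hγ.1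
    rw [Complex.normSq_apply] at h1
    refine ⟨?_, hγ.2⟩
    rw [pow_two, pow_two]
    exact h1
  suffices H : ∃ (k : ℕ) (m : ℤ), (2 : ℤ_[2]) ^ (k + 1) ∣ f γ⁻¹ - m ∧ z' ∈ dyad k (-m) • tile by
    obtain ⟨k, m, h1, h2⟩ := H
    refine ⟨_, ⟨γ⁻¹, k, m, h1, rfl⟩, ?_⟩
    rw [mul_smul, Set.mem_smul_set_iff_inv_smul_mem, map_inv, inv_inv]
    exact h2
  rcases le_total 1 z'.im with hy | hy
  · obtain ⟨k, hk1, hk2⟩ := exists_nat_pow_near hy (one_lt_two : (1 : ℝ) < 2)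
    obtain ⟨m₀, hm₀⟩ : ∃ m₀ : ℤ, m₀ = ((f γ⁻¹).appr (k + 1) : ℕ) := ⟨_, rfl⟩
    obtain ⟨l, v, hv, hzv⟩ := exists_dyad_core (k : ℤ) m₀ (z := z') (by exact_mod_cast hk1)
      (by exact_mod_cast hk2.le)
    set m : ℤ := m₀ - 2 ^ (k + 1) * l with hm
    have hdvd : (2 : ℤ_[2]) ^ (k + 1) ∣ f γ⁻¹ - m := by
      have h1 := appr_dvd (f γ⁻¹) (k + 1)
      rw [← hm₀] at h1
      have h2 : (2 : ℤ_[2]) ^ (k + 1) ∣ 2 ^ (k + 1) * l := dvd_mul_right _ _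
      convert dvd_add h1 h2 using 1
      rw [hm]; push_cast; ring
    have hx : -(m₀ : ℝ) + 2 ^ ((k : ℤ) + 1) * l = -m := by
      have : (2 : ℝ) ^ ((k : ℤ) + 1) = 2 ^ (k + 1) := by exact_mod_cast rfl
      rw [hm, this]; push_cast; ring
    rw [hx] at hzv
    have h2 : (2 : ℝ) ^ ((k : ℤ) + 1) = ((2 ^ (k + 1) : ℤ) : ℝ) := by push_cast; exact_mod_cast rfl
    rcases core_cover_smul k (-m) hv with h | h | ⟨h, h'⟩
    · exact ⟨k, m, hdvd, by rw [hzv]; exact h⟩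
    · refine ⟨k, m + 2 ^ (k + 1), ?_, ?_⟩
      · have h2 : (2 : ℤ_[2]) ^ (k + 1) ∣ 2 ^ (k + 1) := dvd_rfl
        convert dvd_sub hdvd h2 using 1
        push_cast; ring
      · rw [hzv, show (-((m + 2 ^ (k + 1) : ℤ) : ℝ)) = -m - 2 ^ ((k : ℤ) + 1) by
          rw [h2]; push_cast; ring]
        exact h
    -- The point lies in the upper dent. The next digit of the label decides which prong of the
    -- parent fills it.
    · rcases two_pow_succ_dvd_or hdvd with hd | hd
      · exact ⟨k + 1, m, hd, by rw [hzv]; exact_mod_cast h⟩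
      · refine ⟨k + 1, m + 2 ^ (k + 1), ?_, ?_⟩
        · convert hd using 1
          push_cast; ring
        · rw [hzv, show (-((m + 2 ^ (k + 1) : ℤ) : ℝ)) = -m - 2 ^ ((k : ℤ) + 1) by
            rw [h2]; push_cast; ring]
          exact_mod_cast h'
  · obtain ⟨h1, h2⟩ := hfd
    rw [abs_le] at h2
    obtain ⟨n, hn⟩ : ∃ n : ℤ, z' ∈ prong n := by
      rcases le_total 0 z'.re with hx | hx
      · refine ⟨0, mem_prong.mpr ⟨?_, ?_, hy, ?_, ?_⟩⟩ <;> push_cast <;> nlinarith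
      · refine ⟨-1, mem_prong.mpr ⟨?_, ?_, hy, ?_, ?_⟩⟩ <;> push_cast <;> nlinarith
    rw [mem_prong] at hn
    -- The parity of the label of this triangle, `f γ⁻¹ + n`, decides whether the left or the right
    -- prong of a level `0` tile fills the third.
    rcases two_dvd_or (f γ⁻¹ + n) with hd | hd
    · refine ⟨0, -n, by simpa using hd, ?_⟩
      rw [Set.mem_smul_set_iff_inv_smul_mem, dyad_inv]
      refine prong_zero_subset (mem_prong.mpr ?_)
      simp only [dyad_re, dyad_im, CharP.cast_eq_zero, neg_zero, zpow_zero, one_mul, div_one]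
      push_cast
      obtain ⟨a1, a2, a3, a4, a5⟩ := hn
      refine ⟨by linarith, by linarith, by linarith, by linarith, by linarith⟩
    · refine ⟨0, 1 - n, ?_, ?_⟩
      · rw [zero_add, pow_one]
        convert hd using 1
        push_cast; ring
      rw [Set.mem_smul_set_iff_inv_smul_mem, dyad_inv]
      refine prong_one_subset (mem_prong.mpr ?_)
      simp only [dyad_re, dyad_im, CharP.cast_eq_zero, neg_zero, zpow_zero, one_mul, div_one]
      push_cast
      obtain ⟨a1, a2, a3, a4, a5⟩ := hn
      refine ⟨by linarith, by linarith, by linarith, by linarith, by linarith⟩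

/-- The non-degenerate tiling with the given labels, whose packing is the standard one. -/
def labelTiling (f : SL(2, ℤ) → ℤ_[2]) (hf : IsLabel f) : Tiling :=
  ofPos (labelPos f) labelPos_cover fun _ hp _ hq _ => labelPos_disjoint hf hp hq

theorem pos_labelTiling {f : SL(2, ℤ) → ℤ_[2]} (hf : IsLabel f) :
    pos (labelTiling f hf) = labelPos f := pos_ofPos

/-! ### Fixed-sum tilings are given by labels -/

/-- `f` is a labelling for which the three labels at each triangle have sum `w`. -/
structure IsFixedSumLabel (w : ℤ_[2]) (f : SL(2, ℤ) → ℤ_[2]) : Prop extends IsLabel f where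
  sum : ∀ γ, f γ + f (γ * rotation) + f (γ * rotation ^ 2) = w

theorem IsFixedSumLabel.comp_left {w : ℤ_[2]} {f : SL(2, ℤ) → ℤ_[2]} (hf : IsFixedSumLabel w f)
    (γ : SL(2, ℤ)) : IsFixedSumLabel w (fun δ => f (γ * δ)) where
  toIsLabel := hf.comp_mul γ
  sum δ := by simp only [← mul_assoc]; exact hf.sum (γ * δ)

theorem IsFixedSumLabel.add {w e : ℤ_[2]} {f : SL(2, ℤ) → ℤ_[2]} (hf : IsFixedSumLabel w f) :
    IsFixedSumLabel (w + 3 * e) (fun δ => f δ + e) where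
  toIsLabel := hf.add_const e
  sum δ := by rw [← hf.sum δ]; ring

/-- Changing the base triangle. -/
theorem smul_labelTiling_modular {f : SL(2, ℤ) → ℤ_[2]} (hf : IsLabel f) (γ : SL(2, ℤ)) :
    modular γ • labelTiling (fun δ => f (γ * δ)) (hf.comp_mul γ) = labelTiling f hf := by
  refine tiling_eq_of_subset fun p hp => ?_
  rw [mem_pos_smul, pos_labelTiling] at hp
  obtain ⟨δ, k, m, h, he⟩ := hp
  rw [pos_labelTiling]
  refine ⟨γ * δ, k, m, h, ?_⟩
  rw [map_mul, mul_assoc, ← he, mul_inv_cancel_left]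

theorem mul_dyad_overlap {T : Tiling} {p : G} {x : ℝ} (h1 : p ∈ pos T) (h2 : p * dyad 0 x ∈ pos T)
    (hx : |x| < 2) : x = 0 := by
  rw [abs_lt] at hx
  have hmem : ∀ y : ℝ, 0 < y → y < 2 → pt y (6 / 5) (by norm_num) ∈ tileO := by
    intro y hy1 hy2
    refine Or.inl (Or.inl (Or.inl ⟨hy1, hy2, ?_, ?_, ?_, ?_⟩)) <;> simp only [pt_re, pt_im]
    · norm_num
    · norm_num
    · rcases le_total y 1 with h | h
      · left; nlinarith
      · right; nlinarith
    · nlinarith [sq_nonneg y]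
  -- This point is midway between the two tiles; in the coordinates of the second one its abscissa
  -- is `1 - x / 2`.
  have h := pos_eq_of_overlap h1 h2 (z := p • pt (1 + x / 2) (6 / 5) (by norm_num))
    (Set.smul_mem_smul_set (hmem _ (by linarith) (by linarith)))
    ⟨pt (1 - x / 2) (6 / 5) (by norm_num), hmem _ (by linarith) (by linarith), by
      simp only [mul_smul]
      congr 1
      refine UpperHalfPlane.ext_re_im ?_ ?_
      · rw [dyad_re]; simp; ring
      · rw [dyad_im]; simp⟩
  have h3 : dyad 0 x = 1 := mul_eq_left.mp h.symm
  rw [← dyad_zero_zero] at h3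
  exact (dyad_inj h3).2

/-- At level `k` the tile has width `2 ^ (k + 1)`, so tiles of equal level whose offsets differ by
less than that coincide. -/
theorem dvd_of_mem_pos {T : Tiling} {h : G} {k : ℕ} {m m' : ℤ} (h1 : h * dyad k (-m) ∈ pos T)
    (h2 : h * dyad k (-m') ∈ pos T) (hle : |m - m'| ≤ 2 ^ (k + 1)) : (2 : ℤ) ^ (k + 1) ∣ m - m' := by
  rcases eq_or_lt_of_le hle with he | hlt
  · rw [← dvd_abs, he]
  · have h0 : (0 : ℝ) < 2 ^ k := by positivity
    have h3 : h * dyad k (-m) * dyad 0 ((m - m') / 2 ^ k) ∈ pos T := by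
      rw [mul_assoc, dyad_mul]
      convert h2 using 3
      · simp
      · rw [zpow_natCast]; field_simp; ring
    have h4 := mul_dyad_overlap h1 h3 (by
      rw [abs_div, abs_of_pos h0, div_lt_iff₀ h0]
      have : (|m - m'| : ℤ) < (2 : ℤ) ^ (k + 1) := hlt
      have h5 : ((|m - m'| : ℤ) : ℝ) < ((2 ^ (k + 1) : ℤ) : ℝ) := Int.cast_lt.mpr this
      push_cast at h5
      rw [pow_succ] at h5
      linarith)
    have h5 : (m : ℝ) - m' = 0 := by
      rw [div_eq_zero_iff] at h4
      exact h4.resolve_right h0.ne'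
    have h6 : m - m' = 0 := by exact_mod_cast h5
    rw [h6]
    exact dvd_zero _

/-- The digits accumulate along the ancestors: relative to `g`, the ancestor at level `k` has as
offset minus the partial sum of the first `k + 1` digits. The range of `m` makes it the unique
representative of `a` modulo `2 ^ (k + 1)`. -/
theorem Tiling.HasIndex.exists_mem_pos {T : Tiling} {g : G} {a : ℤ_[2]} (H : T.HasIndex g a) (k : ℕ) :
    ∃ m : ℤ, 0 ≤ m ∧ m < 2 ^ (k + 1) ∧ (2 : ℤ_[2]) ^ (k + 1) ∣ a - m ∧ g * dyad k (-m) ∈ pos T := by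
  obtain ⟨d, p, h1, h2, h3, h4⟩ := H
  set S : ℕ → ℤ := fun k => ∑ i ∈ Finset.range k, ((d i : ℕ) : ℤ) * 2 ^ i with hS
  have hdle : ∀ i, ((d i : ℕ) : ℤ) ≤ 1 := fun i => by have := (d i).2; omega
  have hlt : ∀ k, S k < 2 ^ k := by
    intro k
    induction k with
    | zero => simp [hS]
    | succ k ih =>
      have : S (k + 1) = S k + ((d k : ℕ) : ℤ) * 2 ^ k := Finset.sum_range_succ _ _
      rw [this, pow_succ]
      nlinarith [hdle k, pow_pos (two_pos : (0 : ℤ) < 2) k]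
  have hp : ∀ k : ℕ, p k = g * dyad k (-S (k + 1)) := by
    intro k
    induction k with
    | zero =>
      rw [← h2, affineMotion_one_eq, mul_assoc, dyad_mul]
      have : dyad (0 + ((0 : ℕ) : ℤ)) (2 ^ (0 : ℤ) * -((S (0 + 1) : ℤ) : ℝ) + ((d 0 : ℕ) : ℝ)) = 1 := by
        rw [← dyad_zero_zero]
        congr 1
        simp [hS]
      rw [this, mul_one]
    | succ k ih =>
      have h5 := h3 k
      rw [affineMotion_half_eq] at h5
      rw [← mul_inv_eq_iff_eq_mul.mpr h5, ih, dyad_inv, mul_assoc, dyad_mul]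
      congr 2
      · have : S (k + 1 + 1) = S (k + 1) + ((d (k + 1) : ℕ) : ℤ) * 2 ^ (k + 1) :=
          Finset.sum_range_succ _ _
        rw [this]
        push_cast
        rw [pow_succ, zpow_natCast, zpow_neg, zpow_one]
        field_simp
        ring
  refine ⟨S (k + 1), Finset.sum_nonneg fun i _ => by positivity, hlt _, ?_, ?_⟩
  · rw [two_pow_dvd_iff_norm]
    have h5 := (h4.tendsto_sum_nat.sub_const ((S (k + 1) : ℤ) : ℤ_[2])).norm
    refine le_of_tendsto h5 ?_
    filter_upwards [eventually_ge_atTop (k + 1)] with n hn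
    rw [← two_pow_dvd_iff_norm]
    have h6 : (S (k + 1) : ℤ_[2]) = ∑ i ∈ Finset.range (k + 1), ((d i : ℕ) : ℤ_[2]) * 2 ^ i := by
      simp [hS]
    rw [h6, ← Finset.sum_range_add_sum_Ico _ hn, add_sub_cancel_left]
    refine Finset.dvd_sum fun i hi => ?_
    exact dvd_mul_of_dvd_right (pow_dvd_pow _ (Finset.mem_Ico.mp hi).1) _
  · rw [← hp]
    exact h1 k

theorem hasIndex_of_mem_pos {T : Tiling} {g : G} {a : ℤ_[2]}
    (H : ∀ (k : ℕ) (m : ℤ), (2 : ℤ_[2]) ^ (k + 1) ∣ a - m → g * dyad k (-m) ∈ pos T) :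
    T.HasIndex g a := by
  -- The partial sums of the digits are the truncations of `a`.
  obtain ⟨S, hS0, hSd, hSm, hSl, hSa⟩ : ∃ S : ℕ → ℕ, S 0 = 0 ∧
      (∀ k, 2 ^ k ∣ S (k + 1) - S k) ∧ (∀ k, S k ≤ S (k + 1)) ∧ (∀ k, S k < 2 ^ k) ∧
      ∀ k, (2 : ℤ_[2]) ^ k ∣ a - (S k : ℤ) :=
    ⟨a.appr, rfl, fun k => PadicInt.dvd_appr_sub_appr a k (k + 1) (Nat.le_succ k),
      fun k => PadicInt.appr_mono a (Nat.le_succ k), PadicInt.appr_lt a, appr_dvd a⟩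
  have hdig : ∀ k, ∃ d : Fin 2, S (k + 1) = S k + (d : ℕ) * 2 ^ k := by
    intro k
    obtain ⟨c, hc⟩ := hSd k
    have hmono := hSm k
    have hlt := hSl (k + 1)
    have hle : S k ≤ S (k + 1) := hmono
    have he : S (k + 1) = S k + c * 2 ^ k := by rw [mul_comm, ← hc]; omega
    have hc2 : c < 2 := by
      by_contra hge
      push Not at hge
      rw [pow_succ] at hlt
      have : 2 * 2 ^ k ≤ c * 2 ^ k := Nat.mul_le_mul_right _ hge
      omega
    exact ⟨⟨c, hc2⟩, he⟩
  choose d hd using hdig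
  refine ⟨d, fun k => g * dyad k (-(S (k + 1) : ℤ)), fun k => H k _ (hSa _), ?_, ?_, ?_⟩
  · rw [affineMotion_one_eq, mul_assoc, dyad_mul, hd 0, hS0]
    have : dyad (((0 : ℕ) : ℤ) + 0) (2 ^ ((0 : ℕ) : ℤ) * ((d 0 : ℕ) : ℝ) +
        -(((0 + (d 0 : ℕ) * 2 ^ 0 : ℕ) : ℤ) : ℝ)) = 1 := by
      rw [← dyad_zero_zero]
      congr 1
      simp
    rw [this, mul_one]
  · intro k
    rw [affineMotion_half_eq, mul_assoc, dyad_mul, hd (k + 1)]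
    refine congrArg (g * ·) (dyad_congr ?_ ?_)
    · push_cast; ring
    · push_cast
      have : (2 : ℝ) ^ ((k : ℤ) + 1) = 2 ^ (k + 1) := by exact_mod_cast rfl
      rw [this]
      ring
  · have hsum : ∀ n, ∑ i ∈ Finset.range n, ((d i : ℕ) : ℤ_[2]) * 2 ^ i = (S n : ℤ_[2]) := by
      intro n
      induction n with
      | zero => simp [hS0]
      | succ n ih => rw [Finset.sum_range_succ, ih, hd n]; push_cast; ring
    have hs : Summable (fun k => ((d k : ℕ) : ℤ_[2]) * 2 ^ k) := by
      refine Summable.of_norm_bounded (g := fun k : ℕ => ((1 : ℝ) / 2) ^ k)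
        (summable_geometric_of_lt_one (by norm_num) (by norm_num)) fun k => ?_
      have : (2 : ℤ_[2]) ^ k ∣ ((d k : ℕ) : ℤ_[2]) * 2 ^ k := dvd_mul_left _ _
      rw [two_pow_dvd_iff_norm, zpow_neg, zpow_natCast, ← inv_pow, ← one_div] at this
      exact this
    have ht : Tendsto (fun n => (S n : ℤ_[2])) atTop (𝓝 a) := by
      rw [tendsto_iff_norm_sub_tendsto_zero]
      refine squeeze_zero (fun _ => norm_nonneg _) (fun n => ?_)
        (tendsto_pow_atTop_nhds_zero_of_lt_one (r := (1 : ℝ) / 2) (by norm_num) (by norm_num))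
      have := hSa n
      rw [two_pow_dvd_iff_norm, zpow_neg, zpow_natCast, ← inv_pow, ← one_div] at this
      rw [norm_sub_rev]
      exact_mod_cast this
    have h5 := hs.hasSum.tendsto_sum_nat
    simp only [hsum] at h5
    rw [← tendsto_nhds_unique h5 ht]
    exact hs.hasSum

theorem Tiling.HasIndex.unique {T : Tiling} {g : G} {a b : ℤ_[2]} (ha : T.HasIndex g a)
    (hb : T.HasIndex g b) : a = b := by
  refine sub_eq_zero.mp (eq_zero_of_forall_dvd fun k => ?_)
  obtain ⟨m, m1, m2, m3, m4⟩ := Tiling.HasIndex.exists_mem_pos ha k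
  obtain ⟨n, n1, n2, n3, n4⟩ := Tiling.HasIndex.exists_mem_pos hb k
  have h1 := dvd_of_mem_pos m4 n4 (abs_le.mpr ⟨by omega, by omega⟩)
  rw [← two_pow_dvd_int_iff] at h1
  convert dvd_sub (dvd_add m3 h1) n3 using 1
  push_cast; ring

theorem Tiling.HasIndex.translate {T : Tiling} {g : G} {a b : ℤ_[2]} (ha : T.HasIndex g a)
    (hb : T.HasIndex (g * dyad 0 1) b) : b = a + 1 := by
  refine sub_eq_zero.mp (eq_zero_of_forall_dvd fun k => ?_)
  obtain ⟨m, m1, m2, m3, m4⟩ := Tiling.HasIndex.exists_mem_pos ha k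
  obtain ⟨n, n1, n2, n3, n4⟩ := Tiling.HasIndex.exists_mem_pos hb k
  have n5 : g * dyad k (-(n - 1 : ℤ)) ∈ pos T := by
    rw [mul_assoc, dyad_mul] at n4
    convert n4 using 3
    · simp
    · push_cast; simp; ring
  have h1 := dvd_of_mem_pos m4 n5 (abs_le.mpr ⟨by omega, by omega⟩)
  rw [← two_pow_dvd_int_iff] at h1
  convert dvd_sub n3 (dvd_add m3 h1) using 1
  push_cast; ring

/-! ### Equivalence of fixed-sum tilings and labellings -/

theorem horoball_packing_labelTiling {f : SL(2, ℤ) → ℤ_[2]} (hf : IsLabel f) :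
    (labelTiling f hf).HasHoroballPacking 1 := by
  have hpos : {h : G | h • tile ∈ (labelTiling f hf).tiles} = labelPos f := pos_labelTiling hf
  rw [Tiling.HasHoroballPacking, hpos]
  ext z
  simp only [Set.mem_iUnion, exists_prop, one_mul]
  constructor
  · rintro ⟨p, ⟨γ, k, m, h, rfl⟩, v, hv, rfl⟩
    refine ⟨γ, dyad k (-m) • v, ?_, ?_⟩
    · show 1 ≤ (dyad k (-m) • v).im
      rw [dyad_im, zpow_natCast]
      have : (1 : ℝ) ≤ 2 ^ k := one_le_pow₀ (by norm_num)
      nlinarith [hv.2.2.1]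
    · simp only [mul_smul]
  · rintro ⟨γ, z', hz', rfl⟩
    have hy : 1 ≤ z'.im := hz'
    obtain ⟨k, hk1, hk2⟩ := exists_nat_pow_near hy (one_lt_two : (1 : ℝ) < 2)
    obtain ⟨m₀, hm₀⟩ : ∃ m₀ : ℤ, m₀ = ((f γ).appr (k + 1) : ℕ) := ⟨_, rfl⟩
    obtain ⟨l, v, hv, hzv⟩ := exists_dyad_core (k : ℤ) m₀ (z := z') (by exact_mod_cast hk1)
      (by exact_mod_cast hk2.le)
    refine ⟨_, ⟨γ, k, m₀ - 2 ^ (k + 1) * l, ?_, rfl⟩, v, hv, ?_⟩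
    · have h1 := appr_dvd (f γ) (k + 1)
      rw [← hm₀] at h1
      have h2 : (2 : ℤ_[2]) ^ (k + 1) ∣ 2 ^ (k + 1) * l := dvd_mul_right _ _
      convert dvd_add h1 h2 using 1
      push_cast; ring
    · simp only [mul_smul]
      rw [hzv]
      congr 3
      have : (2 : ℝ) ^ ((k : ℤ) + 1) = 2 ^ (k + 1) := by exact_mod_cast rfl
      rw [this]; push_cast; ring

theorem hasIndex_labelTiling {f : SL(2, ℤ) → ℤ_[2]} (hf : IsLabel f) (γ : SL(2, ℤ)) :
    (labelTiling f hf).HasIndex (modular γ) (f γ) := by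
  refine hasIndex_of_mem_pos fun k m h => ?_
  rw [pos_labelTiling]
  exact ⟨γ, k, m, h, rfl⟩

theorem isFixedSum_smul_labelTiling {w : ℤ_[2]} {f : SL(2, ℤ) → ℤ_[2]} (hf : IsFixedSumLabel w f)
    (g : G) : (g • labelTiling f hf.toIsLabel).IsFixedSum w := by
  refine Tiling.IsFixedSum.smul ⟨1, horoball_packing_labelTiling _, fun γ => ?_⟩ g
  refine ⟨_, _, _, ?_, ?_, ?_, hf.sum γ⟩ <;> rw [one_mul] <;> exact hasIndex_labelTiling _ _

/-- The fixed-sum tilings are the ones given by labels with that sum. -/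
theorem isFixedSum_iff {w : ℤ_[2]} {T : Tiling} : T.IsFixedSum w ↔
    ∃ (g : G) (f : SL(2, ℤ) → ℤ_[2]) (hf : IsFixedSumLabel w f), T = g • labelTiling f hf.toIsLabel := by
  constructor
  · rintro ⟨g, -, H⟩
    choose f b c h1 h2 h3 h4 using H
    have hb : ∀ γ, b γ = f (γ * rotation) := fun γ => (h2 γ).unique (h1 _)
    have hc : ∀ γ, c γ = f (γ * rotation ^ 2) := fun γ => (h3 γ).unique (h1 _)
    have hf : IsFixedSumLabel w f :=
      { neg := fun γ => by
          have := h1 (-γ)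
          rw [modular_neg] at this
          exact this.unique (h1 γ)
        mul_T := fun γ => by
          have := h1 (γ * ModularGroup.T)
          have hT := modular_T_zpow 1
          rw [zpow_one] at hT
          rw [map_mul, hT, ← mul_assoc] at this
          exact (h1 γ).translate (by simpa using this)
        sum := fun γ => by rw [← hb, ← hc]; exact h4 γ }
    refine ⟨g, f, hf, (tiling_eq_of_subset fun p hp => ?_).symm⟩
    rw [mem_pos_smul, pos_labelTiling] at hp
    obtain ⟨γ, k, m, h, he⟩ := hp
    have hm := appr_dvd (f (γ * ModularGroup.T ^ (-m))) (k + 1)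
    -- Seen from the triangle translated by `-m`, the label is divisible by `2 ^ (k + 1)`, so its
    -- representative in the range from `0` to `2 ^ (k + 1)` is `0` and the tile is the required
    -- one.
    obtain ⟨n, n1, n2, n3, n4⟩ := Tiling.HasIndex.exists_mem_pos (h1 (γ * ModularGroup.T ^ (-m))) k
    rw [hf.mul_T_zpow] at n3
    have hn : (2 : ℤ_[2]) ^ (k + 1) ∣ (n : ℤ_[2]) := by
      convert dvd_sub h n3 using 1
      push_cast; ring
    rw [two_pow_dvd_int_iff] at hn
    have hn0 : n = 0 := Int.eq_zero_of_dvd_of_nonneg_of_lt n1 n2 hn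
    rw [hn0, map_mul, modular_T_zpow, mul_assoc, mul_assoc, dyad_mul] at n4
    have : p = g * (modular γ * dyad k (-m)) := by rw [← he, mul_inv_cancel_left]
    rw [this]
    convert n4 using 4
    · simp
    · simp
  · rintro ⟨g, f, hf, rfl⟩
    exact isFixedSum_smul_labelTiling hf g

/-- The labels of a non-degenerate tiling are determined up to the choice of the base triangle. -/
theorem smul_labelTiling_inj {f f' : SL(2, ℤ) → ℤ_[2]} (hf : IsLabel f) (hf' : IsLabel f') {g g' : G}
    (h : g • labelTiling f hf = g' • labelTiling f' hf') :
    ∃ γ : SL(2, ℤ), g = g' * modular γ ∧ ∀ δ, f δ = f' (γ * δ) := by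
  have hpos : ∀ p, g⁻¹ * p ∈ labelPos f ↔ g'⁻¹ * p ∈ labelPos f' := by
    intro p
    rw [← pos_labelTiling hf, ← pos_labelTiling hf', ← mem_pos_smul, ← mem_pos_smul, h]
  obtain ⟨m, hm⟩ : ∃ m : ℤ, m = ((f 1).appr 1 : ℕ) := ⟨_, rfl⟩
  have h1 : dyad 0 (-m) ∈ labelPos f := by
    refine ⟨1, 0, m, by rw [hm]; exact appr_dvd (f 1) 1, by simp⟩
  have h2 : g'⁻¹ * (g * dyad 0 (-m)) ∈ labelPos f' := by
    rw [← hpos, inv_mul_cancel_left]; exact h1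
  obtain ⟨γ', k', m', hd, he⟩ := h2
  -- A tile at a higher level would have children inside its horoball. Pulled back, this would give
  -- a tile at level `-1` among the tiles of `f`, whose levels are nonnegative.
  have hk : k' = 0 := by
    by_contra hk0
    obtain ⟨k, rfl⟩ := Nat.exists_eq_succ_of_ne_zero hk0
    have h3 : g'⁻¹ * (g * dyad (-1) (-m)) ∈ labelPos f' := by
      refine ⟨γ', k, m', (pow_dvd_pow _ (by omega)).trans hd, ?_⟩
      have : dyad (-1) (-m) = dyad 0 (-m) * dyad (-1) 0 := by rw [dyad_mul]; simp
      rw [this, ← mul_assoc g, ← mul_assoc, he, mul_assoc, dyad_mul]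
      congr 2
      · push_cast; ring
      · simp
    rw [← hpos, inv_mul_cancel_left] at h3
    obtain ⟨δ, j, n, -, he'⟩ := h3
    have h4 : modular 1 * dyad (-1) (-m) = modular δ * dyad j (-n) := by
      rw [map_one, one_mul, he']
    have := (modular_mul_dyad_inj h4).1
    omega
  subst hk
  have hγ : g = g' * modular (γ' * ModularGroup.T ^ (m - m')) := by
    rw [map_mul, modular_T_zpow]
    have h5 : g * dyad 0 (-m) = g' * (modular γ' * dyad 0 (-m')) := by
      have he0 : g'⁻¹ * (g * dyad 0 (-m)) = modular γ' * dyad 0 (-m') := by simpa using he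
      rw [← he0, mul_inv_cancel_left]
    have h6 : dyad 0 ((m - m' : ℤ) : ℝ) = dyad 0 (-m') * (dyad 0 (-m))⁻¹ := by
      rw [dyad_inv, dyad_mul]
      congr 1
      push_cast; simp; ring
    rw [h6, ← mul_assoc (modular γ'), ← mul_assoc, ← h5, mul_inv_cancel_right]
  set γ := γ' * ModularGroup.T ^ (m - m') with hγdef
  refine ⟨γ, hγ, fun δ => sub_eq_zero.mp (eq_zero_of_forall_dvd fun k => ?_)⟩
  have h7 := (hpos (g * (modular δ * dyad k (-((f δ).appr (k + 1) : ℕ) : ℤ)))).mp (by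
    rw [inv_mul_cancel_left]
    have := (mem_labelPos_iff hf (γ := δ)).mpr (appr_dvd (f δ) (k + 1))
    exact_mod_cast this)
  rw [hγ, mul_assoc, inv_mul_cancel_left, ← mul_assoc, ← map_mul] at h7
  have h8 := (mem_labelPos_iff hf' (γ := γ * δ) (k := k) (m := ((f δ).appr (k + 1) : ℕ))).mp
    (by exact_mod_cast h7)
  convert dvd_sub (appr_dvd (f δ) (k + 1)) h8 using 1
  ring

/-! ### The modular group as a free product, and the existence of labels -/

/-- The homomorphism from a cyclic group sending the generator to `y`. -/
def cyclicHom {K : Type*} [Group K] (n : ℕ) (y : K) (hy : y ^ n = 1) : Multiplicative (ZMod n) →* K :=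
  AddMonoidHom.toMultiplicativeLeft (ZMod.lift n ⟨zmultiplesHom (Additive K) (Additive.ofMul y), by
    simp only [zmultiplesHom_apply, natCast_zsmul, ← ofMul_pow, hy, ofMul_one]⟩)

theorem cyclicHom_ofAdd {K : Type*} [Group K] (n : ℕ) (y : K) (hy : y ^ n = 1) (k : ℤ) :
    cyclicHom n y hy (Multiplicative.ofAdd (k : ZMod n)) = y ^ k := by
  show Additive.toMul (ZMod.lift n _ (k : ZMod n)) = y ^ k
  rw [ZMod.lift_coe]
  rfl

theorem S_mul_rotation : ModularGroup.S * rotation = ModularGroup.T⁻¹ := by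
  ext i j
  rw [ModularGroup.coe_T_inv]
  fin_cases i <;> fin_cases j <;> simp only [Matrix.SpecialLinearGroup.coe_mul] <;>
    simp [ModularGroup.S, rotation]

theorem modular_S_sq : modular ModularGroup.S ^ 2 = 1 := by
  rw [← map_pow, pow_two, ← modular_neg]
  have : -(ModularGroup.S * ModularGroup.S) = 1 := by
    ext i j
    fin_cases i <;> fin_cases j <;>
      simp only [Matrix.SpecialLinearGroup.coe_neg, Matrix.SpecialLinearGroup.coe_mul] <;>
      simp [ModularGroup.S]
  rw [this, map_one]

theorem rotation_cube : rotation ^ 3 = -1 := by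
  ext i j
  rw [pow_succ, pow_two]
  fin_cases i <;> fin_cases j <;> simp only [Matrix.SpecialLinearGroup.coe_mul] <;> simp [rotation]

theorem modular_rotation_cube : modular rotation ^ 3 = 1 := by
  rw [← map_pow, rotation_cube, modular_neg, map_one]

/-- The cyclic factors of the modular group. -/
abbrev Factor (b : Bool) : Type := Multiplicative (ZMod (cond b 3 2))

/-- The homomorphisms from the cyclic factors given by an element of order two and one of order
three. -/
def factorHom {K : Type*} [Group K] (s r : K) (hs : s ^ 2 = 1) (hr : r ^ 3 = 1) :
    (b : Bool) → Factor b →* K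
  | false => cyclicHom 2 s hs
  | true => cyclicHom 3 r hr

/-- The modular group as an image of a free product. -/
def fromFree : Monoid.CoprodI Factor →* G :=
  Monoid.CoprodI.lift (factorHom (modular ModularGroup.S) (modular rotation) modular_S_sq
    modular_rotation_cube)

theorem re_modular_smul (γ : SL(2, ℤ)) (z : ℍ) : ∃ N : ℝ, 0 < N ∧ (modular γ • z).re =
    (((γ 0 0 : ℝ) * z.re + γ 0 1) * ((γ 1 0 : ℝ) * z.re + γ 1 1) +
      (γ 0 0 : ℝ) * γ 1 0 * z.im ^ 2) / N := by
  refine ⟨_, denom_pos (Matrix.SpecialLinearGroup.map (Int.castRingHom ℝ) γ) z, ?_⟩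
  rw [modular_apply, re_toG_smul]
  simp

/-- Ping-pong with the right and left half of the upper half plane: the involution takes the right
half to the left one, and the rotation and its square take the left half to the right one. -/
theorem fromFree_injective : Function.Injective fromFree := by
  have hS : ∀ z : ℍ, 0 < z.re → (modular ModularGroup.S • z).re < 0 := by
    intro z hz
    obtain ⟨N, hN, h⟩ := re_modular_smul ModularGroup.S z
    rw [h]
    refine div_neg_of_neg_of_pos ?_ hN
    simp [ModularGroup.S]
    exact hz
  have hr : ∀ z : ℍ, z.re < 0 → 0 < (modular rotation • z).re := by
    intro z hz
    obtain ⟨N, hN, h⟩ := re_modular_smul rotation z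
    rw [h]
    refine div_pos ?_ hN
    simp [rotation]
    linarith
  have hr2 : ∀ z : ℍ, z.re < 0 → 0 < (modular (rotation ^ 2) • z).re := by
    intro z hz
    obtain ⟨N, hN, h⟩ := re_modular_smul (rotation ^ 2) z
    rw [h]
    refine div_pos ?_ hN
    rw [pow_two, Matrix.SpecialLinearGroup.coe_mul]
    simp [rotation]
    nlinarith [sq_nonneg z.im]
  refine Monoid.CoprodI.lift_injective_of_ping_pong _ ?_
    (fun b : Bool => bif b then {z : ℍ | 0 < z.re} else {z : ℍ | z.re < 0}) ?_ ?_ ?_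
  · right
    refine ⟨true, ?_⟩
    have : Cardinal.mk (Factor true) = 3 := by
      show Cardinal.mk (Fin 3) = 3
      simp
    rw [this]
  · rintro (_ | _)
    · exact ⟨pt (-1) 1 one_pos, show (-1 : ℝ) < 0 by norm_num⟩
    · exact ⟨pt 1 1 one_pos, show (0 : ℝ) < 1 by norm_num⟩
  · intro i j hij
    rw [Function.onFun, Set.disjoint_left]
    rcases i <;> rcases j <;> first | exact absurd rfl hij | skip
    · intro z (h : z.re < 0) (h' : 0 < z.re); linarith
    · intro z (h : 0 < z.re) (h' : z.re < 0); linarith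
  · intro i j hij h hh
    rcases i <;> rcases j <;> first | exact absurd rfl hij | skip
    · have : h = Multiplicative.ofAdd ((1 : ℤ) : ZMod 2) := by
        exact (by decide : ∀ x : Multiplicative (ZMod 2), x ≠ 1 → x = Multiplicative.ofAdd ((1 : ℤ) : ZMod 2)) h hh
      subst this
      rintro _ ⟨z, hz, rfl⟩
      have e : factorHom (modular ModularGroup.S) (modular rotation) modular_S_sq
          modular_rotation_cube false (Multiplicative.ofAdd ((1 : ℤ) : ZMod 2)) =
          modular ModularGroup.S := (cyclicHom_ofAdd 2 _ modular_S_sq 1).trans (zpow_one _)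
      simp only [e]
      exact hS z hz
    · have : h = Multiplicative.ofAdd ((1 : ℤ) : ZMod 3) ∨
          h = Multiplicative.ofAdd ((2 : ℤ) : ZMod 3) := by
        exact (by decide : ∀ x : Multiplicative (ZMod 3), x ≠ 1 →
          x = Multiplicative.ofAdd ((1 : ℤ) : ZMod 3) ∨
            x = Multiplicative.ofAdd ((2 : ℤ) : ZMod 3)) h hh
      rcases this with rfl | rfl
      · rintro _ ⟨z, hz, rfl⟩
        have e : factorHom (modular ModularGroup.S) (modular rotation) modular_S_sq
            modular_rotation_cube true (Multiplicative.ofAdd ((1 : ℤ) : ZMod 3)) =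
            modular rotation := (cyclicHom_ofAdd 3 _ modular_rotation_cube 1).trans (zpow_one _)
        simp only [e]
        exact hr z hz
      · rintro _ ⟨z, hz, rfl⟩
        have e : factorHom (modular ModularGroup.S) (modular rotation) modular_S_sq
            modular_rotation_cube true (Multiplicative.ofAdd ((2 : ℤ) : ZMod 3)) =
            modular (rotation ^ 2) := (cyclicHom_ofAdd 3 _ modular_rotation_cube 2).trans
              (by rw [map_pow]; rfl)
        simp only [e]
        exact hr2 z hz

theorem fromFree_S : fromFree (Monoid.CoprodI.of (i := false)
    (Multiplicative.ofAdd ((1 : ℤ) : ZMod 2))) = modular ModularGroup.S := by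
  rw [fromFree, Monoid.CoprodI.lift_of]
  exact (cyclicHom_ofAdd 2 _ modular_S_sq 1).trans (zpow_one _)

theorem fromFree_rotation : fromFree (Monoid.CoprodI.of (i := true)
    (Multiplicative.ofAdd ((1 : ℤ) : ZMod 3))) = modular rotation := by
  rw [fromFree, Monoid.CoprodI.lift_of]
  exact (cyclicHom_ofAdd 3 _ modular_rotation_cube 1).trans (zpow_one _)

/-- The translation is the inverse of the involution times the rotation, so the two torsion elements
generate the modular group. -/
theorem modular_mem_range (γ : SL(2, ℤ)) : modular γ ∈ fromFree.range := by
  have hγ : γ ∈ Subgroup.closure {ModularGroup.S, ModularGroup.T} := by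
    rw [SpecialLinearGroup.SL2Z_generators]; trivial
  have hS : modular ModularGroup.S ∈ fromFree.range := ⟨_, fromFree_S⟩
  induction hγ using Subgroup.closure_induction with
  | mem x hx =>
    rcases hx with rfl | rfl
    · exact hS
    · have : ModularGroup.T = (ModularGroup.S * rotation)⁻¹ := by rw [S_mul_rotation, inv_inv]
      rw [this, map_inv, map_mul]
      exact inv_mem (mul_mem hS ⟨_, fromFree_rotation⟩)
  | one => rw [map_one]; exact one_mem _
  | mul x y _ _ hx hy => rw [map_mul]; exact mul_mem hx hy
  | inv x _ hx => rw [map_inv]; exact inv_mem hx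

/-- The modular group is the free product of cyclic groups of orders two and three. -/
theorem exists_modular_hom {K : Type*} [Group K] (s r : K) (hs : s ^ 2 = 1) (hr : r ^ 3 = 1) :
    ∃ F : SL(2, ℤ) →* K, F ModularGroup.S = s ∧ F rotation = r ∧ ∀ γ, F (-γ) = F γ := by
  let e := MonoidHom.ofInjective fromFree_injective
  let c : SL(2, ℤ) →* fromFree.range := modular.codRestrict fromFree.range modular_mem_range
  let E : SL(2, ℤ) →* Monoid.CoprodI Factor := e.symm.toMonoidHom.comp c
  have hE : ∀ {γ : SL(2, ℤ)} {x}, fromFree x = modular γ → E γ = x := by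
    intro γ x h
    show e.symm (c γ) = x
    rw [MulEquiv.symm_apply_eq]
    exact Subtype.ext h.symm
  refine ⟨(Monoid.CoprodI.lift (factorHom s r hs hr)).comp E, ?_, ?_, ?_⟩
  · rw [MonoidHom.comp_apply, hE fromFree_S, Monoid.CoprodI.lift_of]
    exact (cyclicHom_ofAdd 2 _ hs 1).trans (zpow_one _)
  · rw [MonoidHom.comp_apply, hE fromFree_rotation, Monoid.CoprodI.lift_of]
    exact (cyclicHom_ofAdd 3 _ hr 1).trans (zpow_one _)
  · intro γ
    have : c (-γ) = c γ := Subtype.ext (modular_neg γ)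
    show _ = (Monoid.CoprodI.lift (factorHom s r hs hr)) (e.symm (c γ))
    rw [← this]
    rfl

/-- How the labels at a triangle change under the half turn about a point of tangency. -/
def flipPerm : Equiv.Perm (ℤ_[2] × ℤ_[2]) where
  toFun x := (x.2 + 1, x.1 - 1)
  invFun x := (x.2 + 1, x.1 - 1)
  left_inv x := by ext <;> simp
  right_inv x := by ext <;> simp

/-- How the labels at a triangle change under the inverse rotation of the triangle. -/
def turnPerm (w : ℤ_[2]) : Equiv.Perm (ℤ_[2] × ℤ_[2]) where
  toFun x := (w - x.1 - x.2, x.1)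
  invFun x := (x.2, w - x.1 - x.2)
  left_inv x := by
    ext
    · simp
    · simp; ring
  right_inv x := by ext <;> simp

/-- There is a labelling with given sum and given labels at the base triangle. -/
theorem exists_label (w a b : ℤ_[2]) : ∃ f, IsFixedSumLabel w f ∧ f 1 = a ∧
    (b = a → w = 3 * a → ∀ γ, f (rotation * γ) = f γ) := by
  obtain ⟨F, hS, hr, hneg⟩ := exists_modular_hom flipPerm (turnPerm w)
    (by ext x <;> simp [pow_two, flipPerm])
    (by ext x <;> simp [pow_succ, turnPerm] <;> ring)
  have hrinv : F rotation⁻¹ = (turnPerm w)⁻¹ := by rw [map_inv, hr]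
  have hr1 : ∀ γ : SL(2, ℤ), F (γ * rotation)⁻¹ (a, b) = (turnPerm w).symm (F γ⁻¹ (a, b)) := by
    intro γ
    rw [mul_inv_rev, map_mul, hrinv]
    rfl
  -- The pair `F γ⁻¹ (a, b)` consists of the labels at `γ` and at `γ * rotation`; the third label at
  -- the triangle is determined by the sum. If `a = b` and `w = 3 * a`, the rotation fixes the
  -- initial pair, whence the symmetry.
  refine ⟨fun γ => (F γ⁻¹ (a, b)).1, ⟨⟨?_, ?_⟩, ?_⟩, ?_, ?_⟩
  · intro γ
    have : (-γ)⁻¹ = -γ⁻¹ := by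
      rw [inv_eq_iff_mul_eq_one, neg_mul_neg, mul_inv_cancel]
    simp only [this, hneg]
  · intro γ
    have : (γ * ModularGroup.T)⁻¹ = ModularGroup.S * rotation * γ⁻¹ := by
      rw [S_mul_rotation, mul_inv_rev]
    simp only [this, map_mul, hS, hr]
    simp [flipPerm, turnPerm]
  · intro γ
    have h2 : γ * rotation ^ 2 = γ * rotation * rotation := by rw [pow_two, mul_assoc]
    simp only [h2, hr1]
    simp [turnPerm]
  · simp
  · rintro rfl hw γ
    simp only [mul_inv_rev, map_mul, hrinv]
    have : (turnPerm w)⁻¹ (b, b) = (b, b) := by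
      show (b, w - b - b) = (b, b)
      rw [hw]
      congr 1
      ring
    rw [Equiv.Perm.mul_apply, this]

/-! ### Limits of label tilings -/

theorem mem_pos_smul_labelTiling {f : SL(2, ℤ) → ℤ_[2]} (hf : IsLabel f) (g : G) (γ : SL(2, ℤ))
    (k : ℕ) (m : ℤ) : g * modular γ * dyad k (-m) ∈ pos (g • labelTiling f hf) ↔
      2 ^ (k + 1) ∣ f γ - m := by
  rw [mul_assoc, mul_mem_pos_smul, pos_labelTiling, mem_labelPos_iff hf]

theorem exists_of_mem_pos_smul_labelTiling {f : SL(2, ℤ) → ℤ_[2]} {hf : IsLabel f} {g p : G}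
    (hp : p ∈ pos (g • labelTiling f hf)) :
    ∃ (γ : SL(2, ℤ)) (k : ℕ), p = g * modular γ * dyad k 0 ∧ 2 ^ (k + 1) ∣ f γ := by
  rw [mem_pos_smul, pos_labelTiling] at hp
  obtain ⟨γ, k, m, hd, h⟩ := hp
  refine ⟨γ * ModularGroup.T ^ (-m), k, ?_, ?_⟩
  · rw [map_mul, modular_T_zpow, mul_assoc, mul_assoc, dyad_mul, ← inv_mul_eq_iff_eq_mul, h]
    refine congrArg (modular γ * ·) (dyad_congr (by ring) ?_)
    push_cast; ring
  · rw [hf.mul_T_zpow]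
    simpa [sub_eq_add_neg] using hd

theorem eventually_dvd_sub {ι : Type*} {l : Filter ι} {x : ι → ℤ_[2]} {y : ℤ_[2]}
    (h : Tendsto x l (𝓝 y)) (k : ℕ) : ∀ᶠ n in l, 2 ^ k ∣ x n - y := by
  filter_upwards [Metric.tendsto_nhds.mp h (2 ^ (-k : ℤ)) (by positivity)] with n hn
  rw [two_pow_dvd_iff_norm, ← dist_eq_norm]
  exact hn.le

/-- The presence of a given tile depends on a label modulo a power of two only, and this residue is
eventually constant. -/
theorem tendsto_smul_labelTiling {ι : Type*} {l : Filter ι} {g : ι → G} {g' : G}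
    {f : ι → SL(2, ℤ) → ℤ_[2]} {f' : SL(2, ℤ) → ℤ_[2]} (hf : ∀ n, IsLabel (f n)) (hf' : IsLabel f')
    (hg : Conv l g g') (hff : ∀ γ, Tendsto (fun n => f n γ) l (𝓝 (f' γ))) :
    Tendsto (fun n => g n • labelTiling (f n) (hf n)) l (𝓝 (g' • labelTiling f' hf')) := by
  refine tendsto_of_conv fun p hp => ?_
  obtain ⟨γ, k, rfl, hd⟩ := exists_of_mem_pos_smul_labelTiling hp
  refine ⟨fun n => g n * modular γ * dyad k 0, ?_, (hg.mul (Conv.const _ _)).mul (Conv.const _ _)⟩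
  filter_upwards [eventually_dvd_sub (hff γ) (k + 1)] with n hn
  have := (mem_pos_smul_labelTiling (hf n) (g n) γ k 0).mpr (by simpa using dvd_add hn hd)
  simpa using this

theorem IsFixedSumLabel.of_tendsto {w : ℤ_[2]} {ι : Type*} {l : Filter ι} [l.NeBot]
    {f : ι → SL(2, ℤ) → ℤ_[2]} {f' : SL(2, ℤ) → ℤ_[2]} (hf : ∀ n, IsFixedSumLabel w (f n))
    (h : ∀ γ, Tendsto (fun n => f n γ) l (𝓝 (f' γ))) : IsFixedSumLabel w f' where
  neg γ := tendsto_nhds_unique (h (-γ)) (by simpa only [(hf _).neg] using h γ)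
  mul_T γ := tendsto_nhds_unique (h (γ * ModularGroup.T))
    (by simpa only [(hf _).mul_T] using (h γ).add_const 1)
  sum γ := tendsto_nhds_unique (((h γ).add (h (γ * rotation))).add (h (γ * rotation ^ 2)))
    (by simpa only [(hf _).sum] using tendsto_const_nhds)

/-- Either a convergent sequence of label tilings converges together with the labels, or it runs
deeper and deeper into horoballs. -/
theorem label_dichotomy {w : ℤ_[2]} {U : Ultrafilter ℕ} (hU : (U : Filter ℕ) ≤ atTop) {g : ℕ → G}
    {f : ℕ → SL(2, ℤ) → ℤ_[2]} (hf : ∀ n, IsFixedSumLabel w (f n)) {T : Tiling}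
    (hT : Tendsto (fun n => g n • labelTiling (f n) (hf n).toIsLabel) U (𝓝 T)) {p : ℕ → G} {p' : G}
    (hp : ∀ᶠ n in U, p n ∈ pos (g n • labelTiling (f n) (hf n).toIsLabel)) (hc : Conv U p p') :
    (∃ (g' : G) (f' : SL(2, ℤ) → ℤ_[2]) (hf' : IsFixedSumLabel w f'),
      T = g' • labelTiling f' hf'.toIsLabel ∧ ∀ e, Tendsto
        (fun n => g n • labelTiling (fun δ => f n δ + e) ((hf n).add_const e)) U
        (𝓝 (g' • labelTiling (fun δ => f' δ + e) (hf'.add_const e)))) ∨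
    ∃ (γ : ℕ → SL(2, ℤ)) (k : ℕ → ℕ), Tendsto k U atTop ∧
      ∀ᶠ n in U, p n = g n * modular (γ n) * dyad (k n) 0 ∧ 2 ^ (k n + 1) ∣ f n (γ n) := by
  have H : ∀ n, ∃ x : SL(2, ℤ) × ℕ, p n ∈ pos (g n • labelTiling (f n) (hf n).toIsLabel) →
      p n = g n * modular x.1 * dyad x.2 0 ∧ 2 ^ (x.2 + 1) ∣ f n x.1 := by
    intro n
    by_cases h : p n ∈ pos (g n • labelTiling (f n) (hf n).toIsLabel)
    · obtain ⟨γ, k, h1, h2⟩ := exists_of_mem_pos_smul_labelTiling h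
      exact ⟨(γ, k), fun _ => ⟨h1, h2⟩⟩
    · exact ⟨(1, 0), fun h' => absurd h' h⟩
  choose x hx using H
  -- If the level of the chosen tile is constant along the ultrafilter, use its triangle as the base
  -- triangle: the motions converge with the tile, and the labels converge by compactness. Otherwise
  -- each level is avoided eventually, so the levels tend to infinity.
  by_cases hk : ∃ k, ∀ᶠ n in U, (x n).2 = k
  · left
    obtain ⟨k, hk⟩ := hk
    have hlim : ∀ γ, ∃ y, Tendsto (fun n => f n ((x n).1 * γ)) U (𝓝 y) := fun γ =>
      ⟨_, Ultrafilter.le_nhds_lim (U.map fun n => f n ((x n).1 * γ))⟩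
    choose f' hf' using hlim
    have hfix : ∀ n, IsFixedSumLabel w (fun δ => f n ((x n).1 * δ)) := fun n => (hf n).comp_left _
    have hF : IsFixedSumLabel w f' := IsFixedSumLabel.of_tendsto hfix hf'
    have hg : Conv U (fun n => g n * modular (x n).1) (p' * (dyad k 0)⁻¹) := by
      refine (hc.mul (Conv.const _ _)).congr' ?_
      filter_upwards [hp, hk] with n h1 h2
      rw [(hx n h1).1, h2, mul_inv_cancel_right]
    have key : ∀ e, Tendsto
        (fun n => g n • labelTiling (fun δ => f n δ + e) ((hf n).add_const e)) U
        (𝓝 ((p' * (dyad k 0)⁻¹) • labelTiling (fun δ => f' δ + e) (hF.add_const e))) := by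
      intro e
      have := tendsto_smul_labelTiling (fun n => (hfix n).add_const e) (hF.add_const e) hg
        (fun γ => (hf' γ).add_const e)
      refine this.congr fun n => ?_
      rw [mul_smul]
      exact congrArg (g n • ·) (smul_labelTiling_modular ((hf n).add_const e) (x n).1)
    refine ⟨_, f', hF, tiling_tendsto_unique hU hT ?_, key⟩
    simpa using key 0
  · right
    refine ⟨fun n => (x n).1, fun n => (x n).2, ?_, hp.mono fun n hn => hx n hn⟩
    rw [tendsto_atTop]
    intro K
    have : ∀ k < K, ∀ᶠ n in U, (x n).2 ≠ k := fun k _ =>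
      (Ultrafilter.eventually_not).mpr fun h => hk ⟨k, h⟩
    have h2 := (eventually_all_finset (Finset.range K)).mpr
      fun k hk => this k (Finset.mem_range.mp hk)
    filter_upwards [h2] with n hn
    by_contra h
    exact hn _ (Finset.mem_range.mpr (not_le.mp h)) rfl

/-! ### Limits running into horoballs: horospheric tilings -/

theorem conv_dyad_level {ι : Type*} {l : Filter ι} [l.NeBot] {j : ι → ℤ} {x : ι → ℝ} {s y : ℝ}
    {hs : 0 < s} (h : Conv l (fun n => dyad (j n) (x n)) (affineMotion s y hs)) :
    ∃ i : ℤ, s = 2 ^ i ∧ (∀ᶠ n in l, j n = i) ∧ Tendsto x l (𝓝 y) := by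
  obtain ⟨h1, h2⟩ := tendsto_coe_iff.mp (h UpperHalfPlane.I)
  simp only [dyad_re, dyad_im, affineMotion_re, affineMotion_im, UpperHalfPlane.I_re,
    UpperHalfPlane.I_im, mul_zero, zero_add, mul_one] at h1 h2
  -- The ratio `5 / 3` of the bounds is less than `2`, so the interval contains at most one power of
  -- two.
  have hev : ∀ᶠ n in l, 3 / 4 * s < (2 : ℝ) ^ j n ∧ (2 : ℝ) ^ j n < 5 / 4 * s :=
    (h2.eventually (lt_mem_nhds (by linarith))).and (h2.eventually (gt_mem_nhds (by linarith)))
  obtain ⟨n₀, hn₀⟩ := hev.exists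
  have hle : ∀ a b : ℤ, 3 / 4 * s < (2 : ℝ) ^ a → (2 : ℝ) ^ b < 5 / 4 * s → b ≤ a := by
    intro a b ha hb
    by_contra hab
    have : (2 : ℝ) ^ (a + 1) ≤ 2 ^ b := zpow_le_zpow_right₀ (by norm_num) (by omega)
    rw [zpow_add_one₀ (by norm_num)] at this
    linarith
  have hj : ∀ᶠ n in l, j n = j n₀ := hev.mono fun n hn =>
    le_antisymm (hle _ _ hn₀.1 hn.2) (hle _ _ hn.1 hn₀.2)
  refine ⟨j n₀, ?_, hj, h1⟩
  refine tendsto_nhds_unique h2 (tendsto_const_nhds.congr' ?_)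
  filter_upwards [hj] with n hn
  rw [hn]

theorem exists_int_of_tendsto {ι : Type*} {l : Filter ι} [l.NeBot] {c : ℝ} (hc : c ≠ 0) {x : ι → ℝ}
    {y : ℝ} (h : Tendsto x l (𝓝 y)) (hx : ∀ᶠ n in l, ∃ r : ℤ, x n = c * r) :
    ∃ r : ℤ, y = c * r := by
  have h1 : Tendsto (fun n => x n / c) l (𝓝 (y / c)) := h.div_const c
  have h2 : y / c ∈ Set.range ((↑) : ℤ → ℝ) := by
    refine Int.isClosedEmbedding_coe_real.isClosed_range.mem_of_tendsto h1 ?_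
    filter_upwards [hx] with n ⟨r, hr⟩
    exact ⟨r, by rw [hr]; field_simp⟩
  obtain ⟨r, hr⟩ := h2
  exact ⟨r, by rw [hr]; field_simp⟩

/-- The relative positions of tiles belonging to one horoball. -/
def IsLatticeMotion (g : G) : Prop := ∃ i r : ℤ, g = dyad i (2 ^ (1 + min 0 i) * r)

theorem IsLatticeMotion.fixesInfty {g : G} (h : IsLatticeMotion g) : FixesInfty g := by
  obtain ⟨i, r, rfl⟩ := h
  exact fixesInfty_dyad _ _

theorem Conv.isLatticeMotion {ι : Type*} {l : Filter ι} [l.NeBot] {q : ι → G} {p : G}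
    (h : Conv l q p) (hq : ∀ᶠ n in l, IsLatticeMotion (q n)) : IsLatticeMotion p := by
  obtain ⟨s, y, hs, rfl⟩ := h.fixesInfty (hq.mono fun n hn => hn.fixesInfty)
  have H : ∀ n, ∃ x : ℤ × ℤ, IsLatticeMotion (q n) → q n = dyad x.1 (2 ^ (1 + min 0 x.1) * x.2) := by
    intro n
    by_cases hn : IsLatticeMotion (q n)
    · obtain ⟨i, r, h⟩ := hn
      exact ⟨(i, r), fun _ => h⟩
    · exact ⟨(0, 0), fun h => absurd h hn⟩
  choose x hx using H
  have h' : Conv l (fun n => dyad (x n).1 (2 ^ (1 + min 0 (x n).1) * (x n).2))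
      (affineMotion s y hs) := h.congr' (hq.mono fun n hn => hx n hn)
  obtain ⟨i, rfl, hi, hy⟩ := conv_dyad_level h'
  obtain ⟨r, rfl⟩ := exists_int_of_tendsto (c := 2 ^ (1 + min 0 i)) (by positivity) hy
    (hi.mono fun n hn => ⟨(x n).2, by rw [hn]⟩)
  exact ⟨i, r, rfl⟩

/-- Within distance `R` heights shrink by at most the factor `e ^ R`. So a tile near one of level
`k` with `2 ^ k ≥ e ^ R` has its centre in the same horoball and belongs to that horoball. Both
offsets are then governed by one label, which makes the relative offset a multiple of the smaller
tile width. -/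
theorem inv_mul_of_deep {f : SL(2, ℤ) → ℤ_[2]} (hf : IsLabel f) {g p q : G} {γ δ : SL(2, ℤ)}
    {k j : ℕ} (hp : p = g * modular γ * dyad k 0) (hpf : 2 ^ (k + 1) ∣ f γ)
    (hq : q = g * modular δ * dyad j 0) (hqf : 2 ^ (j + 1) ∣ f δ) {R : ℝ}
    (hR : dist (p • ctr) (q • ctr) ≤ R) (hk : Real.exp R ≤ 2 ^ k) : IsLatticeMotion (p⁻¹ * q) := by
  have hct : ctr.im = 3 / 2 := rfl
  have h1 : modular (γ⁻¹ * δ) • dyad j 0 • ctr = (g * modular γ)⁻¹ • q • ctr := by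
    rw [hq, ← mul_smul, ← mul_smul, map_mul, map_inv]
    congr 1
    group
  have h2 : (dyad k 0 : G) • ctr = (g * modular γ)⁻¹ • p • ctr := by
    rw [hp, ← mul_smul, inv_mul_cancel_left]
  have h3 : dist (dyad k 0 • ctr) (modular (γ⁻¹ * δ) • dyad j 0 • ctr) ≤ R := by
    rw [h1, h2, dist_smul]; exact hR
  have h4 : 1 < (modular (γ⁻¹ * δ) • dyad j 0 • ctr).im := by
    have h5 := UpperHalfPlane.im_div_exp_dist_le (dyad k 0 • ctr)
      (modular (γ⁻¹ * δ) • dyad j 0 • ctr)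
    refine lt_of_lt_of_le ?_ h5
    rw [dyad_im, hct, lt_div_iff₀ (Real.exp_pos _), zpow_natCast]
    have := Real.exp_le_exp.mpr h3
    have := Real.exp_pos R
    linarith
  have h5 : (γ⁻¹ * δ) 1 0 = 0 := by
    refine lower_left_eq_zero (z := dyad j 0 • ctr) (mem_upperRegion_of_im ?_)
      (mem_upperRegion_of_im h4)
    rw [dyad_im, hct, zpow_natCast]
    have : (1 : ℝ) ≤ 2 ^ j := one_le_pow₀ (by norm_num)
    linarith
  obtain ⟨i, hi, hi'⟩ := eq_of_inv_mul_lower_left h5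
  have h6 : (2 : ℤ) ^ (min j k + 1) ∣ i := by
    rw [← two_pow_dvd_int_iff]
    have e : (i : ℤ_[2]) = f δ - f γ := by rw [hf.eq_add hi']; ring
    rw [e]
    exact dvd_sub ((pow_dvd_pow 2 (by omega)).trans hqf) ((pow_dvd_pow 2 (by omega)).trans hpf)
  obtain ⟨r, hr⟩ := h6
  refine ⟨j - k, r, ?_⟩
  have h7 : p⁻¹ * q = (dyad k 0)⁻¹ * (dyad 0 i * dyad j 0) := by
    rw [hp, hq, hi]; group
  rw [h7, dyad_mul, dyad_inv, dyad_mul]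
  refine dyad_congr (by ring) ?_
  have h8 : (1 + min 0 (j - k : ℤ)) = ((min j k + 1 : ℕ) : ℤ) - k := by push_cast; omega
  rw [h8, hr, zpow_sub₀ (by norm_num), zpow_neg, zpow_natCast, zpow_natCast]
  push_cast
  ring

/-- The tilings in which all tiles belong to one horoball, which is the whole plane. -/
structure IsHorospheric (T : Tiling) : Prop where
  neighbour : ∀ p ∈ pos T, ∀ l : ℤ, p * dyad 0 (2 * l) ∈ pos T
  lattice : ∀ p ∈ pos T, ∀ q ∈ pos T, IsLatticeMotion (p⁻¹ * q)

/-- All tiles of `T` point towards the image of `∞` under `h`. -/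
def EndAt (h : G) (T : Tiling) : Prop := ∀ q ∈ pos T, FixesInfty (h⁻¹ * q)

theorem IsHorospheric.endAt {T : Tiling} (h : IsHorospheric T) {p : G} (hp : p ∈ pos T) :
    EndAt p T := fun q hq => (h.lattice p hp q hq).fixesInfty

theorem EndAt.smul {h : G} {T : Tiling} (H : EndAt h T) (g : G) : EndAt (g * h) (g • T) := by
  intro q hq
  have := H _ (mem_pos_smul.mp hq)
  rwa [mul_inv_rev, mul_assoc]

theorem EndAt.fixesInfty {h h' : G} {T : Tiling} (H : EndAt h T) (H' : EndAt h' T) :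
    FixesInfty (h⁻¹ * h') := by
  obtain ⟨p, hp⟩ := pos_nonempty T
  have := (H p hp).mul (H' p hp).inv
  rwa [mul_inv_rev, inv_inv, mul_assoc, mul_inv_cancel_left] at this

theorem EndAt.congr {h h' : G} {T : Tiling} (H : EndAt h T) (hh : FixesInfty (h⁻¹ * h')) :
    EndAt h' T := by
  intro q hq
  have := hh.inv.mul (H q hq)
  rwa [mul_inv_rev, inv_inv, mul_assoc, mul_inv_cancel_left] at this

/-- It has tiles pointing to different cusps, the images of `∞` and of `0`. -/
theorem not_endAt_labelTiling {f : SL(2, ℤ) → ℤ_[2]} (hf : IsLabel f) (g h : G) :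
    ¬ EndAt h (g • labelTiling f hf) := by
  intro H
  have key : ∀ γ : SL(2, ℤ), FixesInfty (h⁻¹ * (g * modular γ)) := by
    intro γ
    obtain ⟨m, hm⟩ : ∃ m : ℤ, (2 : ℤ_[2]) ^ (0 + 1) ∣ f γ - m := ⟨_, appr_dvd (f γ) _⟩
    have h1 := (H _ ((mem_pos_smul_labelTiling hf g γ 0 m).mpr hm)).mul
      (fixesInfty_dyad (0 : ℕ) (-m)).inv
    rwa [mul_assoc, mul_assoc, mul_inv_cancel, mul_one] at h1
  have h1 := (key 1).inv.mul (key ModularGroup.S)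
  rw [mul_inv_rev, inv_inv, map_one, mul_one, mul_assoc, mul_inv_cancel_left, inv_mul_cancel_left,
    fixesInfty_modular_iff] at h1
  simp [ModularGroup.S] at h1

theorem EndAt.not_isFixedSum {h : G} {T : Tiling} (H : EndAt h T) (w : ℤ_[2]) :
    ¬ T.IsFixedSum w := by
  rw [isFixedSum_iff]
  rintro ⟨g, f, hf, rfl⟩
  exact not_endAt_labelTiling _ _ _ H

/-- Unless the labels converge, `label_dichotomy` shows that every tile of the limit is a limit of
tiles at levels tending to infinity. Their neighbours in the horoballs converge along, and any two
of them eventually belong to a common horoball by `inv_mul_of_deep`. -/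
theorem label_limit {w : ℤ_[2]} {U : Ultrafilter ℕ} (hU : (U : Filter ℕ) ≤ atTop) {g : ℕ → G}
    {f : ℕ → SL(2, ℤ) → ℤ_[2]} (hf : ∀ n, IsFixedSumLabel w (f n)) {T : Tiling}
    (hT : Tendsto (fun n => g n • labelTiling (f n) (hf n).toIsLabel) U (𝓝 T)) :
    (∃ (g' : G) (f' : SL(2, ℤ) → ℤ_[2]) (hf' : IsFixedSumLabel w f'),
      T = g' • labelTiling f' hf'.toIsLabel ∧ ∀ e, Tendsto
        (fun n => g n • labelTiling (fun δ => f n δ + e) ((hf n).add_const e)) U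
        (𝓝 (g' • labelTiling (fun δ => f' δ + e) (hf'.add_const e)))) ∨ IsHorospheric T := by
  refine or_iff_not_imp_left.mpr fun hfix => ?_
  have deep : ∀ p ∈ pos T, ∃ (γ : ℕ → SL(2, ℤ)) (k : ℕ → ℕ), Tendsto k U atTop ∧
      Conv U (fun n => g n * modular (γ n) * dyad (k n) 0) p ∧
      ∀ᶠ n in U, 2 ^ (k n + 1) ∣ f n (γ n) := by
    intro p hp
    obtain ⟨q, hq, hc⟩ := exists_conv_of_tendsto hU hT hp
    obtain ⟨γ, k, hk, h⟩ := (label_dichotomy hU hf hT hq hc).resolve_left hfix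
    exact ⟨γ, k, hk, hc.congr' (h.mono fun n hn => hn.1), h.mono fun n hn => hn.2⟩
  constructor
  · intro p hp l
    obtain ⟨γ, k, hk, hc, hd⟩ := deep p hp
    refine mem_pos_of_tendsto hT ?_ (hc.mul (Conv.const _ _))
    filter_upwards [hd] with n hn
    have h1 := (mem_pos_smul_labelTiling (hf n).toIsLabel (g n) (γ n) (k n)
      (-(2 ^ (k n + 1) * l))).mpr (by
        push_cast
        exact dvd_sub hn (by rw [dvd_neg]; exact dvd_mul_right _ _))
    convert h1 using 1
    rw [mul_assoc _ (dyad _ _), dyad_mul]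
    refine congrArg _ (dyad_congr (by ring) ?_)
    rw [zpow_natCast]; push_cast; ring
  · intro p hp q hq
    obtain ⟨γ, k, hk, hc, hd⟩ := deep p hp
    obtain ⟨γ', k', hk', hc', hd'⟩ := deep q hq
    refine (hc.inv.mul hc').isLatticeMotion ?_
    have hdist := (hc ctr).dist (hc' ctr)
    have hpow : Tendsto (fun n => (2 : ℝ) ^ k n) U atTop :=
      (tendsto_pow_atTop_atTop_of_one_lt (by norm_num)).comp hk
    filter_upwards [hd, hd', hdist.eventually (gt_mem_nhds (lt_add_one _)),
      hpow.eventually_ge_atTop (Real.exp (dist (p • ctr) (q • ctr) + 1))] with n h1 h2 h3 h4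
    exact inv_mul_of_deep (hf n).toIsLabel rfl h1 rfl h2 h3.le h4

theorem hyperfilter_le_atTop : ((hyperfilter ℕ : Ultrafilter ℕ) : Filter ℕ) ≤ atTop := by
  rw [← Nat.cofinite_eq_atTop]
  exact hyperfilter_le_cofinite

theorem isFixedSum_or_isHorospheric {w : ℤ_[2]} {T : Tiling} (hT : T ∈ fixedSumSpace w) :
    T.IsFixedSum w ∨ IsHorospheric T := by
  obtain ⟨S, hS, hlim⟩ := mem_closure_iff_seq_limit.mp hT
  simp only [Set.mem_ofPred_eq, isFixedSum_iff] at hS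
  choose g f hf hS using hS
  obtain rfl : S = fun n => g n • labelTiling (f n) (hf n).toIsLabel := funext hS
  refine (label_limit hyperfilter_le_atTop hf (hlim.mono_left hyperfilter_le_atTop)).imp ?_ id
  rintro ⟨g', f', hf', rfl, -⟩
  exact isFixedSum_smul_labelTiling hf' g'

/-! ### Changing all labels by a constant -/

open Classical in
/-- Adds `e` to all labels of a label tiling, and fixes the other tilings. -/
def shift (e : ℤ_[2]) (T : Tiling) : Tiling :=
  if h : ∃ (g : G) (f : SL(2, ℤ) → ℤ_[2]) (hf : IsLabel f), T = g • labelTiling f hf then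
    h.choose • labelTiling (fun δ => h.choose_spec.choose δ + e)
      (h.choose_spec.choose_spec.choose.add_const e)
  else T

/-- The definition of `shift` chooses some presentation of the tiling. Another presentation differs
by a change of the base triangle, which commutes with adding a constant. -/
theorem shift_smul_labelTiling (e : ℤ_[2]) (g : G) {f : SL(2, ℤ) → ℤ_[2]} (hf : IsLabel f) :
    shift e (g • labelTiling f hf) = g • labelTiling (fun δ => f δ + e) (hf.add_const e) := by
  have h : ∃ (g' : G) (f' : SL(2, ℤ) → ℤ_[2]) (hf' : IsLabel f'),
    g • labelTiling f hf = g' • labelTiling f' hf' := ⟨g, f, hf, rfl⟩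
  rw [shift, dif_pos h]
  have hF := h.choose_spec.choose_spec.choose
  obtain ⟨γ, hg, hγ⟩ := smul_labelTiling_inj hf hF h.choose_spec.choose_spec.choose_spec
  have e1 : (fun δ => f δ + e) = fun δ => (h.choose_spec.choose (γ * δ) + e) :=
    funext fun δ => by rw [hγ]
  have e2 := smul_labelTiling_modular (hF.add_const e) γ
  rw [← e2, ← mul_smul, ← hg]
  simp only [e1]

theorem EndAt.shift_eq {h : G} {T : Tiling} (H : EndAt h T) (e : ℤ_[2]) : shift e T = T := by
  rw [shift, dif_neg]
  rintro ⟨g, f, hf, rfl⟩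
  exact not_endAt_labelTiling _ _ _ H

theorem shift_smul (e : ℤ_[2]) (g : G) (T : Tiling) : shift e (g • T) = g • shift e T := by
  by_cases h : ∃ (g : G) (f : SL(2, ℤ) → ℤ_[2]) (hf : IsLabel f), T = g • labelTiling f hf
  · obtain ⟨g', f, hf, rfl⟩ := h
    rw [← mul_smul, shift_smul_labelTiling, shift_smul_labelTiling, mul_smul]
  · rw [shift, shift, dif_neg h, dif_neg]
    rintro ⟨g', f, hf, h'⟩
    exact h ⟨g⁻¹ * g', f, hf, by rw [mul_smul, ← h', inv_smul_smul]⟩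

theorem shift_shift (e e' : ℤ_[2]) (T : Tiling) : shift e (shift e' T) = shift (e' + e) T := by
  by_cases h : ∃ (g : G) (f : SL(2, ℤ) → ℤ_[2]) (hf : IsLabel f), T = g • labelTiling f hf
  · obtain ⟨g', f, hf, rfl⟩ := h
    rw [shift_smul_labelTiling, shift_smul_labelTiling, shift_smul_labelTiling]
    simp only [add_assoc]
  · have : ∀ e, shift e T = T := fun e => by rw [shift, dif_neg h]
    rw [this, this, this]

theorem shift_zero (T : Tiling) : shift 0 T = T := by
  by_cases h : ∃ (g : G) (f : SL(2, ℤ) → ℤ_[2]) (hf : IsLabel f), T = g • labelTiling f hf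
  · obtain ⟨g', f, hf, rfl⟩ := h
    rw [shift_smul_labelTiling]
    simp only [add_zero]
  · rw [shift, dif_neg h]

theorem isFixedSum_shift {w e : ℤ_[2]} {T : Tiling} (hT : T.IsFixedSum w) :
    (shift e T).IsFixedSum (w + 3 * e) := by
  obtain ⟨g, f, hf, rfl⟩ := isFixedSum_iff.mp hT
  rw [shift_smul_labelTiling]
  exact isFixedSum_smul_labelTiling hf.add g

/-- At a fixed-sum limit the labels converge, so any constant may be added. At a horospheric limit
the constant must be a rational integer in order to act as a translation, which becomes negligible
against the size of deep tiles. -/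
theorem tendsto_shift_of_isFixedSum {w : ℤ_[2]} {U : Ultrafilter ℕ} (hU : (U : Filter ℕ) ≤ atTop)
    {S : ℕ → Tiling} (hS : ∀ n, (S n).IsFixedSum w) {T : Tiling} (hT : Tendsto S U (𝓝 T))
    {e : ℤ_[2]} (h : T.IsFixedSum w ∨ ∃ e' : ℤ, e = e') :
    Tendsto (fun n => shift e (S n)) U (𝓝 (shift e T)) := by
  simp only [isFixedSum_iff] at hS
  choose g f hf hS using hS
  obtain rfl : S = fun n => g n • labelTiling (f n) (hf n).toIsLabel := funext hS
  simp only [shift_smul_labelTiling]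
  have hmem : T ∈ fixedSumSpace w := mem_closure_of_tendsto hT
    (Eventually.of_forall fun n => isFixedSum_smul_labelTiling (hf n) (g n))
  by_cases hfix : T.IsFixedSum w
  · rcases label_limit hU hf hT with ⟨g', f', hf', rfl, h'⟩ | hH
    · rw [shift_smul_labelTiling]
      exact h' e
    · obtain ⟨p, hp⟩ := pos_nonempty T
      exact absurd hfix ((hH.endAt hp).not_isFixedSum w)
  · have hH := (isFixedSum_or_isHorospheric hmem).resolve_left hfix
    obtain ⟨p₀, hp₀⟩ := pos_nonempty T
    rw [(hH.endAt hp₀).shift_eq]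
    obtain ⟨e', rfl⟩ := h.resolve_left hfix
    refine tendsto_of_conv fun p hp => ?_
    obtain ⟨q, hq, hc⟩ := exists_conv_of_tendsto hU hT hp
    rcases label_dichotomy hU hf hT hq hc with ⟨g', f', hf', rfl, -⟩ | ⟨γ, k, hk, hd⟩
    · exact absurd (isFixedSum_smul_labelTiling hf' g') hfix
    -- Adding `e'` to the labels moves the tiles of level `k` by `-e'` in the coordinate of the
    -- horoball, which is `-e' / 2 ^ k` in the coordinate of the tile.
    refine ⟨fun n => q n * dyad 0 (-e' / 2 ^ k n), ?_, ?_⟩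
    · filter_upwards [hd] with n ⟨h1, h2⟩
      have h3 := (mem_pos_smul_labelTiling ((hf n).add_const e') (g n) (γ n) (k n) e').mpr (by
        simpa using h2)
      convert h3 using 1
      rw [h1, mul_assoc _ (dyad _ _), dyad_mul]
      refine congrArg _ (dyad_congr (by ring) ?_)
      rw [zpow_natCast]
      field_simp
      ring
    · have h0 : Tendsto (fun n => (-e' : ℝ) / 2 ^ k n) U (𝓝 0) :=
        tendsto_const_nhds.div_atTop ((tendsto_pow_atTop_atTop_of_one_lt (by norm_num)).comp hk)
      have := hc.mul (conv_dyad 0 h0)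
      rwa [dyad_zero_zero, mul_one] at this


theorem IsHorospheric.shift_eq {T : Tiling} (h : IsHorospheric T) (e : ℤ_[2]) : shift e T = T :=
  have ⟨_, hp⟩ := pos_nonempty T
  (h.endAt hp).shift_eq e

theorem EndAt.of_tendsto {U : Ultrafilter ℕ} (hU : (U : Filter ℕ) ≤ atTop) {S : ℕ → Tiling}
    {T : Tiling} (hT : Tendsto S U (𝓝 T)) {h : ℕ → G} {h' : G} (hc : Conv U h h')
    (hS : ∀ᶠ n in U, EndAt (h n) (S n)) : EndAt h' T := by
  intro q hq
  obtain ⟨r, hr, hcr⟩ := exists_conv_of_tendsto hU hT hq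
  refine (hc.inv.mul hcr).fixesInfty ?_
  filter_upwards [hr, hS] with n h1 h2 using h2 _ h1

/-- Along an ultrafilter the terms are eventually all fixed-sum or all horospheric. In the second
case the limit also has a single end, so the shift changes neither the terms nor the limit. -/
theorem tendsto_shift {w : ℤ_[2]} {S : ℕ → Tiling} (hS : ∀ n, S n ∈ fixedSumSpace w) {T : Tiling}
    (hT : Tendsto S atTop (𝓝 T)) (e : ℤ) :
    Tendsto (fun n => shift e (S n)) atTop (𝓝 (shift e T)) := by
  rw [tendsto_iff_ultrafilter]
  intro U hU
  have hT' := hT.mono_left hU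
  by_cases h : ∀ᶠ n in U, (S n).IsFixedSum w
  · obtain ⟨n₀, hn₀⟩ := h.exists
    classical
    -- Replace the exceptional terms by a fixed one, so that the lemma for sequences of fixed-sum
    -- tilings applies.
    let S' : ℕ → Tiling := fun n => if (S n).IsFixedSum w then S n else S n₀
    have hS' : ∀ n, (S' n).IsFixedSum w := by
      intro n
      by_cases hn : (S n).IsFixedSum w
      · simpa only [S', if_pos hn] using hn
      · simpa only [S', if_neg hn] using hn₀
    have he : ∀ᶠ n in U, S n = S' n := h.mono fun n hn => by simp only [S', if_pos hn]
    have := tendsto_shift_of_isFixedSum hU hS' (hT'.congr' he) (e := e) (Or.inr ⟨e, rfl⟩)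
    exact this.congr' (he.mono fun n hn => congrArg (shift e) hn.symm)
  · have h' : ∀ᶠ n in U, IsHorospheric (S n) := (Ultrafilter.eventually_not.mpr h).mono fun n hn =>
      (isFixedSum_or_isHorospheric (hS n)).resolve_left hn
    have hTd : shift e T = T := by
      obtain ⟨p, hp⟩ := pos_nonempty T
      obtain ⟨q, hq, hc⟩ := exists_conv_of_tendsto hU hT' hp
      refine (EndAt.of_tendsto hU hT' hc ?_).shift_eq e
      filter_upwards [hq, h'] with n h1 h2 using h2.endAt h1
    rw [hTd]
    exact hT'.congr' (h'.mono fun n hn => (hn.shift_eq e).symm)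

theorem shift_mem_fixedSumSpace {w : ℤ_[2]} {T : Tiling} (hT : T ∈ fixedSumSpace w) (e : ℤ) :
    shift e T ∈ fixedSumSpace (w + 3 * e) := by
  obtain ⟨S, hS, hlim⟩ := mem_closure_iff_seq_limit.mp hT
  exact mem_closure_of_tendsto (tendsto_shift (fun n => subset_closure (hS n)) hlim e)
    (Eventually.of_forall fun n => isFixedSum_shift (hS n))

theorem continuous_shift (w : ℤ_[2]) (e : ℤ) :
    Continuous (fun T : fixedSumSpace w => shift e T.1) := by
  refine SeqContinuous.continuous fun S T hT => ?_
  exact tendsto_shift (fun n => (S n).2) ((continuous_subtype_val.tendsto T).comp hT) e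

/-! ### Conjugacy for sums that differ by an integral multiple of three -/

theorem topologicallyConjugate_of_sub {w w' : ℤ_[2]} (e : ℤ) (h : w - w' = 3 * (e : ℤ_[2])) :
    TopologicallyConjugate G (fixedSumSpace w) (fixedSumSpace w') := by
  have h1 : w' = w + 3 * ((-e : ℤ) : ℤ_[2]) := by push_cast; linear_combination -h
  have h2 : w = w' + 3 * ((e : ℤ) : ℤ_[2]) := by linear_combination h
  have hm1 : ∀ T : fixedSumSpace w, shift ((-e : ℤ) : ℤ_[2]) T.1 ∈ fixedSumSpace w' := fun T => by
    rw [h1]; exact shift_mem_fixedSumSpace T.2 (-e)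
  have hm2 : ∀ T : fixedSumSpace w', shift (e : ℤ_[2]) T.1 ∈ fixedSumSpace w := fun T => by
    rw [h2]; exact shift_mem_fixedSumSpace T.2 e
  refine ⟨{ toFun := fun T => ⟨shift ((-e : ℤ) : ℤ_[2]) T.1, hm1 T⟩
            invFun := fun T => ⟨shift (e : ℤ_[2]) T.1, hm2 T⟩
            left_inv := fun T => Subtype.ext ?_
            right_inv := fun T => Subtype.ext ?_
            continuous_toFun := (continuous_shift w (-e)).subtype_mk hm1
            continuous_invFun := (continuous_shift w' e).subtype_mk hm2 },
    fun g T => Subtype.ext (shift_smul _ g T.1)⟩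
  · simp only [shift_shift]
    push_cast
    rw [neg_add_cancel, shift_zero]
  · simp only [shift_shift]
    push_cast
    rw [add_neg_cancel, shift_zero]

/-! ### The horospheric tilings form a null set -/

/-- The tilings all of whose tiles point towards one boundary point in `[a, b]`. -/
def endSet (a b : ℝ) : Set Tiling :=
  {T | ∃ ξ ∈ Set.Icc a b, EndAt (dyad 0 ξ * modular ModularGroup.S) T}

/-- The ends accumulate in the compact interval, and pointing towards a given end passes to limits.
Closedness yields the measurability needed below. -/
theorem isClosed_endSet (a b : ℝ) : IsClosed (endSet a b) := by
  refine IsSeqClosed.isClosed fun S T hS hT => ?_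
  choose ξ hξ hE using hS
  have hU := hyperfilter_le_atTop
  obtain ⟨x, hx, hlim⟩ := isCompact_Icc.ultrafilter_le_nhds ((hyperfilter ℕ).map ξ)
    (le_principal_iff.mpr (Eventually.of_forall hξ : ∀ᶠ n in hyperfilter ℕ, ξ n ∈ Set.Icc a b))
  have hlim' : Tendsto ξ (hyperfilter ℕ : Ultrafilter ℕ) (𝓝 x) := hlim
  exact ⟨x, hx, EndAt.of_tendsto hU (hT.mono_left hU)
    ((conv_dyad 0 hlim').mul (Conv.const _ _)) (Eventually.of_forall hE)⟩

theorem toG_affineMatrix_one (x : ℝ) : dyad 0 x = toG (affineMatrix 1 x one_pos) :=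
  (affineMotion_one_eq x).symm

/-- The matrix of the half turn `z ↦ -1 / z`. -/
def swapMatrix : SL(2, ℝ) := ⟨!![0, -1; 1, 0], by simp⟩

theorem modular_S_eq : modular ModularGroup.S = toG swapMatrix := by
  rw [modular_apply]
  congr 1
  ext i j
  rw [Matrix.SpecialLinearGroup.map_apply_coe]
  fin_cases i <;> fin_cases j <;> simp [ModularGroup.S, swapMatrix]

theorem fixesInfty_conj_S {s x : ℝ} (hs : 0 < s) : FixesInfty ((modular ModularGroup.S)⁻¹ *
    affineMotion s x hs * modular ModularGroup.S) ↔ x = 0 := by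
  rw [modular_S_eq, affineMotion, ← map_inv, ← map_mul, ← map_mul, fixesInfty_toG_iff]
  simp only [Matrix.SpecialLinearGroup.coe_mul, Matrix.SpecialLinearGroup.coe_inv,
    Matrix.adjugate_fin_two]
  have := (Real.sqrt_pos.mpr hs).ne'
  simp [Matrix.mul_apply, Fin.sum_univ_two, swapMatrix, affineMatrix, this]

theorem eq_of_endAt {ξ ξ' : ℝ} {T : Tiling} (h : EndAt (dyad 0 ξ * modular ModularGroup.S) T)
    (h' : EndAt (dyad 0 ξ' * modular ModularGroup.S) T) : ξ = ξ' := by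
  have h1 := h.fixesInfty h'
  rw [mul_inv_rev, mul_assoc, ← mul_assoc _ (dyad 0 ξ'), dyad_inv, dyad_mul, ← mul_assoc, dyad,
    fixesInfty_conj_S] at h1
  simp at h1
  linarith

theorem smul_mem_endSet {a b x : ℝ} {T : Tiling} (h : T ∈ endSet a b) :
    dyad 0 x • T ∈ endSet (x + a) (x + b) := by
  obtain ⟨ξ, hξ, hE⟩ := h
  refine ⟨x + ξ, ⟨by linarith [hξ.1], by linarith [hξ.2]⟩, ?_⟩
  have := hE.smul (dyad 0 x)
  rwa [← mul_assoc, dyad_mul, dyad_congr (zero_add 0) (show _ = x + ξ by simp [add_comm])] at this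

/-- The end is the image of `∞` under the position of any tile: it is `∞` or the quotient of the
entries in the first column. -/
theorem exists_endAt {T : Tiling} (h : IsHorospheric T) :
    EndAt 1 T ∨ ∃ ξ : ℝ, EndAt (dyad 0 ξ * modular ModularGroup.S) T := by
  obtain ⟨p, hp⟩ := pos_nonempty T
  have hE := h.endAt hp
  obtain ⟨M, rfl⟩ := toG_surjective p
  by_cases hc : M 1 0 = 0
  · left
    refine hE.congr ?_
    rw [mul_one]
    exact ((fixesInfty_toG_iff M).mpr hc).inv
  · right
    refine ⟨M 0 0 / M 1 0, hE.congr ?_⟩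
    rw [toG_affineMatrix_one, modular_S_eq, ← map_inv, ← map_mul, ← map_mul, fixesInfty_toG_iff]
    simp only [Matrix.SpecialLinearGroup.coe_mul, Matrix.SpecialLinearGroup.coe_inv,
    Matrix.adjugate_fin_two]
    simp [Matrix.mul_apply, Fin.sum_univ_two, swapMatrix, affineMatrix]
    field_simp
    ring

/-- The measure of the tilings with end in `[0, 1]` does not change under translations, and
infinitely many translates are disjoint, so it vanishes. Countably many images of this set contain
all horospheric tilings. -/
theorem isInvariantNull_compl (w : ℤ_[2]) :
    IsInvariantNull G {T : fixedSumSpace w | ¬ T.1.IsFixedSum w} := by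
  refine ⟨fun g T hT h => hT ?_, fun μ hμ hinv => ?_⟩
  · have := h.smul g⁻¹
    have e : g⁻¹ • ((g • T : fixedSumSpace w) : Tiling) = T.1 := inv_smul_smul g T.1
    rwa [e] at this
  have hmeas : ∀ a b, MeasurableSet {T : fixedSumSpace w | T.1 ∈ endSet a b} := fun a b =>
    ((isClosed_endSet a b).preimage continuous_subtype_val).measurableSet
  have htrans : ∀ x a b : ℝ, μ {T : fixedSumSpace w | T.1 ∈ endSet (x + a) (x + b)} =
      μ {T : fixedSumSpace w | T.1 ∈ endSet a b} := by
    intro x a b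
    rw [← MeasureTheory.measure_preimage_smul μ (dyad 0 (-x)) (s := {T | T.1 ∈ endSet a b})]
    congr 1
    ext T
    constructor
    · intro hT
      have := smul_mem_endSet (x := -x) hT
      rwa [neg_add_cancel_left, neg_add_cancel_left] at this
    · intro (hT : dyad 0 (-x) • T.1 ∈ endSet a b)
      have := smul_mem_endSet (x := x) hT
      rwa [← mul_smul, dyad_mul, dyad_congr (y := 0) (zero_add 0) (by simp), dyad_zero_zero,
        one_smul] at this
  have hzero : μ {T : fixedSumSpace w | T.1 ∈ endSet 0 1} = 0 := by
    -- Translating by even integers only keeps the closed intervals disjoint.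
    have hdisj : Pairwise (Function.onFun Disjoint fun n : ℕ =>
        {T : fixedSumSpace w | T.1 ∈ endSet ((2 * n : ℕ) + 0) ((2 * n : ℕ) + 1)}) := by
      intro i j hij
      rw [Function.onFun, Set.disjoint_left]
      rintro T ⟨ξ, hξ, h1⟩ ⟨ξ', hξ', h2⟩
      obtain rfl := eq_of_endAt h1 h2
      have a1 : ((2 * i : ℕ) : ℝ) < ((2 * j + 2 : ℕ) : ℝ) := by push_cast at *; linarith [hξ.1, hξ'.2]
      have a2 : ((2 * j : ℕ) : ℝ) < ((2 * i + 2 : ℕ) : ℝ) := by push_cast at *; linarith [hξ'.1, hξ.2]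
      rw [Nat.cast_lt] at a1 a2
      omega
    have hsum := MeasureTheory.measure_iUnion (μ := μ) hdisj (fun n => hmeas _ _)
    simp only [htrans] at hsum
    by_contra hne
    rw [ENNReal.tsum_const_eq_top_of_ne_zero hne] at hsum
    exact MeasureTheory.measure_ne_top μ _ hsum
  -- The half turn takes the end `∞` to `0`, which lies in `[0, 1]`; the finite ends are reached by
  -- integer translations.
  have hsub : {T : fixedSumSpace w | ¬ T.1.IsFixedSum w} ⊆
      (⋃ k : ℤ, {T : fixedSumSpace w | T.1 ∈ endSet (k + 0) (k + 1)}) ∪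
      (fun T : fixedSumSpace w => modular ModularGroup.S • T) ⁻¹' {T | T.1 ∈ endSet 0 1} := by
    intro T hT
    rcases exists_endAt ((isFixedSum_or_isHorospheric T.2).resolve_left hT) with h | ⟨ξ, h⟩
    · right
      refine ⟨0, ⟨le_rfl, zero_le_one⟩, ?_⟩
      have := h.smul (modular ModularGroup.S)
      rw [mul_one] at this
      rwa [dyad_zero_zero, one_mul]
    · left
      refine Set.mem_iUnion.mpr ⟨⌊ξ⌋, ξ, ⟨?_, ?_⟩, h⟩
      · rw [add_zero]; exact Int.floor_le ξ
      · exact (Int.lt_floor_add_one ξ).le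
  refine MeasureTheory.measure_mono_null hsub (MeasureTheory.measure_union_null ?_ ?_)
  · rw [MeasureTheory.measure_iUnion_null_iff]
    intro k
    rw [htrans, hzero]
  · rw [MeasureTheory.measure_preimage_smul, hzero]

/-! ### Almost conjugacy -/

theorem isUnit_three : IsUnit (3 : ℤ_[2]) := by
  rw [PadicInt.isUnit_iff]
  refine le_antisymm (PadicInt.norm_le_one _) (not_lt.mp fun h => ?_)
  have h1 := (PadicInt.norm_int_lt_one_iff_dvd (p := 2) 3).mp (by exact_mod_cast h)
  omega

/-- Adding `(w' - w) / 3` to the labels is continuous off the horospheric tilings, even where this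
dyadic number is no rational integer. -/
theorem almostConjugate (w w' : ℤ_[2]) :
    AlmostConjugate G (fixedSumSpace w) (fixedSumSpace w') := by
  obtain ⟨e, he⟩ : ∃ e : ℤ_[2], 3 * e = w' - w := by
    obtain ⟨u, hu⟩ := isUnit_three
    exact ⟨↑u⁻¹ * (w' - w), by rw [← hu, Units.mul_inv_cancel_left]⟩
  have h1 : w' = w + 3 * e := by linear_combination -he
  have h2 : w = w' + 3 * -e := by linear_combination he
  have hc : ∀ (w e : ℤ_[2]), Continuous
      (fun T : ↥({T : fixedSumSpace w | ¬ T.1.IsFixedSum w}ᶜ) => shift e T.1.1) := by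
    intro w e
    refine SeqContinuous.continuous fun S T hT => ?_
    have hT' : Tendsto (fun n => (S n).1.1) atTop (𝓝 T.1.1) :=
      ((continuous_subtype_val.comp continuous_subtype_val).tendsto T).comp hT
    rw [tendsto_iff_ultrafilter]
    intro U hU
    exact tendsto_shift_of_isFixedSum hU (fun n => not_not.mp (S n).2) (hT'.mono_left hU)
      (Or.inl (not_not.mp T.2))
  have hm1 : ∀ T : ↥({T : fixedSumSpace w | ¬ T.1.IsFixedSum w}ᶜ),
      (shift e T.1.1).IsFixedSum w' := fun T => by
    rw [h1]; exact isFixedSum_shift (not_not.mp T.2)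
  have hm2 : ∀ T : ↥({T : fixedSumSpace w' | ¬ T.1.IsFixedSum w'}ᶜ),
      (shift (-e) T.1.1).IsFixedSum w := fun T => by
    rw [h2]; exact isFixedSum_shift (not_not.mp T.2)
  refine ⟨_, _, isInvariantNull_compl w, isInvariantNull_compl w',
    { toFun := fun T => ⟨⟨shift e T.1.1, subset_closure (hm1 T)⟩, not_not.mpr (hm1 T)⟩
      invFun := fun T => ⟨⟨shift (-e) T.1.1, subset_closure (hm2 T)⟩, not_not.mpr (hm2 T)⟩
      left_inv := fun T => Subtype.ext (Subtype.ext ?_)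
      right_inv := fun T => Subtype.ext (Subtype.ext ?_)
      continuous_toFun := ((hc w e).subtype_mk fun T => subset_closure (hm1 T)).subtype_mk
        fun T => not_not.mpr (hm1 T)
      continuous_invFun := ((hc w' (-e)).subtype_mk fun T => subset_closure (hm2 T)).subtype_mk
        fun T => not_not.mpr (hm2 T) }, ?_⟩
  · simp only [shift_shift, add_neg_cancel, shift_zero]
  · simp only [shift_shift, neg_add_cancel, shift_zero]
  · intro g T T' h
    refine Subtype.ext ?_
    have h' : T'.1.1 = g • T.1.1 := congrArg Subtype.val h
    show shift e T'.1.1 = g • shift e T.1.1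
    rw [h', shift_smul]

/-! ### Horospheric tilings pointing towards infinity -/

/-- The positions of the tiles of a horospheric tiling with offset `c j` in level `j`. -/
def horoPos (c : ℤ → ℝ) : Set G := {p | ∃ j l : ℤ, p = dyad j (c j + 2 ^ (j + 1) * l)}

theorem exists_offset_sub {c : ℤ → ℝ} (hc : ∀ j, ∃ r : ℤ, c (j + 1) - c j = 2 ^ (j + 1) * r) (j : ℤ)
    (n : ℕ) : ∃ r : ℤ, c (j + n) - c j = 2 ^ (j + 1) * r := by
  induction n with
  | zero => exact ⟨0, by simp⟩
  | succ n ih =>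
    obtain ⟨r, hr⟩ := ih
    obtain ⟨r', hr'⟩ := hc (j + n)
    refine ⟨r + 2 ^ n * r', ?_⟩
    have e : j + ((n + 1 : ℕ) : ℤ) = j + n + 1 := by push_cast; ring
    have e2 : (2 : ℝ) ^ (j + n + 1) = 2 ^ (j + 1) * 2 ^ n := by
      rw [← zpow_natCast, ← zpow_add₀ (by norm_num)]; congr 1; ring
    rw [e]
    rw [e2] at hr'
    push_cast
    linear_combination hr + hr'

theorem horoPos_disjoint {c : ℤ → ℝ} (hc : ∀ j, ∃ r : ℤ, c (j + 1) - c j = 2 ^ (j + 1) * r)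
    {p q : G} (hp : p ∈ horoPos c) (hq : q ∈ horoPos c) {z : ℍ} (h1 : z ∈ p • tileO)
    (h2 : z ∈ q • tileO) : p = q := by
  obtain ⟨j, l, rfl⟩ := hp
  obtain ⟨j', l', rfl⟩ := hq
  wlog hjj : j ≤ j' generalizing j j' l l'
  · exact (this j' l' h2 j l h1 (le_of_not_ge hjj)).symm
  obtain ⟨n, rfl⟩ : ∃ n : ℕ, j' = j + n := ⟨(j' - j).toNat, by omega⟩
  obtain ⟨r, hr⟩ := exists_offset_sub hc j n
  obtain ⟨v, hv, rfl⟩ := h1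
  obtain ⟨v', hv', h⟩ := h2
  have e2 : (2 : ℝ) ^ (j + n + 1) = 2 ^ (j + 1) * 2 ^ n := by
    rw [← zpow_natCast, ← zpow_add₀ (by norm_num)]; congr 1; ring
  have e3 : (2 : ℝ) ^ (j + 1) = 2 ^ j * 2 := zpow_add_one₀ (by norm_num) _
  obtain ⟨R, hR⟩ : ∃ R : ℤ, R = r + 2 ^ n * l' - l := ⟨_, rfl⟩
  have hRr : (R : ℝ) = r + 2 ^ n * l' - l := by rw [hR]; push_cast; ring
  -- In the coordinate of the lower tile the relative offset is an even integer, so the disjointness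
  -- inside a horoball applies.
  have key : dyad (0 : ℕ) (-(0 : ℤ)) • v = dyad n (-((-(2 * R) : ℤ) : ℝ)) • v' := by
    have h' : v = (dyad j (c j + 2 ^ (j + 1) * l))⁻¹ •
        dyad (j + n) (c (j + n) + 2 ^ (j + n + 1) * l') • v' := by
      rw [eq_inv_smul_iff]; exact h.symm
    rw [← mul_smul, dyad_inv, dyad_mul] at h'
    have hb : dyad (0 : ℕ) (-(0 : ℤ)) = 1 := by simp [dyad_zero_zero]
    rw [hb, one_smul]
    refine h'.trans (congrArg (· • v') (dyad_congr (by ring) ?_))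
    rw [e2, zpow_neg]
    push_cast
    have hc' : c (j + n) = c j + 2 ^ (j + 1) * r := by linear_combination hr
    have : (2 : ℝ) ^ j ≠ 0 := by positivity
    rw [hc', hRr, e3]
    field_simp
    ring
  obtain ⟨hn, hR0⟩ := dyad_tileO_disjoint (k := 0) (k' := n) (m := 0) (m' := -(2 * R))
    (by simp) hv hv' key
  subst hn
  obtain rfl : R = 0 := by omega
  refine dyad_congr (by simp) ?_
  have : r + (2 : ℝ) ^ 0 * l' - l = 0 := by rw [← hRr]; simp
  rw [e2]
  linear_combination (-1 : ℝ) * hr - 2 ^ (j + 1) * this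

theorem horoPos_cover {c : ℤ → ℝ} (hc : ∀ j, ∃ r : ℤ, c (j + 1) - c j = 2 ^ (j + 1) * r) (z : ℍ) :
    ∃ p ∈ horoPos c, z ∈ p • tile := by
  obtain ⟨k, hk1, hk2⟩ := exists_mem_Ico_zpow (y := (2 : ℝ)) z.im_pos (by norm_num)
  obtain ⟨l, v, hv, rfl⟩ := exists_dyad_core k (-c k) hk1 hk2.le
  obtain ⟨r, hr⟩ := hc k
  rw [neg_neg] at *
  have e3 : (2 : ℝ) ^ (k + 1 + 1) = 2 ^ (k + 1) * 2 := zpow_add_one₀ (by norm_num) _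
  rcases core_cover_smul k (c k + 2 ^ (k + 1) * l) hv with h | h | ⟨h, h'⟩
  · exact ⟨_, ⟨k, l, rfl⟩, h⟩
  · refine ⟨_, ⟨k, l - 1, ?_⟩, h⟩
    refine dyad_congr rfl ?_
    push_cast; ring
  -- The parity of the offset relative to the next level decides which prong of the parent covers
  -- the point.
  · rcases Int.even_or_odd' (l - r) with ⟨t, ht | ht⟩
    · refine ⟨_, ⟨k + 1, t, dyad_congr rfl ?_⟩, h⟩
      have ht' : (l : ℝ) - r = 2 * t := by exact_mod_cast ht
      rw [e3]
      linear_combination (2 : ℝ) ^ (k + 1) * ht' - hr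
    · refine ⟨_, ⟨k + 1, t, dyad_congr rfl ?_⟩, h'⟩
      have ht' : (l : ℝ) - r = 2 * t + 1 := by exact_mod_cast ht
      rw [e3]
      linear_combination (2 : ℝ) ^ (k + 1) * ht' - hr

/-- At negative levels `toNat` is `0` and so is the truncation, so all offsets are `0` there; only
the ancestors of the standard tile depend on `a`. -/
theorem appr_offset (a : ℤ_[2]) (j : ℤ) : ∃ r : ℤ, -2 * (a.appr (j + 1).toNat : ℝ) -
    -2 * (a.appr j.toNat : ℝ) = 2 ^ (j + 1) * r := by
  rcases le_or_gt 0 j with hj | hj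
  · obtain ⟨k, rfl⟩ : ∃ k : ℕ, j = k := ⟨j.toNat, by omega⟩
    have h1 : (2 : ℤ) ^ k ∣ (a.appr k : ℤ) - (a.appr (k + 1) : ℤ) := by
      rw [← two_pow_dvd_int_iff]
      have := dvd_sub ((pow_dvd_pow 2 k.le_succ).trans (appr_dvd a (k + 1))) (appr_dvd a k)
      push_cast
      simpa using this
    obtain ⟨r, hr⟩ := h1
    have e : ((k : ℤ) + 1).toNat = k + 1 := by omega
    have hr' : (a.appr k : ℝ) - a.appr (k + 1) = 2 ^ k * r := by exact_mod_cast hr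
    refine ⟨r, ?_⟩
    rw [e, Int.toNat_natCast, zpow_add_one₀ (by norm_num), zpow_natCast]
    linear_combination 2 * hr'
  · refine ⟨0, ?_⟩
    have e : (j + 1).toNat = 0 := by omega
    have e' : j.toNat = 0 := by omega
    rw [e, e']
    simp

/-- The horospheric tiling pointing towards `∞` which contains the standard tile and whose ancestors
are given by the digits of `a`. -/
def solenoid (a : ℤ_[2]) : Tiling :=
  ofPos (horoPos fun j => -2 * (a.appr j.toNat : ℝ)) (horoPos_cover (appr_offset a))
    (fun _ hp _ hq _ h1 h2 => horoPos_disjoint (appr_offset a) hp hq h1 h2)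

theorem dyad_mem_solenoid {a : ℤ_[2]} {k : ℕ} {μ : ℤ} (h : 2 ^ k ∣ a - μ) :
    dyad k (-2 * μ) ∈ pos (solenoid a) := by
  rw [solenoid, pos_ofPos]
  have h1 : (2 : ℤ) ^ k ∣ (a.appr k : ℤ) - μ := by
    rw [← two_pow_dvd_int_iff]
    have := dvd_sub h (appr_dvd a k)
    push_cast
    simpa using this
  obtain ⟨l, hl⟩ := h1
  have hl' : (a.appr k : ℝ) - μ = 2 ^ k * l := by exact_mod_cast hl
  refine ⟨k, l, dyad_congr rfl ?_⟩
  beta_reduce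
  rw [Int.toNat_natCast, zpow_add_one₀ (by norm_num), zpow_natCast]
  linear_combination 2 * hl'

theorem dyad_neg_mem_solenoid (a : ℤ_[2]) (k : ℕ) (l : ℤ) :
    dyad (-k) (2 ^ (-k + 1 : ℤ) * l) ∈ pos (solenoid a) := by
  rw [solenoid, pos_ofPos]
  refine ⟨-k, l, dyad_congr rfl ?_⟩
  have e : (-k : ℤ).toNat = 0 := by omega
  simp [e, PadicInt.appr]

theorem mem_solenoid_cases {a : ℤ_[2]} {p : G} (hp : p ∈ pos (solenoid a)) :
    (∃ (k : ℕ) (μ : ℤ), 2 ^ k ∣ a - μ ∧ p = dyad k (-2 * μ)) ∨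
    ∃ (k : ℕ) (l : ℤ), p = dyad (-k) (2 ^ (-k + 1 : ℤ) * l) := by
  rw [solenoid, pos_ofPos] at hp
  obtain ⟨j, l, rfl⟩ := hp
  rcases le_or_gt 0 j with hj | hj
  · left
    obtain ⟨k, rfl⟩ : ∃ k : ℕ, j = k := ⟨j.toNat, by omega⟩
    refine ⟨k, (a.appr k : ℤ) - 2 ^ k * l, ?_, dyad_congr rfl ?_⟩
    · have := appr_dvd a k
      push_cast at this ⊢
      rw [← sub_add]
      exact dvd_add this (dvd_mul_right _ _)
    · beta_reduce
      rw [Int.toNat_natCast, zpow_add_one₀ (by norm_num), zpow_natCast]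
      push_cast
      ring
  · right
    obtain ⟨k, rfl⟩ : ∃ k : ℕ, j = -k := ⟨(-j).toNat, by omega⟩
    refine ⟨k, l, dyad_congr rfl ?_⟩
    have e : (-k : ℤ).toNat = 0 := by omega
    simp [e, PadicInt.appr]

theorem mem_solenoid_zero {p : G} :
    p ∈ pos (solenoid 0) ↔ ∃ j l : ℤ, p = dyad j (2 ^ (j + 1) * l) := by
  constructor
  · intro hp
    rcases mem_solenoid_cases hp with ⟨k, μ, h, rfl⟩ | ⟨k, l, rfl⟩
    · rw [zero_sub, dvd_neg, two_pow_dvd_int_iff] at h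
      obtain ⟨l, rfl⟩ := h
      refine ⟨k, -l, dyad_congr rfl ?_⟩
      rw [zpow_add_one₀ (by norm_num), zpow_natCast]
      push_cast
      ring
    · exact ⟨-k, l, rfl⟩
  · rintro ⟨j, l, rfl⟩
    rcases le_or_gt 0 j with hj | hj
    · obtain ⟨k, rfl⟩ : ∃ k : ℕ, j = k := ⟨j.toNat, by omega⟩
      have := dyad_mem_solenoid (a := 0) (k := k) (μ := -(2 ^ k * l)) (by push_cast; simp)
      convert this using 2
      rw [zpow_add_one₀ (by norm_num), zpow_natCast]
      push_cast
      ring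
    · obtain ⟨k, rfl⟩ : ∃ k : ℕ, j = -k := ⟨(-j).toNat, by omega⟩
      exact dyad_neg_mem_solenoid 0 k l

theorem one_mem_solenoid (a : ℤ_[2]) : 1 ∈ pos (solenoid a) := by
  have := dyad_mem_solenoid (a := a) (k := 0) (μ := 0) (by simp)
  simpa [dyad_zero_zero] using this

theorem dyad_smul_solenoid_zero (j : ℤ) : dyad j 0 • solenoid 0 = solenoid 0 := by
  refine (tiling_eq_of_subset fun p hp => ?_).symm
  obtain ⟨i, l, rfl⟩ := mem_solenoid_zero.mp hp
  rw [mem_pos_smul, mem_solenoid_zero]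
  refine ⟨i - j, l, ?_⟩
  rw [dyad_inv, dyad_mul]
  refine dyad_congr (by ring) ?_
  have : (2 : ℝ) ^ (i - j + 1) = 2 ^ (-j) * 2 ^ (i + 1) := by
    rw [← zpow_add₀ (by norm_num)]; congr 1; ring
  rw [this]
  ring

theorem endAt_solenoid (a : ℤ_[2]) : EndAt 1 (solenoid a) := by
  intro q hq
  rw [inv_one, one_mul]
  rcases mem_solenoid_cases hq with ⟨k, μ, h, rfl⟩ | ⟨k, l, rfl⟩ <;> exact fixesInfty_dyad _ _

/-- View the tiling from the level `n` tile with offset `-m n` at `∞`. The quotient `a n` records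
the part of the label beyond this tile, hence its further ancestors, while the descendants down to
level `0` already agree with those of the solenoid. -/
theorem tendsto_labelTiling_solenoid {U : Filter ℕ} (hU : U ≤ atTop) {f : SL(2, ℤ) → ℤ_[2]}
    (hf : IsLabel f) {m : ℕ → ℤ} {a : ℕ → ℤ_[2]} {b : ℤ_[2]}
    (h : ∀ n, f 1 - m n = 2 ^ (n + 1) * a n) (ha : Tendsto a U (𝓝 b)) :
    Tendsto (fun n : ℕ => (dyad n (-m n))⁻¹ • labelTiling f hf) U (𝓝 (solenoid b)) := by
  refine tendsto_of_conv fun p hp => ⟨fun _ => p, ?_, Conv.const _ _⟩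
  have key : ∀ (n i : ℕ) (x : ℤ) (j : ℤ) (y : ℝ), (i : ℤ) = n + j → (2 : ℝ) ^ n * y + -m n = -x →
      2 ^ (i + 1) ∣ f 1 - x → dyad j y ∈ pos ((dyad n (-m n))⁻¹ • labelTiling f hf) := by
    intro n i x j y h1 h2 h3
    rw [mem_pos_smul, inv_inv, dyad_mul, dyad_congr (y := -(x : ℝ)) h1.symm (by rw [zpow_natCast]; exact h2),
      pos_labelTiling]
    have := (mem_labelPos_iff hf).mpr h3
    rwa [map_one, one_mul] at this
  rcases mem_solenoid_cases hp with ⟨k, μ, hd, rfl⟩ | ⟨k, l, rfl⟩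
  · filter_upwards [eventually_dvd_sub ha k] with n hn
    refine key n (n + k) (m n + 2 ^ (n + 1) * μ) _ _ (by push_cast; ring) (by push_cast; ring) ?_
    have e : f 1 - ((m n + 2 ^ (n + 1) * μ : ℤ) : ℤ_[2]) = 2 ^ (n + 1) * (a n - μ) := by
      push_cast
      linear_combination h n
    rw [e, show n + k + 1 = (n + 1) + k by ring, pow_add]
    refine mul_dvd_mul_left _ ?_
    simpa using dvd_add hn hd
  · filter_upwards [hU (eventually_ge_atTop k)] with n hn
    obtain ⟨i, rfl⟩ : ∃ i, n = i + k := ⟨n - k, by omega⟩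
    refine key (i + k) i (m (i + k) - 2 ^ (i + 1) * l) _ _ (by push_cast; ring) ?_ ?_
    · rw [zpow_add_one₀ (by norm_num), zpow_neg, zpow_natCast, pow_add]
      push_cast
      field_simp
      ring
    · have e : f 1 - ((m (i + k) - 2 ^ (i + 1) * l : ℤ) : ℤ_[2]) =
          2 ^ (i + 1) * (2 ^ k * a (i + k) + l) := by
        push_cast
        linear_combination h (i + k)
      rw [e]
      exact dvd_mul_right _ _

/-- The translation by `-2 * μ n` preserves the levels up to `0` and changes the dyadic parameter
from `0` to `μ n`. -/
theorem tendsto_translate_solenoid {U : Filter ℕ} {μ : ℕ → ℤ} {b : ℤ_[2]}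
    (h : Tendsto (fun n => (μ n : ℤ_[2])) U (𝓝 b)) :
    Tendsto (fun n => dyad 0 (-2 * μ n) • solenoid 0) U (𝓝 (solenoid b)) := by
  refine tendsto_of_conv fun p hp => ⟨fun _ => p, ?_, Conv.const _ _⟩
  rcases mem_solenoid_cases hp with ⟨k, ν, hd, rfl⟩ | ⟨k, l, rfl⟩
  · filter_upwards [eventually_dvd_sub h k] with n hn
    rw [mem_pos_smul, dyad_inv, dyad_mul]
    have := dyad_mem_solenoid (a := 0) (k := k) (μ := ν - μ n) (by
      push_cast
      have := dvd_add hn hd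
      simpa using this)
    convert this using 2
    · simp
    · push_cast; simp; ring
  · refine Eventually.of_forall fun n => ?_
    rw [mem_pos_smul, dyad_inv, dyad_mul]
    have := dyad_neg_mem_solenoid 0 k (l + 2 ^ k * μ n)
    convert this using 2
    · simp
    · rw [zpow_add_one₀ (by norm_num), zpow_neg (2 : ℝ) k, zpow_natCast]
      push_cast
      field_simp
      simp

/-- Recurrence: the powers of two tend to `0` among the dyadic integers. Conjugacies must preserve
this property, which ties the real scale of the image to powers of two. -/
theorem tendsto_pow_translate :
    Tendsto (fun n : ℕ => dyad 0 (2 ^ (n + 1)) • solenoid 0) atTop (𝓝 (solenoid 0)) := by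
  have h : Tendsto (fun n : ℕ => (((-2 ^ n : ℤ)) : ℤ_[2])) atTop (𝓝 0) := by
    have h2 : ‖(2 : ℤ_[2])‖ < 1 := by
      have := (PadicInt.norm_int_lt_one_iff_dvd (p := 2) 2).mpr (by norm_num)
      exact_mod_cast this
    have := (tendsto_pow_atTop_nhds_zero_of_norm_lt_one h2).neg
    simpa using this
  refine (tendsto_translate_solenoid h).congr fun n => ?_
  congr 1
  refine dyad_congr rfl ?_
  push_cast
  ring

theorem solenoid_mem_fixedSumSpace (w : ℤ_[2]) : solenoid 0 ∈ fixedSumSpace w := by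
  obtain ⟨f, hf, h1, -⟩ := exists_label w 0 0
  refine mem_closure_of_tendsto (tendsto_labelTiling_solenoid le_rfl hf.toIsLabel
    (m := fun _ => 0) (a := fun _ => 0) (by simp [h1]) tendsto_const_nhds)
    (Eventually.of_forall fun n => isFixedSum_smul_labelTiling hf _)

/-! ### Equivariant maps fix the horospheric tilings pointing towards infinity -/

theorem entries_of_toG_eq {A B : SL(2, ℝ)} (h : toG A = toG B) :
    ∃ ε : ℝ, ε ^ 2 = 1 ∧ ∀ i j, A i j = ε * B i j := by
  have h1 : B⁻¹ * A ∈ Subgroup.center SL(2, ℝ) := QuotientGroup.eq.mp h.symm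
  obtain ⟨r, hr, hs⟩ := Matrix.SpecialLinearGroup.mem_center_iff.mp h1
  refine ⟨r, by simpa using hr, fun i j => ?_⟩
  have h2 : (A : Matrix (Fin 2) (Fin 2) ℝ) = B * (Matrix.scalar (Fin 2) r) := by
    rw [hs, ← Matrix.SpecialLinearGroup.coe_mul, mul_inv_cancel_left]
  rw [h2]
  simp [mul_comm]

theorem trace_conj (M R : SL(2, ℝ)) : (M⁻¹ * R * M) 0 0 + (M⁻¹ * R * M) 1 1 = R 0 0 + R 1 1 := by
  rw [← Matrix.trace_fin_two, ← Matrix.trace_fin_two, Matrix.SpecialLinearGroup.coe_mul,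
    Matrix.trace_mul_comm, ← Matrix.SpecialLinearGroup.coe_mul]
  exact congrArg (fun X : SL(2, ℝ) => X.1.trace) (mul_inv_cancel_left M R)

/-- Invariance under `z ↦ z / 2` would make this motion conjugate to an element of the modular
group, but its squared trace `9 / 2` is no integer. -/
theorem half_smul_labelTiling_ne {f : SL(2, ℤ) → ℤ_[2]} (hf : IsLabel f) (g : G) :
    dyad (-1) 0 • g • labelTiling f hf ≠ g • labelTiling f hf := by
  intro h
  rw [← mul_smul] at h
  obtain ⟨γ, hγ, -⟩ := smul_labelTiling_inj hf hf h
  obtain ⟨M, rfl⟩ := toG_surjective g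
  have h1 : toG (M⁻¹ * affineMatrix (2 ^ (-1 : ℤ)) 0 (by positivity) * M) =
      toG (Matrix.SpecialLinearGroup.map (Int.castRingHom ℝ) γ) := by
    rw [map_mul, map_mul, map_inv, mul_assoc, inv_mul_eq_iff_eq_mul]
    exact hγ
  obtain ⟨ε, hε, he⟩ := entries_of_toG_eq h1
  have h2 := trace_conj M (affineMatrix (2 ^ (-1 : ℤ)) 0 (by positivity))
  rw [he, he] at h2
  have h3 : (affineMatrix (2 ^ (-1 : ℤ)) 0 (by positivity) 0 0 +
      affineMatrix (2 ^ (-1 : ℤ)) 0 (by positivity) 1 1) ^ 2 = 9 / 2 := by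
    have h4 : (√((2 : ℝ) ^ (-1 : ℤ))) ^ 2 = 1 / 2 := by
      rw [Real.sq_sqrt (by positivity)]; norm_num
    have h5 : √((2 : ℝ) ^ (-1 : ℤ)) ≠ 0 := by positivity
    show (√((2 : ℝ) ^ (-1 : ℤ)) + 1 / √((2 : ℝ) ^ (-1 : ℤ))) ^ 2 = 9 / 2
    generalize √((2 : ℝ) ^ (-1 : ℤ)) = y at h4 h5 ⊢
    field_simp
    rw [h4]
    norm_num
  rw [← h2, ← mul_add, mul_pow, hε, one_mul] at h3
  have h6 : 2 * (γ 0 0 + γ 1 1) ^ 2 = (9 : ℤ) := by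
    have h7 : (2 : ℝ) * ((γ 0 0 : ℝ) + γ 1 1) ^ 2 = 9 := by
      simp at h3
      linarith
    exact_mod_cast h7
  omega

/-- A triangular conjugate would have diagonal entries with sum `1` and product `1`, which no real
numbers have: a rotation fixes no boundary point. -/
theorem not_fixesInfty_conj_rotation (g : G) : ¬ FixesInfty (g⁻¹ * (modular rotation * g)) := by
  obtain ⟨M, rfl⟩ := toG_surjective g
  intro h
  rw [modular_apply, ← map_inv, ← map_mul, ← map_mul, fixesInfty_toG_iff, ← mul_assoc] at h
  have h1 := trace_conj M (Matrix.SpecialLinearGroup.map (Int.castRingHom ℝ) rotation)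
  have h2 := det_eq (M⁻¹ * Matrix.SpecialLinearGroup.map (Int.castRingHom ℝ) rotation * M)
  rw [h] at h2
  generalize (M⁻¹ * Matrix.SpecialLinearGroup.map (Int.castRingHom ℝ) rotation * M) 0 0 = x at *
  generalize (M⁻¹ * Matrix.SpecialLinearGroup.map (Int.castRingHom ℝ) rotation * M) 1 1 = y at *
  have h3 : x + y = 1 := by
    rw [h1, Matrix.SpecialLinearGroup.map_apply_coe]
    simp [rotation]
  nlinarith [sq_nonneg (x - y), sq_nonneg (x + y)]

/-- The end is a boundary point fixed by `z ↦ z / 2`, that is, `∞` or `0`. -/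
theorem endAt_of_half_smul {S : Tiling} (hS : IsHorospheric S) (h : dyad (-1) 0 • S = S) :
    EndAt 1 S ∨ EndAt (modular ModularGroup.S) S := by
  refine (exists_endAt hS).imp id ?_
  rintro ⟨ξ, hξ⟩
  have h1 := hξ.smul (dyad (-1) 0)
  rw [h] at h1
  have h2 := hξ.fixesInfty h1
  have e : (dyad 0 ξ * modular ModularGroup.S)⁻¹ * (dyad (-1) 0 * (dyad 0 ξ * modular ModularGroup.S)) =
      (modular ModularGroup.S)⁻¹ * dyad (-1) (-ξ / 2) * modular ModularGroup.S := by
    have : dyad (-1) (-ξ / 2) = (dyad 0 ξ)⁻¹ * (dyad (-1) 0 * dyad 0 ξ) := by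
      rw [dyad_mul, dyad_inv, dyad_mul]
      refine dyad_congr (by norm_num) ?_
      norm_num
      ring
    rw [this]
    group
  rw [e, dyad, fixesInfty_conj_S] at h2
  obtain rfl : ξ = 0 := by linarith
  rwa [dyad_zero_zero, one_mul] at hξ

theorem S_mul_S : modular ModularGroup.S * modular ModularGroup.S = 1 := by
  rw [← pow_two, modular_S_sq]

theorem not_fixesInfty_S : ¬ FixesInfty (modular ModularGroup.S) := by
  rw [fixesInfty_modular_iff]
  simp [ModularGroup.S]

theorem EndAt.translate_mem_endSet {S : Tiling} (hS : EndAt (modular ModularGroup.S) S) {x : ℝ}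
    (hx : 1 ≤ x) : modular ModularGroup.S • dyad 0 x • S ∈ endSet (-1) 0 := by
  refine ⟨-1 / x, ⟨?_, ?_⟩, ?_⟩
  · rw [le_div_iff₀ (by linarith)]; linarith
  · exact div_nonpos_of_nonpos_of_nonneg (by norm_num) (by linarith)
  · refine ((hS.smul (dyad 0 x)).smul (modular ModularGroup.S)).congr ?_
    rw [toG_affineMatrix_one, toG_affineMatrix_one, modular_S_eq, ← map_mul, ← map_mul, ← map_mul,
      ← map_inv, ← map_mul, fixesInfty_toG_iff]
    simp only [Matrix.SpecialLinearGroup.coe_mul, Matrix.SpecialLinearGroup.coe_inv,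
      Matrix.adjugate_fin_two]
    simp [Matrix.mul_apply, Fin.sum_univ_two, swapMatrix, affineMatrix]
    field_simp
    ring

/-- If the end were `0`, translation by `x = 2 ^ (n + 1)` would move it to `x`. Seen after the half
turn, the translates have ends `-1 / x` in `[-1, 0]`, so their limit has a finite end, whereas the
half turn takes the end `0` to `∞`. -/
theorem not_endAt_S {S : Tiling}
    (h : Tendsto (fun n : ℕ => dyad 0 (2 ^ (n + 1)) • S) atTop (𝓝 S)) :
    ¬ EndAt (modular ModularGroup.S) S := by
  intro hS
  have h1 : modular ModularGroup.S • S ∈ endSet (-1) 0 := by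
    refine (isClosed_endSet _ _).mem_of_tendsto
      (((continuous_const_smul (modular ModularGroup.S)).tendsto S).comp h)
      (Eventually.of_forall fun n => hS.translate_mem_endSet (one_le_pow₀ (by norm_num)))
  obtain ⟨ξ, -, hξ⟩ := h1
  have h2 := hS.smul (modular ModularGroup.S)
  rw [S_mul_S] at h2
  have h3 := h2.fixesInfty hξ
  rw [inv_one, one_mul] at h3
  have h4 := (fixesInfty_dyad 0 ξ).inv.mul h3
  rw [inv_mul_cancel_left] at h4
  exact not_fixesInfty_S h4

/-- Compare a tile with its image under `z ↦ z / 2`: the lattice condition makes its abscissa an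
integral multiple of its width. Hence there is a tile with abscissa `0`, and dilations and
neighbours produce all the others. -/
theorem eq_smul_solenoid_zero {S : Tiling} (hS : IsHorospheric S) (hE : EndAt 1 S)
    (h : ∀ j : ℤ, dyad j 0 • S = S) : ∃ (s : ℝ) (hs : 0 < s), S = affineMotion s 0 hs • solenoid 0 := by
  obtain ⟨p, hp⟩ := pos_nonempty S
  have hF := hE p hp
  rw [inv_one, one_mul] at hF
  obtain ⟨s, x, hs, rfl⟩ := hF
  have hhp : dyad (-1) 0 * affineMotion s x hs ∈ pos S := by
    have := mul_mem_pos_smul (g := dyad (-1) 0).mpr hp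
    rwa [h] at this
  obtain ⟨i, r, hir⟩ := hS.lattice _ hp _ hhp
  have e : (affineMotion s x hs)⁻¹ * (dyad (-1) 0 * affineMotion s x hs) = dyad (-1) (-x / (2 * s)) := by
    rw [dyad, dyad, affineMotion_mul, affineMotion_inv, affineMotion_mul]
    refine affineMotion_congr ?_ ?_
    · field_simp
    · norm_num
      field_simp
      ring
  rw [e] at hir
  obtain ⟨rfl, hr⟩ := dyad_inj hir
  norm_num at hr
  have hx : x = -(2 * s * r) := by
    rw [← hr]; field_simp
  have hp0 : affineMotion s 0 hs ∈ pos S := by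
    have := hS.neighbour _ hp r
    rw [dyad, affineMotion_mul] at this
    convert this using 1
    refine affineMotion_congr (by simp) ?_
    rw [hx]; ring
  refine ⟨s, hs, (tiling_eq_of_subset fun q hq => ?_).symm⟩
  rw [mem_pos_smul, mem_solenoid_zero] at hq
  obtain ⟨j, l, hq⟩ := hq
  rw [inv_mul_eq_iff_eq_mul] at hq
  have h1 : dyad j 0 * affineMotion s 0 hs ∈ pos S := by
    have := mul_mem_pos_smul (g := dyad j 0).mpr hp0
    rwa [h] at this
  have h2 := hS.neighbour _ h1 l
  convert h2 using 1
  rw [hq, dyad, dyad, dyad, affineMotion_mul, affineMotion_mul, affineMotion_mul]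
  refine affineMotion_congr (by simp [mul_comm]) ?_
  rw [zpow_add_one₀ (by norm_num)]
  ring

/-- Recurrence makes `2 ^ n / s` approach the integers. Once the error is small it doubles exactly
with each step, so it can remain small only if it is zero. -/
theorem exists_mul_eq_two_pow {s : ℝ} (hs : 0 < s) (h : Tendsto
    (fun n : ℕ => dyad 0 (2 ^ (n + 1)) • affineMotion s 0 hs • solenoid 0) atTop
    (𝓝 (affineMotion s 0 hs • solenoid 0))) : ∃ (N : ℕ) (r : ℤ), (2 : ℝ) ^ N = s * r := by
  have h1 : Tendsto (fun n : ℕ => dyad 0 (2 ^ (n + 1) / s) • solenoid 0) atTop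
      (𝓝 (solenoid 0)) := by
    have := ((continuous_const_smul (affineMotion s 0 hs)⁻¹).tendsto _).comp h
    rw [inv_smul_smul] at this
    refine this.congr fun n => ?_
    rw [Function.comp_apply, ← mul_smul, ← mul_smul]
    congr 1
    rw [dyad, dyad, affineMotion_inv, affineMotion_mul, affineMotion_mul]
    refine affineMotion_congr ?_ ?_
    · field_simp
    · field_simp
      ring
  obtain ⟨q, hq, hc⟩ := exists_conv_of_tendsto le_rfl h1 (one_mem_solenoid 0)
  have H : ∀ n, ∃ x : ℤ × ℤ, q n ∈ pos (dyad 0 (2 ^ (n + 1) / s) • solenoid 0) →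
      q n = dyad x.1 (2 ^ (x.1 + 1) * x.2 + 2 ^ (n + 1) / s) := by
    intro n
    by_cases hn : q n ∈ pos (dyad 0 (2 ^ (n + 1) / s) • solenoid 0)
    · have hn' := hn
      rw [mem_pos_smul, mem_solenoid_zero] at hn'
      obtain ⟨j, l, hjl⟩ := hn'
      refine ⟨(j, l), fun _ => ?_⟩
      rw [inv_mul_eq_iff_eq_mul.mp hjl, dyad_mul]
      exact dyad_congr (zero_add _) (by simp)
    · exact ⟨(0, 0), fun h => absurd h hn⟩
  choose x hx using H
  rw [← affineMotion_one_zero] at hc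
  obtain ⟨i, hi, hev, hlim⟩ := conv_dyad_level (hc.congr' (hq.mono fun n hn => hx n hn))
  obtain rfl : i = 0 := by
    have : (2 : ℝ) ^ i = 2 ^ (0 : ℤ) := by rw [← hi]; simp
    exact zpow_right_injective₀ (by norm_num) (by norm_num) this
  have hlim' : Tendsto (fun n => ((x n).2 : ℝ) + 2 ^ n / s) atTop (𝓝 0) := by
    have := (hlim.const_mul (1 / 2))
    rw [mul_zero] at this
    refine this.congr' (hev.mono fun n hn => ?_)
    rw [hn, pow_succ]
    norm_num
    ring
  obtain ⟨N, hN⟩ := eventually_atTop.mp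
    ((Metric.tendsto_nhds.mp hlim') (1 / 8) (by norm_num))
  simp only [Real.dist_eq, sub_zero] at hN
  have hstep : ∀ n ≥ N, (x (n + 1)).2 = 2 * (x n).2 := by
    intro n hn
    have h2 := abs_lt.mp (hN n hn)
    have h3 := abs_lt.mp (hN (n + 1) (by omega))
    rw [pow_succ] at h3
    have e : (2 : ℝ) ^ n * 2 / s = 2 * (2 ^ n / s) := by ring
    rw [e] at h3
    have h4 : ((x (n + 1)).2 : ℝ) - 2 * (x n).2 < 1 := by linarith [h2.1, h3.2]
    have h5 : -1 < ((x (n + 1)).2 : ℝ) - 2 * (x n).2 := by linarith [h2.2, h3.1]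
    have h4' : (x (n + 1)).2 - 2 * (x n).2 < 1 := by exact_mod_cast h4
    have h5' : -1 < (x (n + 1)).2 - 2 * (x n).2 := by exact_mod_cast h5
    omega
  have hdouble : ∀ k : ℕ, ((x (N + k)).2 : ℝ) + 2 ^ (N + k) / s =
      2 ^ k * ((x N).2 + 2 ^ N / s) := by
    intro k
    induction k with
    | zero => simp
    | succ k ih =>
      rw [← add_assoc, hstep (N + k) (by omega), pow_succ, pow_succ]
      push_cast
      linear_combination 2 * ih
  have hzero : ((x N).2 : ℝ) + 2 ^ N / s = 0 := by
    by_contra hne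
    have h2 : Tendsto (fun k : ℕ => (2 : ℝ) ^ k * |(x N).2 + 2 ^ N / s|) atTop atTop :=
      (tendsto_pow_atTop_atTop_of_one_lt (by norm_num)).atTop_mul_const (abs_pos.mpr hne)
    obtain ⟨k, hk⟩ := (h2.eventually_gt_atTop 1).exists
    have h3 := hN (N + k) (by omega)
    rw [hdouble, abs_mul, abs_of_pos (by positivity : (0 : ℝ) < 2 ^ k)] at h3
    linarith
  refine ⟨N, -(x N).2, ?_⟩
  push_cast
  field_simp at hzero
  linarith

/-- Equivariant continuous maps respect the limits of orbits. -/
theorem tendsto_equivariant {w w' : ℤ_[2]} {α : fixedSumSpace w → fixedSumSpace w'}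
    (hc : Continuous α) (hα : ∀ (g : G) T, α (g • T) = g • α T) {l : Filter ℕ} {g : ℕ → G}
    {T T' : fixedSumSpace w} (h : Tendsto (fun n => g n • T.1) l (𝓝 T'.1)) :
    Tendsto (fun n => g n • (α T).1) l (𝓝 (α T').1) := by
  have h1 : Tendsto (fun n => g n • T) l (𝓝 T') := tendsto_subtype_rng.mpr h
  have h2 := (continuous_subtype_val.tendsto _).comp ((hc.tendsto T').comp h1)
  refine h2.congr fun n => ?_
  rw [Function.comp_apply, Function.comp_apply, hα]
  rfl

/-- The horospheric tiling invariant under `z ↦ 2 * z` as a point of the fixed-sum space. -/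
def basePoint (w : ℤ_[2]) : fixedSumSpace w := ⟨solenoid 0, solenoid_mem_fixedSumSpace w⟩

/-- Dilation invariance and recurrence pass to the image. The former excludes fixed-sum tilings,
together they put the end at `∞`, and then `eq_smul_solenoid_zero` applies. -/
theorem exists_equivariant_basePoint {w w' : ℤ_[2]} {α : fixedSumSpace w → fixedSumSpace w'}
    (hc : Continuous α) (hα : ∀ (g : G) T, α (g • T) = g • α T) :
    ∃ (s : ℝ) (hs : 0 < s), (α (basePoint w)).1 = affineMotion s 0 hs • solenoid 0 ∧
      ∃ (N : ℕ) (r : ℤ), (2 : ℝ) ^ N = s * r := by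
  have hinv : ∀ j : ℤ, dyad j 0 • (α (basePoint w)).1 = (α (basePoint w)).1 := by
    intro j
    have h1 : dyad j 0 • basePoint w = basePoint w := Subtype.ext (dyad_smul_solenoid_zero j)
    have h2 := hα (dyad j 0) (basePoint w)
    rw [h1] at h2
    exact congrArg Subtype.val h2.symm
  have hlim : Tendsto (fun n : ℕ => dyad 0 (2 ^ (n + 1)) • (α (basePoint w)).1) atTop
      (𝓝 (α (basePoint w)).1) := tendsto_equivariant hc hα tendsto_pow_translate
  have hH : IsHorospheric (α (basePoint w)).1 := by
    refine (isFixedSum_or_isHorospheric (α (basePoint w)).2).resolve_left fun hf => ?_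
    obtain ⟨g, f, hf, e⟩ := isFixedSum_iff.mp hf
    have := hinv (-1)
    rw [e] at this
    exact half_smul_labelTiling_ne _ _ this
  have hE := (endAt_of_half_smul hH (hinv (-1))).resolve_right (not_endAt_S hlim)
  obtain ⟨s, hs, e⟩ := eq_smul_solenoid_zero hH hE hinv
  rw [e] at hlim
  exact ⟨s, hs, e, exists_mul_eq_two_pow hs hlim⟩

/-- An equivariant map alone may rescale by some `s` with `2 ^ N / s` integral. For a homeomorphism
the scale `t` of the inverse satisfies the same, and `t * s` is a power of two, so `s` is one as
well; `solenoid 0` is invariant under such dilations. -/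
theorem conjugacy_basePoint {w w' : ℤ_[2]} (α : fixedSumSpace w ≃ₜ fixedSumSpace w')
    (hα : ∀ (g : G) T, α (g • T) = g • α T) : α (basePoint w) = basePoint w' := by
  have hα' : ∀ (g : G) T, α.symm (g • T) = g • α.symm T := fun g T => by
    rw [Homeomorph.symm_apply_eq, hα, Homeomorph.apply_symm_apply]
  obtain ⟨s, hs, e, N, r, hr⟩ := exists_equivariant_basePoint α.continuous hα
  obtain ⟨t, ht, e', M, r', hr'⟩ := exists_equivariant_basePoint α.symm.continuous hα'
  have h1 : α (basePoint w) = affineMotion s 0 hs • basePoint w' := Subtype.ext e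
  have h2 : α.symm (basePoint w') = affineMotion t 0 ht • basePoint w := Subtype.ext e'
  have h3 : basePoint w' = (affineMotion t 0 ht * affineMotion s 0 hs) • basePoint w' := by
    rw [mul_smul, ← h1, ← hα, ← h2, Homeomorph.apply_symm_apply]
  have h4 : affineMotion t 0 ht * affineMotion s 0 hs ∈ pos (solenoid 0) := by
    have h5 : solenoid 0 = (affineMotion t 0 ht * affineMotion s 0 hs) • solenoid 0 :=
      congrArg Subtype.val h3
    rw [h5, mem_pos_smul, inv_mul_cancel]
    exact one_mem_solenoid 0
  obtain ⟨j, l, h5⟩ := mem_solenoid_zero.mp h4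
  rw [dyad, affineMotion_mul] at h5
  obtain ⟨h6, -⟩ := affineMotion_inj h5
  have hr0 : 0 < r := by
    have : (0 : ℝ) < s * r := by rw [← hr]; positivity
    exact_mod_cast (pos_iff_pos_of_mul_pos this).mp hs
  -- Multiply `2 ^ N = s * r` by `2 ^ M = t * r'` and insert `t * s = 2 ^ j`; the exponent
  -- `(-j).toNat` clears a possible denominator.
  have hdvd : ∃ b : ℕ, r ∣ 2 ^ b := by
    refine ⟨N + M + (-j).toNat, r' * 2 ^ j.toNat, ?_⟩
    have h7 : (2 : ℝ) ^ j * 2 ^ (-j).toNat = 2 ^ j.toNat := by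
      rw [← zpow_natCast, ← zpow_natCast, ← zpow_add₀ (by norm_num)]
      congr 1
      omega
    have h8 : (2 : ℝ) ^ (N + M + (-j).toNat) = r * (r' * 2 ^ j.toNat) := by
      rw [pow_add, pow_add, hr, hr', ← h7, ← h6]
      ring
    exact_mod_cast h8
  obtain ⟨b, hb⟩ := hdvd
  obtain ⟨i, -, hi⟩ := (Nat.dvd_prime_pow Nat.prime_two).mp (show r.natAbs ∣ 2 ^ b by
    simpa [Int.natAbs_pow] using Int.natAbs_dvd_natAbs.mpr hb)
  have hri : (r : ℝ) = 2 ^ i := by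
    have : r = 2 ^ i := by
      rw [← Int.natAbs_of_nonneg hr0.le, hi]; push_cast; rfl
    rw [this]; push_cast; rfl
  have hs2 : s = 2 ^ ((N : ℤ) - i) := by
    rw [hri] at hr
    rw [zpow_sub₀ (by norm_num), zpow_natCast, zpow_natCast, hr]
    field_simp
  refine h1.trans (Subtype.ext ?_)
  show affineMotion s 0 hs • solenoid 0 = solenoid 0
  rw [affineMotion_congr (ht := by positivity) hs2 rfl]
  exact dyad_smul_solenoid_zero _

theorem tendsto_appr (b : ℤ_[2]) : Tendsto (fun n => (((b.appr n : ℕ) : ℤ) : ℤ_[2])) atTop (𝓝 b) := by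
  rw [tendsto_iff_norm_sub_tendsto_zero]
  refine squeeze_zero (fun _ => norm_nonneg _) (fun n => ?_)
    (tendsto_pow_atTop_nhds_zero_of_lt_one (r := (2 : ℝ)⁻¹) (by norm_num) (by norm_num))
  rw [norm_sub_rev]
  have := (two_pow_dvd_iff_norm n _).mp (appr_dvd b n)
  rwa [zpow_neg, zpow_natCast, ← inv_pow] at this

theorem conjugacy_solenoid {w w' : ℤ_[2]} (α : fixedSumSpace w ≃ₜ fixedSumSpace w')
    (hα : ∀ (g : G) T, α (g • T) = g • α T) {b : ℤ_[2]} (hb : solenoid b ∈ fixedSumSpace w) :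
    (α ⟨solenoid b, hb⟩).1 = solenoid b := by
  have h1 := tendsto_translate_solenoid (tendsto_appr b)
  have h2 := tendsto_equivariant (T := basePoint w) (T' := ⟨solenoid b, hb⟩) α.continuous hα h1
  rw [conjugacy_basePoint α hα] at h2
  exact tiling_tendsto_unique le_rfl h2 h1

/-! ### Rigidity of conjugacies -/

theorem eventually_of_ultrafilter {p : ℕ → Prop}
    (h : ∀ U : Ultrafilter ℕ, (U : Filter ℕ) ≤ atTop → ∀ᶠ n in U, p n) : ∀ᶠ n in atTop, p n :=
  mem_iff_ultrafilter.mpr h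

/-- A motion that becomes trivial when conjugated by larger and larger dilations is a
translation. -/
theorem eq_translation_of_conv {κ : G} {x : ℕ → ℝ}
    (h : Conv atTop (fun n : ℕ => (dyad n (x n))⁻¹ * κ * dyad n (x n)) 1) :
    ∃ u : ℝ, κ = dyad 0 u := by
  obtain ⟨M, hM⟩ := toG_surjective κ
  have h10 : M 1 0 = 0 := by
    let D : ℕ → SL(2, ℝ) := fun n => affineMatrix (2 ^ (n : ℤ)) (x n) (by positivity)
    have e : ∀ n : ℕ, (dyad n (x n))⁻¹ * κ * dyad n (x n) = toG ((D n)⁻¹ * M * D n) := by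
      intro n
      rw [map_mul, map_mul, map_inv, hM]
      rfl
    have hz : ∀ z : ℍ, Tendsto (fun n => dist (toG ((D n)⁻¹ * M * D n) • z) z) atTop (𝓝 0) := by
      intro z
      have := (h z).dist (tendsto_const_nhds (x := z))
      simp only [one_smul, dist_self] at this
      simpa only [e] using this
    have h1 := (entries_tendsto_zero ctr_low.1 ctr_low.2 (hz _) (hz _)).1
    have h2 : ∀ n : ℕ, ((D n)⁻¹ * M * D n) 1 0 = 2 ^ n * M 1 0 := by
      intro n
      have hs : √((2 : ℝ) ^ (n : ℤ)) * √((2 : ℝ) ^ (n : ℤ)) = 2 ^ n := by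
        rw [Real.mul_self_sqrt (by positivity), zpow_natCast]
      simp only [Matrix.SpecialLinearGroup.coe_mul, Matrix.SpecialLinearGroup.coe_inv,
        Matrix.adjugate_fin_two]
      simp [Matrix.mul_apply, Matrix.vecMul, dotProduct, Fin.sum_univ_two, D, affineMatrix]
      rw [zpow_natCast] at hs
      linear_combination M 1 0 * hs
    simp only [h2] at h1
    by_contra hne
    have h3 : Tendsto (fun n : ℕ => (2 : ℝ) ^ n * |M 1 0|) atTop atTop :=
      (tendsto_pow_atTop_atTop_of_one_lt (by norm_num)).atTop_mul_const (abs_pos.mpr hne)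
    refine not_tendsto_nhds_of_tendsto_atTop h3 0 ?_
    have := h1.abs
    simpa [abs_mul] using this
  obtain ⟨s, y, hs, e⟩ := fixesInfty_of_entry h10
  rw [hM] at e
  refine ⟨y, ?_⟩
  have h1 : s = 1 := by
    have h2 := (tendsto_coe_iff.mp (h UpperHalfPlane.I)).2
    have h3 : ∀ n : ℕ, (((dyad n (x n))⁻¹ * κ * dyad n (x n)) • UpperHalfPlane.I).im = s := by
      intro n
      have : (2 : ℝ) ^ n ≠ 0 := by positivity
      rw [e, dyad_inv, mul_smul, mul_smul, dyad_im, affineMotion_im, dyad_im, zpow_neg]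
      simp
      field_simp
    simp only [h3, one_smul] at h2
    exact tendsto_nhds_unique tendsto_const_nhds h2
  rw [e, ← affineMotion_one_eq]
  exact affineMotion_congr h1 rfl

/-- A conjugacy moves the ancestors of a tile at the horoball at `∞` by one translation, far up. -/
theorem exists_translation_mem_pos {w w' : ℤ_[2]} (α : fixedSumSpace w ≃ₜ fixedSumSpace w')
    (hα : ∀ (g : G) T, α (g • T) = g • α T) {f : SL(2, ℤ) → ℤ_[2]} (hf : IsFixedSumLabel w f)
    (hT : labelTiling f hf.toIsLabel ∈ fixedSumSpace w) {g' : G} {f' : SL(2, ℤ) → ℤ_[2]}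
    (hf' : IsFixedSumLabel w' f')
    (hT' : (α ⟨labelTiling f hf.toIsLabel, hT⟩).1 = g' • labelTiling f' hf'.toIsLabel) :
    ∃ (u : ℝ) (N : ℕ), ∀ n ≥ N, dyad 0 u * dyad n (-((f 1).appr (n + 1) : ℤ)) ∈
      pos (g' • labelTiling f' hf'.toIsLabel) := by
  obtain ⟨a, ha⟩ : ∃ a, a = f 1 := ⟨_, rfl⟩
  obtain ⟨m, hm⟩ : ∃ m : ℕ → ℤ, m = fun n => ((a.appr (n + 1) : ℕ) : ℤ) := ⟨_, rfl⟩
  have hmd : ∀ n, (2 : ℤ_[2]) ^ (n + 1) ∣ a - m n := fun n => by rw [hm]; exact appr_dvd a _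
  have hm0 : ∀ n, 0 ≤ m n := fun n => by rw [hm]; exact Int.natCast_nonneg _
  have hm1 : ∀ n, m n < 2 ^ (n + 1) := fun n => by
    have := PadicInt.appr_lt a (n + 1)
    simp only [hm]
    exact_mod_cast this
  choose c hc using hmd
  obtain ⟨D, hD⟩ : ∃ D : ℕ → G, D = fun n : ℕ => dyad n (-m n) := ⟨_, rfl⟩
  obtain ⟨T', hTT⟩ : ∃ T', T' = g' • labelTiling f' hf'.toIsLabel := ⟨_, rfl⟩
  -- Viewed from the ancestors `D n`, the original tiling accumulates at solenoids. As `α` fixes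
  -- these, the same views of the image have the same limits.
  have hlim : ∀ U : Ultrafilter ℕ, (U : Filter ℕ) ≤ atTop →
      ∃ b, Tendsto (fun n => (D n)⁻¹ • T') U (𝓝 (solenoid b)) := by
    intro U hU
    obtain ⟨b, hb⟩ : ∃ b, Tendsto c U (𝓝 b) := ⟨_, Ultrafilter.le_nhds_lim (U.map c)⟩
    have h1 := tendsto_labelTiling_solenoid hU hf.toIsLabel (m := m) (a := c)
      (fun n => by rw [← ha]; exact hc n) hb
    have hmem : solenoid b ∈ fixedSumSpace w := mem_closure_of_tendsto h1
      (Eventually.of_forall fun n => isFixedSum_smul_labelTiling hf _)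
    have h2 := tendsto_equivariant (T := ⟨labelTiling f hf.toIsLabel, hT⟩)
      (T' := ⟨solenoid b, hmem⟩) α.continuous hα h1
    rw [conjugacy_solenoid α hα hmem, hT', ← hTT] at h2
    refine ⟨b, ?_⟩
    rw [hD]
    exact h2
  let low : ℍ := pt 1 (5 / 4) (by norm_num)
  -- Every solenoid contains the standard tile, so the `n`th view of the image has a tile `κ n`
  -- close to it, whichever solenoid is being approached.
  obtain ⟨κ, hκ, hd⟩ := exists_tendsto_zero_of_eventually (le_refl atTop)
    (fun n (p : G) => p ∈ pos ((D n)⁻¹ • T'))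
    (fun _ p => dist (p • ctr) ctr + dist (p • low) low) (fun _ _ => by positivity) (by
      intro ε hε
      refine eventually_of_ultrafilter fun U hU => ?_
      obtain ⟨b, hb⟩ := hlim U hU
      obtain ⟨q, hq, hcq⟩ := exists_conv_of_tendsto hU hb (one_mem_solenoid b)
      have h1 := ((hcq ctr).dist (tendsto_const_nhds (x := ctr))).add
        ((hcq low).dist (tendsto_const_nhds (x := low)))
      simp only [one_smul, dist_self, add_zero] at h1
      filter_upwards [hq, h1.eventually (gt_mem_nhds hε)] with n h2 h3 using ⟨q n, h2, h3⟩)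
  have hκc : Conv atTop κ 1 := by
    refine conv_of_two ctr_low.1 ctr_low.2 ?_ ?_
    · rw [one_smul, tendsto_iff_dist_tendsto_zero]
      exact squeeze_zero (fun _ => dist_nonneg) (fun n => le_add_of_nonneg_right dist_nonneg) hd
    · rw [one_smul, tendsto_iff_dist_tendsto_zero]
      exact squeeze_zero (fun _ => dist_nonneg) (fun n => le_add_of_nonneg_left dist_nonneg) hd
  -- These tiles lie eventually at positive levels, since a limit at bounded level would be
  -- fixed-sum and not a solenoid. A positive level is needed for the tile to have children.
  have hlevel : ∀ᶠ n in atTop, ∃ (γ : SL(2, ℤ)) (k : ℕ),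
      D n * κ n = g' * modular γ * dyad ((k + 1 : ℕ) : ℤ) 0 ∧ 2 ^ (k + 1 + 1) ∣ f' γ := by
    refine eventually_of_ultrafilter fun U hU => ?_
    obtain ⟨b, hb⟩ := hlim U hU
    have e : (fun n => (D n)⁻¹ • T') =
        fun n => ((D n)⁻¹ * g') • labelTiling f' hf'.toIsLabel := by
      funext n
      rw [mul_smul, hTT]
    have hκU : ∀ᶠ n in U, κ n ∈ pos (((D n)⁻¹ * g') • labelTiling f' hf'.toIsLabel) := by
      refine (hκ.filter_mono hU).mono fun n hn => ?_
      rw [mul_smul, ← hTT]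
      exact hn
    rw [e] at hb
    rcases label_dichotomy hU (g := fun n => (D n)⁻¹ * g') (f := fun _ => f') (fun _ => hf') hb hκU
      (hκc.mono hU) with ⟨g₁, f₁, hf₁, h1, -⟩ | ⟨γ, k, hk, h⟩
    · exfalso
      have := endAt_solenoid b
      rw [h1] at this
      exact not_endAt_labelTiling _ _ _ this
    · filter_upwards [h, hk.eventually_ge_atTop 1] with n ⟨h1, h2⟩ h3
      obtain ⟨i, hi⟩ : ∃ i, k n = i + 1 := ⟨k n - 1, by omega⟩
      rw [hi] at h1 h2
      refine ⟨γ n, i, ?_, h2⟩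
      rw [h1]
      group
  have hdig : ∀ n, ∃ b : ℕ, b < 2 ∧ D n = D (n + 1) * dyad (-1) b := by
    intro n
    have h1 : (2 : ℤ) ^ (n + 1) ∣ m (n + 1) - m n := by
      rw [← two_pow_dvd_int_iff]
      have h2 : (2 : ℤ_[2]) ^ (n + 1) ∣ a - m (n + 1) := by
        rw [hc (n + 1)]
        exact (pow_dvd_pow 2 (by omega)).mul_right _
      have h3 : (2 : ℤ_[2]) ^ (n + 1) ∣ a - m n := ⟨_, hc n⟩
      have := dvd_sub h3 h2
      push_cast
      simpa using this
    obtain ⟨b, hb⟩ := h1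
    have hpos : (0 : ℤ) < 2 ^ (n + 1) := by positivity
    have hb0 : -1 < b := by
      by_contra hcon
      have h2 : (2 : ℤ) ^ (n + 1) * b ≤ 2 ^ (n + 1) * (-1) :=
        mul_le_mul_of_nonneg_left (by omega) hpos.le
      have := hm0 (n + 1)
      have := hm1 n
      linarith
    have hb2 : b < 2 := by
      by_contra hcon
      have h2 : (2 : ℤ) ^ (n + 1) * 2 ≤ 2 ^ (n + 1) * b :=
        mul_le_mul_of_nonneg_left (by omega) hpos.le
      have := hm0 n
      have := hm1 (n + 1)
      rw [pow_succ] at this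
      linarith
    refine ⟨b.toNat, by omega, ?_⟩
    have hbr : ((b.toNat : ℕ) : ℝ) = b := by
      have : ((b.toNat : ℕ) : ℤ) = b := Int.toNat_of_nonneg (by omega)
      exact_mod_cast this
    have hb' : (m (n + 1) : ℝ) - m n = 2 ^ (n + 1) * b := by exact_mod_cast hb
    simp only [hD]
    rw [dyad_mul]
    refine dyad_congr (by push_cast; ring) ?_
    rw [hbr, zpow_natCast]
    linear_combination hb'
  choose b hb2 hbD using hdig
  -- The tile `κ n` and the child of `κ (n + 1)` on the side given by the digit `b n` are both tiles
  -- of the `n`th view close to the standard tile, so they are equal.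
  have hstep : ∀ᶠ n in atTop, D n * κ n = D (n + 1) * κ (n + 1) * dyad (-1) (b n) := by
    have hκ1 : Conv atTop (fun n => κ (n + 1)) 1 := fun z =>
      (hκc z).comp (tendsto_add_atTop_nat 1)
    refine eventually_of_ultrafilter fun U hU => ?_
    have hr : Conv U (fun n => (dyad (-1) (b n))⁻¹ * κ (n + 1) * dyad (-1) (b n)) 1 := by
      have hbc : (∀ᶠ n in U, b n = 0) ∨ ∀ᶠ n in U, b n = 1 := by
        rw [← Ultrafilter.eventually_or]
        exact Eventually.of_forall fun n => by have := hb2 n; omega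
      have aux : ∀ i : ℕ, (∀ᶠ n in U, b n = i) →
          Conv U (fun n => (dyad (-1) (b n))⁻¹ * κ (n + 1) * dyad (-1) (b n)) 1 := by
        intro i hi
        have := ((Conv.const (U : Filter ℕ) (dyad (-1) i)⁻¹).mul (hκ1.mono hU)).mul
          (Conv.const (U : Filter ℕ) (dyad (-1) i))
        rw [mul_one, inv_mul_cancel] at this
        refine this.congr' (hi.mono fun n hn => ?_)
        rw [hn]
      exact hbc.elim (aux 0) (aux 1)
    have hdist := (hr ctr).dist ((hκc.mono hU) ctr)
    rw [dist_self] at hdist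
    filter_upwards [hU ((tendsto_add_atTop_nat 1).eventually hlevel), hκ.filter_mono hU,
      hdist.eventually (gt_mem_nhds inrad_pos)] with n ⟨γ, k, h1, h2⟩ h3 h4
    have h5 : (D n)⁻¹ * (D (n + 1) * κ (n + 1) * dyad (-1) (b n)) =
        (dyad (-1) (b n))⁻¹ * κ (n + 1) * dyad (-1) (b n) := by
      rw [hbD n]
      group
    have h6 : (dyad (-1) (b n))⁻¹ * κ (n + 1) * dyad (-1) (b n) ∈ pos ((D n)⁻¹ • T') := by
      rw [← h5, mul_mem_pos_smul, h1, hTT]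
      have h7 := (mem_pos_smul_labelTiling hf'.toIsLabel g' γ k (-(2 ^ (k + 1) * b n))).mpr (by
        push_cast
        refine dvd_sub ((pow_dvd_pow 2 (by omega)).trans h2) ?_
        rw [dvd_neg]
        exact dvd_mul_right _ _)
      convert h7 using 1
      rw [mul_assoc _ (dyad _ _), dyad_mul]
      refine congrArg _ (dyad_congr (by push_cast; ring) ?_)
      rw [zpow_natCast]
      push_cast
      ring
    have h8 := pos_eq_of_dist h6 h3 h4
    rw [← h8, ← h5, mul_inv_cancel_left]
  obtain ⟨N, hN⟩ := eventually_atTop.mp (hstep.and hκ)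
  have hconst : ∀ n ≥ N, D n * κ n * (D n)⁻¹ = D N * κ N * (D N)⁻¹ := by
    intro n hn
    induction n, hn using Nat.le_induction with
    | base => rfl
    | succ n hn ih =>
      rw [← ih, (hN n hn).1, hbD n]
      group
  -- The motion from `D n` to the corresponding tile of the image is the same for all large `n`, and
  -- it becomes trivial in the coordinates of `D n`.
  obtain ⟨u, hu⟩ := eq_translation_of_conv (κ := D N * κ N * (D N)⁻¹) (x := fun n => -m n) (by
    refine hκc.congr' ?_
    filter_upwards [eventually_ge_atTop N] with n hn
    rw [← hconst n hn, hD]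
    group)
  refine ⟨u, N, fun n hn => ?_⟩
  have h1 := (hN n hn).2
  rw [← mul_mem_pos_smul (g := D n), smul_inv_smul] at h1
  have h2 : D n * κ n = dyad 0 u * D n := by
    rw [← hu, ← hconst n hn]
    group
  rw [h2, hTT, hD, hm, ha] at h1
  exact h1

/-! ### Comparison of the sums by means of a tiling with a rotational symmetry -/

theorem dyad_conj_rotation {j : ℤ} {y : ℝ} {η : SL(2, ℤ)}
    (h : modular rotation * dyad j y = dyad j y * modular η) : j = 0 ∧ ∃ B : ℤ, y = B := by
  have h1 : toG ((affineMatrix (2 ^ j) y (by positivity))⁻¹ *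
      Matrix.SpecialLinearGroup.map (Int.castRingHom ℝ) rotation *
      affineMatrix (2 ^ j) y (by positivity)) =
      toG (Matrix.SpecialLinearGroup.map (Int.castRingHom ℝ) η) := by
    rw [map_mul, map_mul, map_inv, mul_assoc, inv_mul_eq_iff_eq_mul]
    exact h
  obtain ⟨ε, hε, he⟩ := entries_of_toG_eq h1
  obtain ⟨s, hs⟩ : ∃ s : ℝ, s = 2 ^ j := ⟨_, rfl⟩
  have hs0 : 0 < s := by rw [hs]; positivity
  have hsq : √s * √s = s := Real.mul_self_sqrt hs0.le
  have hsq0 : √s ≠ 0 := (Real.sqrt_pos.mpr hs0).ne'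
  have e00 := he 0 0
  have e01 := he 0 1
  have e10 := he 1 0
  simp only [Matrix.SpecialLinearGroup.coe_mul, Matrix.SpecialLinearGroup.coe_inv,
    Matrix.adjugate_fin_two, Matrix.SpecialLinearGroup.map_apply_coe] at e00 e01 e10
  simp [Matrix.mul_apply, Matrix.vecMul, dotProduct, Fin.sum_univ_two, rotation, affineMatrix,
    ← hs] at e00 e01 e10
  obtain ⟨ε', rfl⟩ : ∃ ε' : ℤ, ε = ε' := by
    have h2 : (ε - 1) * (ε + 1) = 0 := by linear_combination hε
    rcases mul_eq_zero.mp h2 with h | h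
    · exact ⟨1, by push_cast; linarith⟩
    · exact ⟨-1, by push_cast; linarith⟩
  obtain ⟨A, hA⟩ : ∃ A : ℤ, s = A := ⟨-(ε' * η 1 0), by
    push_cast
    linear_combination -e10 - hsq⟩
  obtain ⟨B, hB⟩ : ∃ B : ℤ, y = B := ⟨ε' * η 0 0, by
    push_cast
    rw [← e00]
    field_simp⟩
  obtain ⟨C, hC⟩ : ∃ C : ℤ, y ^ 2 - y + 1 = s * C := ⟨ε' * η 0 1, by
    push_cast
    rw [← e01]
    nth_rewrite 1 [← hsq]
    field_simp
    ring⟩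
  -- Conjugating the rotation by `z ↦ s * z + y` gives entries `s`, `y` and `(y² - y + 1) / s` up to
  -- sign, so these are integers. As `y² - y + 1` is odd, the power of two `s` must be `1`.
  refine ⟨?_, B, hB⟩
  have hABC : B ^ 2 - B + 1 = A * C := by
    rw [hA, hB] at hC
    exact_mod_cast hC
  rw [hA] at hs hs0
  rcases lt_trichotomy j 0 with hj | hj | hj
  · exfalso
    have h2 : (2 : ℝ) ^ j < 1 := zpow_lt_one_of_neg₀ (by norm_num) hj
    rw [← hs] at h2
    have h3 : A < 1 := by exact_mod_cast h2
    have h4 : 0 < A := by exact_mod_cast hs0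
    omega
  · exact hj
  · exfalso
    obtain ⟨k, rfl⟩ : ∃ k : ℕ, j = (k + 1 : ℕ) := ⟨(j - 1).toNat, by omega⟩
    rw [zpow_natCast] at hs
    have h2 : A = 2 ^ (k + 1) := by exact_mod_cast hs
    have h3 : Even (B ^ 2 - B + 1) := by
      rw [hABC, h2, pow_succ]
      exact ⟨2 ^ k * C, by ring⟩
    have h4 : Even (B ^ 2 - B) := by
      have := Int.even_mul_pred_self B
      rwa [mul_sub, mul_one, ← pow_two] at this
    rcases h3 with ⟨u, hu⟩
    rcases h4 with ⟨v, hv⟩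
    omega

theorem exists_int_of_conjugate {w w' : ℤ_[2]}
    (h : TopologicallyConjugate G (fixedSumSpace w) (fixedSumSpace w')) :
    ∃ e : ℤ, w - w' = 3 * (e : ℤ_[2]) := by
  obtain ⟨α, hα⟩ := h
  obtain ⟨a, ha⟩ : ∃ a : ℤ_[2], 3 * a = w := by
    obtain ⟨v, hv⟩ := isUnit_three
    exact ⟨↑v⁻¹ * w, by rw [← hv, Units.mul_inv_cancel_left]⟩
  obtain ⟨f, hf, hf1, hrot⟩ := exists_label w a a
  replace hrot := hrot rfl ha.symm
  have hT : labelTiling f hf.toIsLabel ∈ fixedSumSpace w := by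
    have := isFixedSum_smul_labelTiling hf 1
    rw [one_smul] at this
    exact subset_closure this
  have hinv : modular rotation • labelTiling f hf.toIsLabel = labelTiling f hf.toIsLabel := by
    have := smul_labelTiling_modular hf.toIsLabel rotation
    simpa only [hrot] using this
  obtain ⟨T', hTT⟩ : ∃ T', T' = (α ⟨labelTiling f hf.toIsLabel, hT⟩).1 := ⟨_, rfl⟩
  have hinv' : modular rotation • T' = T' := by
    rw [hTT]
    have h1 := hα (modular rotation) ⟨labelTiling f hf.toIsLabel, hT⟩
    have h2 : modular rotation • (⟨labelTiling f hf.toIsLabel, hT⟩ : fixedSumSpace w) =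
        ⟨labelTiling f hf.toIsLabel, hT⟩ := Subtype.ext hinv
    rw [h2] at h1
    exact congrArg Subtype.val h1.symm
  -- A horospheric image would have its end fixed by the rotation, which fixes no boundary point.
  have hfix : T'.IsFixedSum w' := by
    have hmem : T' ∈ fixedSumSpace w' := by rw [hTT]; exact Subtype.coe_prop _
    refine (isFixedSum_or_isHorospheric hmem).resolve_right fun hH => ?_
    obtain ⟨p, hp⟩ := pos_nonempty T'
    have h1 := hH.endAt hp
    have h2 := h1.smul (modular rotation)
    rw [hinv'] at h2
    exact not_fixesInfty_conj_rotation p (h1.fixesInfty h2)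
  obtain ⟨g', f', hf', hT'⟩ := isFixedSum_iff.mp hfix
  obtain ⟨u, N, hN⟩ := exists_translation_mem_pos α hα hf hT hf' (hTT.symm.trans hT')
  rw [← hT'] at hN
  -- The translated ancestors are tiles of the image pointing to `∞`, so its packing is the standard
  -- one up to some `z ↦ 2 ^ j * z + y`. The common rotational symmetry then forces `j = 0` and `y`
  -- integral, so that the packing is the standard one itself.
  obtain ⟨f₁, hf₁, hT₁⟩ : ∃ (f₁ : SL(2, ℤ) → ℤ_[2]) (hf₁ : IsFixedSumLabel w' f₁),
      T' = labelTiling f₁ hf₁.toIsLabel := by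
    have h1 := hN N le_rfl
    rw [hT'] at h1
    obtain ⟨γ, k, h2, -⟩ := exists_of_mem_pos_smul_labelTiling h1
    have h3 : ∃ (j : ℤ) (y : ℝ), g' * modular γ = dyad j y := by
      have h4 := eq_mul_inv_of_mul_eq h2.symm
      rw [dyad_inv, dyad_mul, dyad_mul] at h4
      exact ⟨_, _, h4⟩
    obtain ⟨j, y, h3⟩ := h3
    have h4 : T' = dyad j y • labelTiling (fun δ => f' (γ * δ)) (hf'.comp_mul γ) := by
      rw [hT', ← h3, mul_smul, smul_labelTiling_modular]
    have h5 := hinv'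
    rw [h4, ← mul_smul] at h5
    obtain ⟨η, hη, -⟩ := smul_labelTiling_inj _ _ h5
    obtain ⟨rfl, B, rfl⟩ := dyad_conj_rotation hη
    refine ⟨fun δ => f' (γ * (ModularGroup.T ^ (-B) * δ)), (hf'.comp_left γ).comp_left _, ?_⟩
    rw [h4, ← modular_T_zpow]
    have h6 := smul_labelTiling_modular ((hf'.comp_left γ).comp_left (ModularGroup.T ^ (-B))).toIsLabel
      (ModularGroup.T ^ B)
    rw [← h6]
    congr 2
    funext δ
    congr 2
    group
  -- Uniqueness of labels gives invariance under an integral matrix with the same motion as the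
  -- rotation, that is, under the rotation up to sign.
  have hrot₁ : ∀ δ, f₁ (rotation * δ) = f₁ δ := by
    have h1 := hinv'
    rw [hT₁] at h1
    obtain ⟨γ, hγ, hf₁γ⟩ := smul_labelTiling_inj hf₁.toIsLabel hf₁.toIsLabel (g' := 1)
      (h1.trans (one_smul _ _).symm)
    rw [one_mul] at hγ
    obtain ⟨-, j, -, hj, hj0⟩ := modular_mul_dyad_inj (k := 0) (k' := 0) (x := 0) (x' := 0)
      (congrArg (· * dyad 0 0) hγ)
    obtain rfl : j = 0 := by simpa using hj0
    intro δ
    rw [hf₁γ δ]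
    rcases hj with hj | hj
    · rw [hj, zpow_zero, mul_one]
    · rw [hj, zpow_zero, mul_one, neg_mul, hf₁.neg]
  have hsum : 3 * f₁ 1 = w' := by
    have h1 := hf₁.sum 1
    have h2 := hrot₁ 1
    have h3 := hrot₁ rotation
    rw [mul_one] at h2
    rw [one_mul, one_mul, pow_two, h3, h2] at h1
    linear_combination h1
  -- The translated ancestor at level `n` is a tile of the image at `∞`, and its offset must
  -- represent the label `f₁ 1` modulo `2 ^ (n + 1)`. This shows that `u` is an integer.
  have hpos : ∀ n ≥ N, ∃ j : ℤ, u = ((a.appr (n + 1) : ℕ) : ℤ) - j ∧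
      (2 : ℤ_[2]) ^ (n + 1) ∣ f₁ 1 - j := by
    intro n hn
    have h1 := hN n hn
    rw [hT₁, hf1] at h1
    rw [← one_smul G (labelTiling f₁ hf₁.toIsLabel)] at h1
    obtain ⟨γ, k, h2, h3⟩ := exists_of_mem_pos_smul_labelTiling h1
    rw [one_mul, dyad_mul, ← one_mul (dyad _ _), ← map_one modular] at h2
    obtain ⟨hk, j, -, hj, hj0⟩ := modular_mul_dyad_inj h2
    have hk' : n = k := by simpa using hk
    subst hk'
    refine ⟨j, ?_, ?_⟩
    · simp at hj0
      push_cast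
      linarith
    · rw [hf₁.eq_add hj]
      simpa using h3
  obtain ⟨j₀, hj₀, -⟩ := hpos N le_rfl
  obtain ⟨v, hv⟩ : ∃ v : ℤ, u = v := ⟨((a.appr (N + 1) : ℕ) : ℤ) - j₀, by rw [hj₀]; push_cast; ring⟩
  -- The congruences hold modulo all powers of two, hence the labels `w / 3` and `w' / 3` differ
  -- exactly by the integer `v`.
  have hfa : f₁ 1 + v - a = 0 := by
    refine eq_zero_of_forall_dvd fun n => ?_
    obtain ⟨j, hj, hd⟩ := hpos (n + N) (by omega)
    refine (pow_dvd_pow 2 (show n + 1 ≤ n + N + 1 by omega)).trans ?_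
    have hj' : v = ((a.appr (n + N + 1) : ℕ) : ℤ) - j := by
      rw [hv] at hj
      exact_mod_cast hj
    have h1 := dvd_sub hd (appr_dvd a (n + N + 1))
    convert h1 using 1
    rw [hj']
    push_cast
    ring
  refine ⟨v, ?_⟩
  linear_combination (-1 : ℤ_[2]) * ha + hsum - 3 * hfa

end ModifiedBinary

end

theorem theorem5 (w w' : ℤ_[2]) :
    (ModifiedBinary.TopologicallyConjugate PSL(2, ℝ)
        (ModifiedBinary.fixedSumSpace w) (ModifiedBinary.fixedSumSpace w') ↔
      ∃ e : ℤ, w - w' = 3 * (e : ℤ_[2])) ∧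
    ModifiedBinary.AlmostConjugate PSL(2, ℝ)
        (ModifiedBinary.fixedSumSpace w) (ModifiedBinary.fixedSumSpace w') :=
  ⟨⟨ModifiedBinary.exists_int_of_conjugate,
    fun ⟨e, he⟩ => ModifiedBinary.topologicallyConjugate_of_sub e he⟩,
    ModifiedBinary.almostConjugate w w'⟩
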